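/- Let $N\ge 1$, $p,q>1$, $a,b>0$, and let $G_1,G_2\in C^1(\mathbb{R})$ satisfy $G_1(0)=G_2(0)=0$, $G_1(s)\ge a|s|^q$ and $G_2(\sigma)\ge b|\sigma|^p$ for all $s,\sigma\in\mathbb{R}$. Let $f_1,g_1,f_2,g_2\in C_c^\infty(\mathbb{R}^N)$ with $\int_{\mathbb{R}^N}g_1\,dx>0$ and $\int_{\mathbb{R}^N}g_2\,dx>0$, and put $r_0=\sup\{|x| : x\in\operatorname{supp}(f_1,f_2,g_1,g_2)\}$. For $\varepsilon>0$ consider $$\partial_t^2u-\Delta u=G_1(v),\qquad \partial_t^2v-\Delta v=G_2(\partial_tu)\qquad\text{in }\mathbb{R}^N\times(0,T),$$ $$u(0)=\varepsilon f_1,\quad \partial_tu(0)=\varepsilon g_1,\quad v(0)=\varepsilon f_2,\quad \partial_tv(0)=\varepsilon g_2 .$$ A weak solution in $(0,T)$, where $0<T<\infty$, is a pair $(u,v)\in C([0,T);H^1(\mathbb{R}^N)^2)\cap C^1([0,T);L^2(\mathbb{R}^N)^2)$ with $G_2(\partial_tu),\,G_1(v)\in L^1(0,T;L^1(\mathbb{R}^N))$,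 with the above initial values, such that for every $\Psi\in C_c^\infty(\mathbb{R}^N\times[0,T))$ $$\varepsilon\int_{\mathbb{R}^N} g_1\Psi(\cdot,0)\,dx+\int_0^T\!\!\int_{\mathbb{R}^N}G_1(v)\Psi\,dx\,dt=\int_0^T\!\!\int_{\mathbb{R}^N}\big(-\partial_tu\,\partial_t\Psi+\nabla u\cdot\nabla\Psi\big)\,dx\,dt,$$ $$\varepsilon\int_{\mathbb{R}^N} g_2\Psi(\cdot,0)\,dx+\int_0^T\!\!\int_{\mathbb{R}^N}G_2(\partial_tu)\Psi\,dx\,dt=\int_0^T\!\!\int_{\mathbb{R}^N}\big(-\partial_tv\,\partial_t\Psi+\nabla v\cdot\nabla\Psi\big)\,dx\,dt .$$ Put $$F_{SG,1}=\Big(\frac1p+1+q\Big)(pq-1)^{-1}-\frac{N-1}{2},\qquad F_{SG,2}=\Big(2+\frac1q\Big)(pq-1)^{-1}-\frac{N-1}{2},\qquad \Gamma_{SG}=\max\{F_{SG,1},F_{SG,2}\},$$ and suppose that $\Gamma_{SG}\ge0$. Then there are constants $\varepsilon_0>0$ and $C>0$, independent of $\varepsilon$, $T$ and $(u,v)$,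 such that for every $\varepsilon\in(0,\varepsilon_0]$, if $(u,v)$ is a weak solution in $(0,T)$ supported in $\{(x,t)\in\mathbb{R}^N\times[0,T) : |x|\le r_0+t\}$, then $$T\le\begin{cases}C\varepsilon^{-\Gamma_{SG}^{-1}}&\text{if }\Gamma_{SG}>0,\\ \exp\big(C\varepsilon^{-p(pq-1)}\big)&\text{if }F_{SG,1}=0>F_{SG,2},\\ \exp\big(C\varepsilon^{-q(pq-1)}\big)&\text{if }F_{SG,1}<0=F_{SG,2},\\ \exp\big(C\varepsilon^{-(pq-1)}\big)&\text{if }F_{SG,1}=0=F_{SG,2}.\end{cases}$$ -/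

import Mathlib

open MeasureTheory

namespace WaveSystem

noncomputable section

/-- The space `ℝ^N` with its Euclidean norm. -/
abbrev Space (N : ℕ) : Type := EuclideanSpace ℝ (Fin N)

/-- `L²(ℝ^N)`. -/
abbrev L2 (N : ℕ) : Type := Lp ℝ 2 (volume : Measure (Space N))

/-- `L²(ℝ^N; ℝ^N)`, the space in which gradients of `H¹` functions live. -/
abbrev L2Vec (N : ℕ) : Type := Lp (Space N) 2 (volume : Measure (Space N))

/-- `L¹(ℝ^N)`. -/
abbrev L1 (N : ℕ) : Type := Lp ℝ 1 (volume : Measure (Space N))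

/-- `f ∈ C_c^∞(ℝ^N)`. -/
def IsTestFun {N : ℕ} (f : Space N → ℝ) : Prop :=
  ContDiff ℝ (⊤ : ℕ∞) f ∧ HasCompactSupport f

/-- `W ∈ L²(ℝ^N; ℝ^N)` is the weak gradient of `w ∈ L²(ℝ^N)`;
`w ∈ H¹(ℝ^N)` means that such a `W` (which is then unique) exists. -/
def IsWeakGradient {N : ℕ} (w : L2 N) (W : L2Vec N) : Prop :=
  ∀ φ : Space N → ℝ, IsTestFun φ → ∀ e : Space N,
    ∫ x, w x * fderiv ℝ φ x e = - ∫ x, inner ℝ (W x) e * φ x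

/-- `u ∈ C([0,T); H¹(ℝ^N))`, and `Du` is its spatial gradient. -/
def IsContinuousH1Curve {N : ℕ} (T : ℝ) (u : ℝ → L2 N) (Du : ℝ → L2Vec N) : Prop :=
  (∀ t ∈ Set.Ico 0 T, IsWeakGradient (u t) (Du t)) ∧
    ContinuousOn u (Set.Ico 0 T) ∧ ContinuousOn Du (Set.Ico 0 T)

/-- `u ∈ C¹([0,T); L²(ℝ^N))`, and `ut` is its time derivative (one-sided at `t = 0`). -/
def IsC1L2Curve {N : ℕ} (T : ℝ) (u ut : ℝ → L2 N) : Prop :=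
  (∀ t ∈ Set.Ico 0 T, HasDerivWithinAt u (ut t) (Set.Ico 0 T) t) ∧
    ContinuousOn ut (Set.Ico 0 T)

/-- `h ∈ L¹(0,T; L¹(ℝ^N))`: up to null sets, `h` is a Bochner integrable curve in `L¹(ℝ^N)`. -/
def MemL1L1 {N : ℕ} (T : ℝ) (h : ℝ → Space N → ℝ) : Prop :=
  ∃ H : ℝ → L1 N, IntegrableOn H (Set.Ioo 0 T) ∧
    ∀ᵐ t ∂(volume.restrict (Set.Ioo 0 T)), (H t : Space N → ℝ) =ᵐ[volume] h t

/-- `Ψ ∈ C_c^∞(ℝ^N × [0,T))`, given as the restriction to `t ≥ 0` of a function in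
`C_c^∞(ℝ^N × (-∞,T))`. -/
def IsSpaceTimeTestFun {N : ℕ} (T : ℝ) (Ψ : Space N × ℝ → ℝ) : Prop :=
  ContDiff ℝ (⊤ : ℕ∞) Ψ ∧ HasCompactSupport Ψ ∧ tsupport Ψ ⊆ {z | z.2 < T}

/-- The integral form of `∂ₜ²u - Δu = h`, `∂ₜu(0) = ε g` on `ℝ^N × (0,T)`, where `ut` and `Du` are
the time derivative and the spatial gradient of `u`. -/
def SatisfiesWeakWaveEq {N : ℕ} (T ε : ℝ) (g : Space N → ℝ) (h : ℝ → Space N → ℝ)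
    (ut : ℝ → L2 N) (Du : ℝ → L2Vec N) : Prop :=
  ∀ Ψ : Space N × ℝ → ℝ, IsSpaceTimeTestFun T Ψ →
    ε * (∫ x, g x * Ψ (x, 0)) + (∫ t in Set.Ioo 0 T, ∫ x, h t x * Ψ (x, t)) =
      ∫ t in Set.Ioo 0 T, ∫ x,
        (-(ut t x * deriv (fun s : ℝ => Ψ (x, s)) t)
          + inner ℝ (Du t x) (gradient (fun y : Space N => Ψ (y, t)) x))

/-- `(u, v)` is a weak solution in `(0,T)` of
`∂ₜ²u - Δu = G₁(v)`, `∂ₜ²v - Δv = G₂(∂ₜu)`,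
`u(0) = ε f₁`, `∂ₜu(0) = ε g₁`, `v(0) = ε f₂`, `∂ₜv(0) = ε g₂`. -/
def IsWeakSolution {N : ℕ} (G₁ G₂ : ℝ → ℝ) (f₁ g₁ f₂ g₂ : Space N → ℝ) (ε T : ℝ)
    (u v : ℝ → L2 N) : Prop :=
  ∃ (ut vt : ℝ → L2 N) (Du Dv : ℝ → L2Vec N),
    IsContinuousH1Curve T u Du ∧ IsContinuousH1Curve T v Dv ∧
    IsC1L2Curve T u ut ∧ IsC1L2Curve T v vt ∧
    MemL1L1 T (fun t x => G₂ (ut t x)) ∧ MemL1L1 T (fun t x => G₁ (v t x)) ∧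
    (u 0 : Space N → ℝ) =ᵐ[volume] (fun x => ε * f₁ x) ∧
    (v 0 : Space N → ℝ) =ᵐ[volume] (fun x => ε * f₂ x) ∧
    (ut 0 : Space N → ℝ) =ᵐ[volume] (fun x => ε * g₁ x) ∧
    (vt 0 : Space N → ℝ) =ᵐ[volume] (fun x => ε * g₂ x) ∧
    SatisfiesWeakWaveEq T ε g₁ (fun t x => G₁ (v t x)) ut Du ∧
    SatisfiesWeakWaveEq T ε g₂ (fun t x => G₂ (ut t x)) vt Dv

/-- `r₀ = sup {|x| : x ∈ supp (f₁, f₂, g₁, g₂)}`. -/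
def dataRadius {N : ℕ} (f₁ g₁ f₂ g₂ : Space N → ℝ) : ℝ :=
  sSup ((fun x : Space N => ‖x‖) '' (tsupport f₁ ∪ tsupport f₂ ∪ tsupport g₁ ∪ tsupport g₂))

/-- `supp w ⊆ {(x,t) ∈ ℝ^N × [0,T) : |x| ≤ r + t}`. -/
def SupportedInCone {N : ℕ} (T r : ℝ) (w : ℝ → L2 N) : Prop :=
  ∀ t ∈ Set.Ico 0 T, ∀ᵐ x, r + t < ‖x‖ → w t x = 0

/-- `F_{SG,1}(N,p,q)`. -/
def FSG1 (N : ℕ) (p q : ℝ) : ℝ := (1 / p + 1 + q) * (p * q - 1)⁻¹ - ((N : ℝ) - 1) / 2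

/-- `F_{SG,2}(N,p,q)`. -/
def FSG2 (N : ℕ) (p q : ℝ) : ℝ := (2 + 1 / q) * (p * q - 1)⁻¹ - ((N : ℝ) - 1) / 2

/-- `Γ_{SG}(N,p,q)`. -/
def GammaSG (N : ℕ) (p q : ℝ) : ℝ := max (FSG1 N p q) (FSG2 N p q)

end

end WaveSystem

namespace WaveSystem

noncomputable section

/-- Coefficients of the power series `radialSeries ν`. -/
def radialCoeff (ν : ℝ) (k : ℕ) : ℝ := ∏ j ∈ Finset.range k, (2 * ((j : ℝ) + 1) * (2 * j + ν))⁻¹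

/-- The entire solution of `4 s h'' + 2 ν h' = h`, `h 0 = 1`; then `x ↦ h ‖x‖²` solves `Δφ = φ` in
dimension `ν`. -/
def radialSeries (ν s : ℝ) : ℝ := ∑' k, radialCoeff ν k * s ^ k

lemma radialCoeff_succ (ν : ℝ) (k : ℕ) :
    radialCoeff ν (k + 1) = radialCoeff ν k * (2 * ((k : ℝ) + 1) * (2 * k + ν))⁻¹ := by
  simp [radialCoeff, Finset.prod_range_succ]

lemma radialCoeff_pos {ν : ℝ} (hν : 1 ≤ ν) (k : ℕ) : 0 < radialCoeff ν k := by
  apply Finset.prod_pos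
  intro j _
  positivity

lemma radialCoeff_le {ν : ℝ} (hν : 1 ≤ ν) (k : ℕ) : radialCoeff ν k ≤ 1 / (k.factorial : ℝ) := by
  induction k with
  | zero => simp [radialCoeff]
  | succ k ih =>
    rw [radialCoeff_succ, Nat.factorial_succ]
    push_cast
    rw [one_div, mul_inv _ (k.factorial : ℝ), mul_comm, ← one_div (k.factorial : ℝ)]
    apply mul_le_mul _ ih (radialCoeff_pos hν k).le (by positivity)
    apply inv_anti₀ (by positivity)
    have : (0 : ℝ) ≤ k := by positivity
    nlinarith

lemma radialCoeff_add_two {ν : ℝ} (hν : 1 ≤ ν) (k : ℕ) :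
    ((k : ℝ) + 1) * radialCoeff ν (k + 1) = radialCoeff (ν + 2) k / (2 * ν) := by
  have hν0 : ν ≠ 0 := by positivity
  induction k with
  | zero => simp [radialCoeff]
  | succ k ih =>
    rw [radialCoeff_succ, radialCoeff_succ (ν + 2)]
    push_cast
    have h1 : ((k : ℝ) + 1) ≠ 0 := by positivity
    have h2 : (2 * (k : ℝ) + (ν + 2)) ≠ 0 := by positivity
    have h3 : (2 * ((k : ℝ) + 1) + ν) ≠ 0 := by positivity
    have h4 : ((k : ℝ) + 1 + 1) ≠ 0 := by positivity
    have : radialCoeff ν (k + 1) = radialCoeff (ν + 2) k / (2 * ν) / ((k : ℝ) + 1) := by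
      rw [← ih]; field_simp
    rw [this]
    have h5 : 2 * (k : ℝ) + (ν + 2) = 2 * ((k : ℝ) + 1) + ν := by ring
    rw [h5]
    field_simp

lemma summable_radialSeries {ν : ℝ} (hν : 1 ≤ ν) (s : ℝ) :
    Summable fun k => radialCoeff ν k * s ^ k := by
  refine Summable.of_norm_bounded (g := fun k : ℕ => |s| ^ k / (k.factorial : ℝ))
    (Real.summable_pow_div_factorial |s|) fun k => ?_
  rw [norm_mul, norm_pow, Real.norm_eq_abs, Real.norm_eq_abs, abs_of_pos (radialCoeff_pos hν k)]
  have := radialCoeff_le hν k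
  calc _ ≤ 1 / (k.factorial : ℝ) * |s| ^ k := by gcongr
    _ = _ := by ring

lemma hasDerivAt_radialSeries {ν : ℝ} (hν : 1 ≤ ν) (s : ℝ) :
    HasDerivAt (radialSeries ν) (radialSeries (ν + 2) s / (2 * ν)) s := by
  have hν0 : ν ≠ 0 := by positivity
  have hν2 : (1 : ℝ) ≤ ν + 2 := by linarith
  set ρ := |s| + 1 with hρ
  have hρ0 : 0 ≤ ρ := by positivity
  let g' : ℕ → ℝ → ℝ := fun k y => radialCoeff ν k * ((k : ℝ) * y ^ (k - 1))
  have hkey : ∀ (k : ℕ) (y : ℝ), g' (k + 1) y = (radialCoeff (ν + 2) k * y ^ k) / (2 * ν) := by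
    intro k y
    have := radialCoeff_add_two hν k
    simp only [g', Nat.add_sub_cancel]
    push_cast
    calc _ = (((k : ℝ) + 1) * radialCoeff ν (k + 1)) * y ^ k := by ring
      _ = _ := by rw [this]; ring
  have hu : Summable fun k : ℕ => g' k ρ := by
    rw [← summable_nat_add_iff 1]
    simp only [hkey]
    exact (summable_radialSeries hν2 ρ).div_const _
  have h := hasDerivAt_tsum_of_isPreconnected (u := fun k : ℕ => g' k ρ)
    (t := Set.Ioo (-ρ) ρ) (g := fun k y => radialCoeff ν k * y ^ k) (g' := g') (y₀ := s) (y := s)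
    hu isOpen_Ioo isPreconnected_Ioo
    (fun k y _ => (hasDerivAt_pow k y).const_mul _) ?_ ?_ (summable_radialSeries hν s) ?_
  · refine h.congr_deriv ?_
    have hs : Summable fun k : ℕ => g' k s := by
      rw [← summable_nat_add_iff 1]
      simp only [hkey]
      exact (summable_radialSeries hν2 s).div_const _
    rw [hs.tsum_eq_zero_add]
    simp only [hkey]
    simp [g', tsum_div_const, radialSeries]
  · intro k y hy
    have hy' : |y| ≤ ρ := abs_le.2 ⟨hy.1.le, hy.2.le⟩
    simp only [g', norm_mul, norm_pow, Real.norm_eq_abs, abs_of_pos (radialCoeff_pos hν k),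
      Nat.abs_cast]
    have := radialCoeff_pos hν k
    gcongr
  · exact ⟨by rw [hρ]; linarith [neg_abs_le s], by rw [hρ]; linarith [le_abs_self s]⟩
  · exact ⟨by rw [hρ]; linarith [neg_abs_le s], by rw [hρ]; linarith [le_abs_self s]⟩

lemma contDiff_radialSeries {ν : ℝ} (hν : 1 ≤ ν) : ContDiff ℝ (⊤ : ℕ∞) (radialSeries ν) := by
  rw [contDiff_infty]
  intro n
  induction n generalizing ν with
  | zero =>
    exact contDiff_zero.2
      (continuous_iff_continuousAt.2 fun s => (hasDerivAt_radialSeries hν s).continuousAt)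
  | succ n ih =>
    push_cast
    rw [contDiff_succ_iff_deriv]
    refine ⟨fun s => (hasDerivAt_radialSeries hν s).differentiableAt, by simp, ?_⟩
    have : deriv (radialSeries ν) = fun s => radialSeries (ν + 2) s / (2 * ν) :=
      funext fun s => (hasDerivAt_radialSeries hν s).deriv
    rw [this]
    exact (ih (by linarith)).div_const _

lemma radialSeries_ode {ν : ℝ} (hν : 1 ≤ ν) (s : ℝ) :
    s * radialSeries (ν + 4) s / (ν * (ν + 2)) + radialSeries (ν + 2) s = radialSeries ν s := by
  have h2 : (1 : ℝ) ≤ ν + 2 := by linarith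
  have h4 : (1 : ℝ) ≤ ν + 4 := by linarith
  have hν0 : ν ≠ 0 := by positivity
  have hν2 : ν + 2 ≠ 0 := by positivity
  unfold radialSeries
  rw [(summable_radialSeries h2 s).tsum_eq_zero_add, (summable_radialSeries hν s).tsum_eq_zero_add]
  have e : s * (∑' k, radialCoeff (ν + 4) k * s ^ k) / (ν * (ν + 2)) =
      ∑' k, (radialCoeff (ν + 4) k / (ν * (ν + 2))) * s ^ (k + 1) := by
    rw [← tsum_mul_left, ← tsum_div_const]
    congr 1; ext k; ring
  have hs : Summable fun k => (radialCoeff (ν + 4) k / (ν * (ν + 2))) * s ^ (k + 1) := by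
    have := ((summable_radialSeries h4 s).mul_left s).div_const (ν * (ν + 2))
    refine this.congr fun k => by ring
  rw [e, add_left_comm, ← hs.tsum_add ((summable_nat_add_iff 1).2 (summable_radialSeries h2 s))]
  simp only [radialCoeff, Finset.range_zero, Finset.prod_empty, pow_zero]
  congr 1
  congr 1
  ext k
  change radialCoeff (ν + 4) k / (ν * (ν + 2)) * s ^ (k + 1) + radialCoeff (ν + 2) (k + 1) * s ^ (k + 1)
    = radialCoeff ν (k + 1) * s ^ (k + 1)
  rw [← add_mul]
  congr 1
  have e1 := radialCoeff_add_two hν k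
  have e2 := radialCoeff_add_two h2 k
  have e3 := radialCoeff_succ (ν + 2) k
  have hk : (k : ℝ) + 1 ≠ 0 := by positivity
  have hk2 : 2 * (k : ℝ) + (ν + 2) ≠ 0 := by positivity
  rw [show ν + 2 + 2 = ν + 4 by ring] at e2
  have e2' : radialCoeff (ν + 4) k = (2 * (ν + 2)) * (((k : ℝ) + 1) * radialCoeff (ν + 2) (k + 1)) := by
    rw [e2]; field_simp
  have e1' : radialCoeff ν (k + 1) = radialCoeff (ν + 2) k / (2 * ν) / ((k : ℝ) + 1) := by
    rw [← e1]; field_simp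
  rw [e2', e1', e3]
  field_simp
  ring

lemma radialSeries_zero (ν : ℝ) : radialSeries ν 0 = 1 := by
  unfold radialSeries
  rw [tsum_eq_single 0 (fun k hk => by simp [hk])]
  simp [radialCoeff]

lemma one_le_radialSeries {ν : ℝ} (hν : 1 ≤ ν) {s : ℝ} (hs : 0 ≤ s) : 1 ≤ radialSeries ν s := by
  have := (summable_radialSeries hν s).sum_le_tsum (Finset.range 1)
    (fun k _ => mul_nonneg (radialCoeff_pos hν k).le (pow_nonneg hs k))
  rw [Finset.sum_range_one] at this
  rwa [pow_zero, mul_one, show radialCoeff ν 0 = 1 by simp [radialCoeff]] at this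

/-- The bound `h r² ≤ C (1 + r)^{-(ν-1)/2} e^r`. -/
lemma radialSeries_sq_le {ν : ℝ} (hν : 1 ≤ ν) : ∃ C : ℝ, 0 < C ∧ ∀ r : ℝ, 0 ≤ r →
    radialSeries ν (r ^ 2) ≤ C * (1 + r) ^ (-((ν - 1) / 2)) * Real.exp r := by
  have h2 : (1 : ℝ) ≤ ν + 2 := by linarith
  have h4 : (1 : ℝ) ≤ ν + 4 := by linarith
  have hν0 : ν ≠ 0 := by positivity
  have hν2 : ν + 2 ≠ 0 := by positivity
  set m := (ν - 1) / 2 with hm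
  have hm0 : 0 ≤ m := by rw [hm]; linarith
  set M := |m * (m - 1)| with hM
  set F : ℝ → ℝ := fun r => radialSeries ν (r ^ 2) with hF
  set F1 : ℝ → ℝ := fun r => radialSeries (ν + 2) (r ^ 2) / ν * r with hF1
  have dF : ∀ r, HasDerivAt F (F1 r) r := by
    intro r
    have := (hasDerivAt_radialSeries hν (r ^ 2)).comp r (hasDerivAt_pow 2 r)
    refine this.congr_deriv ?_
    simp only [hF1]; push_cast; field_simp
  have dF1 : ∀ r, 0 < r → HasDerivAt F1 (F r - 2 * m / r * F1 r) r := by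
    intro r hr
    have h := (hasDerivAt_radialSeries h2 (r ^ 2)).comp r (hasDerivAt_pow 2 r)
    have := (h.div_const ν).mul (hasDerivAt_id r)
    refine this.congr_deriv ?_
    simp only [hF1, hF, Function.comp_def, id]
    rw [← radialSeries_ode hν (r ^ 2), hm, show ν + 2 + 2 = ν + 4 by ring]
    push_cast
    field_simp
    ring
  have hFpos : ∀ r, 0 < F r := fun r => zero_lt_one.trans_le (one_le_radialSeries hν (sq_nonneg r))
  have hF1pos : ∀ r, 0 < r → 0 ≤ F1 r := fun r hr => by
    have := one_le_radialSeries h2 (sq_nonneg r)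
    simp only [hF1]; positivity
  -- the energy `e^{-r} (w + w')` of `w = r^m F`, with a decreasing correction
  set z : ℝ → ℝ := fun r => r ^ m * (F r + F1 r + m / r * F r) * Real.exp (M / r - r) with hz
  have dz : ∀ r, 0 < r → HasDerivAt z ((r ^ m * (m * (m - 1) / r ^ 2) * F r
      - M / r ^ 2 * (r ^ m * (F r + F1 r + m / r * F r))) * Real.exp (M / r - r)) r := by
    intro r hr
    have a1 : HasDerivAt (fun r : ℝ => r ^ m) (m * r ^ (m - 1)) r :=
      Real.hasDerivAt_rpow_const (Or.inl hr.ne')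
    have a2 : HasDerivAt (fun r : ℝ => m / r) (-(m / r ^ 2)) r := by
      have := (hasDerivAt_inv hr.ne').const_mul m
      refine this.congr_deriv ?_
      field_simp
    have a3 : HasDerivAt (fun r : ℝ => M / r - r) (-(M / r ^ 2) - 1) r := by
      have := ((hasDerivAt_inv hr.ne').const_mul M).sub (hasDerivAt_id r)
      refine this.congr_deriv ?_
      field_simp
    have := (a1.mul (((dF r).add (dF1 r hr)).add (a2.mul (dF r)))).mul a3.exp
    refine this.congr_deriv ?_
    rw [Real.rpow_sub_one hr.ne']
    simp only [Pi.mul_apply, Pi.add_apply]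
    field_simp
    ring
  have hanti : AntitoneOn z (Set.Ici 1) := by
    have hd : ∀ r ∈ Set.Ici (1 : ℝ), HasDerivAt z _ r := fun r hr =>
      dz r (lt_of_lt_of_le one_pos hr)
    apply antitoneOn_of_deriv_nonpos (convex_Ici 1)
    · exact fun r hr => (hd r hr).continuousAt.continuousWithinAt
    · intro r hr
      exact (hd r (interior_subset hr)).differentiableAt.differentiableWithinAt
    · intro r hr
      have hr1 : r ∈ Set.Ici (1 : ℝ) := interior_subset hr
      have hr0 : 0 < r := lt_of_lt_of_le one_pos hr1
      rw [(hd r hr1).deriv]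
      apply mul_nonpos_of_nonpos_of_nonneg _ (Real.exp_pos _).le
      have hFr := (hFpos r).le
      have hF1r := hF1pos r hr0
      have hw : 0 ≤ r ^ m := by positivity
      have e1 : r ^ m * (m * (m - 1) / r ^ 2) * F r ≤ M / r ^ 2 * (r ^ m * F r) := by
        have : m * (m - 1) ≤ M := le_abs_self _
        have : m * (m - 1) / r ^ 2 ≤ M / r ^ 2 := by gcongr
        calc _ = m * (m - 1) / r ^ 2 * (r ^ m * F r) := by ring
          _ ≤ _ := by gcongr
      have e2 : M / r ^ 2 * (r ^ m * F r) ≤ M / r ^ 2 * (r ^ m * (F r + F1 r + m / r * F r)) := by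
        have hM0 : 0 ≤ M := abs_nonneg _
        have : 0 ≤ m / r * F r := by positivity
        gcongr
        linarith
      linarith
  have hz1 : 0 < z 1 := by
    have h1 := hFpos 1
    have h2 := hF1pos 1 one_pos
    simp only [hz]
    positivity
  have hcont : Continuous F := continuous_iff_continuousAt.2 fun r => (dF r).continuousAt
  obtain ⟨B, hB⟩ := (isCompact_Icc (a := (0 : ℝ)) (b := 1)).exists_bound_of_continuousOn
    hcont.continuousOn
  have hB0 : 0 ≤ B := (norm_nonneg _).trans (hB 0 (by simp))
  refine ⟨2 ^ m * (z 1 + B), by positivity, fun r hr => ?_⟩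
  have hp1 : (0 : ℝ) < 1 + r := by positivity
  rw [Real.rpow_neg hp1.le]
  have hexp1 : 1 ≤ Real.exp r := Real.one_le_exp hr
  rcases le_total r 1 with h | h
  · have h1 : F r ≤ B := (le_abs_self _).trans (hB r ⟨hr, h⟩)
    have h2 : (1 + r) ^ m ≤ 2 ^ m := Real.rpow_le_rpow hp1.le (by linarith) hm0
    have h3 : 1 ≤ 2 ^ m * ((1 + r) ^ m)⁻¹ := by
      rw [← div_eq_mul_inv, one_le_div (by positivity)]; exact h2
    calc F r ≤ z 1 + B := by linarith
      _ = 1 * (z 1 + B) * 1 := by ring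
      _ ≤ (2 ^ m * ((1 + r) ^ m)⁻¹) * (z 1 + B) * Real.exp r := by gcongr
      _ = _ := by ring
  · have hr0 : 0 < r := by linarith
    have h1 : z r ≤ z 1 := hanti (by simp) h h
    have h2 : r ^ m * F r * Real.exp (-r) ≤ z r := by
      simp only [hz]
      have hFr := hFpos r
      have hF1r := hF1pos r hr0
      have hM0 : 0 ≤ M / r := by positivity
      have : 0 ≤ m / r * F r := by positivity
      gcongr
      · linarith
      · linarith
    have h3 : (1 + r) ^ m ≤ 2 ^ m * r ^ m := by
      rw [← Real.mul_rpow (by norm_num) hr]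
      exact Real.rpow_le_rpow hp1.le (by linarith) hm0
    have h4 : F r = (r ^ m * F r * Real.exp (-r)) * (r ^ m)⁻¹ * Real.exp r := by
      rw [Real.exp_neg]; field_simp
    have h5 : (r ^ m)⁻¹ ≤ 2 ^ m * ((1 + r) ^ m)⁻¹ := by
      rw [← div_eq_mul_inv, inv_eq_one_div, div_le_div_iff₀ (by positivity) (by positivity)]
      linarith
    change F r ≤ _
    rw [h4]
    calc _ ≤ (z 1 + B) * (2 ^ m * ((1 + r) ^ m)⁻¹) * Real.exp r := by
          gcongr
          linarith
      _ = _ := by ring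

end

noncomputable section

variable {N : ℕ}

/-- The Laplacian in coordinates. -/
def coordLaplacian (f : Space N → ℝ) (x : Space N) : ℝ :=
  ∑ i, fderiv ℝ (fun y => fderiv ℝ f y (EuclideanSpace.single i 1)) x (EuclideanSpace.single i 1)

lemma coordLaplacian_congr {f g : Space N → ℝ} {x : Space N} (h : f =ᶠ[nhds x] g) :
    coordLaplacian f x = coordLaplacian g x := by
  unfold coordLaplacian
  refine Finset.sum_congr rfl fun i _ => ?_
  have : (fun y => fderiv ℝ f y (EuclideanSpace.single i 1)) =ᶠ[nhds x]
      fun y => fderiv ℝ g y (EuclideanSpace.single i 1) := by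
    filter_upwards [h.fderiv (𝕜 := ℝ)] with y hy
    rw [hy]
  rw [this.fderiv_eq]

/-- The radial positive solution of `Δφ = l² φ` with `φ 0 = 1`. -/
def radialSol (N : ℕ) (l : ℝ) (x : Space N) : ℝ := radialSeries N (l ^ 2 * ‖x‖ ^ 2)

lemma contDiff_radialSol (hN : 1 ≤ N) (l : ℝ) : ContDiff ℝ (⊤ : ℕ∞) (radialSol N l) :=
  (contDiff_radialSeries (by exact_mod_cast hN)).comp
    (contDiff_const.mul (contDiff_norm_sq ℝ))

lemma one_le_radialSol (hN : 1 ≤ N) (l : ℝ) (x : Space N) : 1 ≤ radialSol N l x :=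
  one_le_radialSeries (by exact_mod_cast hN) (by positivity)

lemma radialSol_zero_left (x : Space N) : radialSol N 0 x = 1 := by
  simp [radialSol, radialSeries_zero]

lemma coordLaplacian_radialSol (hN : 1 ≤ N) (l : ℝ) (x : Space N) :
    coordLaplacian (radialSol N l) x = l ^ 2 * radialSol N l x := by
  have hN1 : (1 : ℝ) ≤ N := by exact_mod_cast hN
  have hN3 : (1 : ℝ) ≤ N + 2 := by linarith
  have hN0 : (N : ℝ) ≠ 0 := by positivity
  have d : ∀ (ν : ℝ), 1 ≤ ν → ∀ (y e : Space N),
      HasFDerivAt (fun y : Space N => radialSeries ν (l ^ 2 * ‖y‖ ^ 2))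
        ((radialSeries (ν + 2) (l ^ 2 * ‖y‖ ^ 2) / (2 * ν)) • (l ^ 2 • (2 • innerSL ℝ y))) y := by
    intro ν hν y e
    exact (hasDerivAt_radialSeries hν _).comp_hasFDerivAt y
      ((hasStrictFDerivAt_norm_sq y).hasFDerivAt.const_mul (l ^ 2))
  have d1 : ∀ (y e : Space N), fderiv ℝ (radialSol N l) y e =
      (l ^ 2 / N) * (radialSeries (N + 2) (l ^ 2 * ‖y‖ ^ 2) * inner ℝ y e) := by
    intro y e
    rw [show radialSol N l = fun y : Space N => radialSeries N (l ^ 2 * ‖y‖ ^ 2) from rfl,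
      (d N hN1 y e).fderiv]
    simp
    field_simp
  have d2 : ∀ (e : Space N), fderiv ℝ (fun y => fderiv ℝ (radialSol N l) y e) x e =
      (l ^ 2 / N) * (radialSeries (N + 2) (l ^ 2 * ‖x‖ ^ 2) * inner ℝ e e +
        inner ℝ x e * (l ^ 2 / (N + 2) * (radialSeries (N + 4) (l ^ 2 * ‖x‖ ^ 2) * inner ℝ x e))) := by
    intro e
    simp_rw [d1]
    have h1 : HasFDerivAt (fun y : Space N => (inner ℝ y e : ℝ)) (innerSL ℝ e) x := by
      have := (innerSL ℝ e).hasFDerivAt (x := x)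
      refine this.congr_of_eventuallyEq (Filter.Eventually.of_forall fun y => ?_)
      simp [real_inner_comm]
    have h := ((d (N + 2) hN3 x e).mul h1).const_mul (l ^ 2 / (N : ℝ))
    have h' : fderiv ℝ (fun y => l ^ 2 / (N : ℝ) *
        (radialSeries (N + 2) (l ^ 2 * ‖y‖ ^ 2) * inner ℝ y e)) x = _ := h.fderiv
    rw [h', show ((N : ℝ) + 2 + 2) = N + 4 by ring]
    have : (N : ℝ) + 2 ≠ 0 := by positivity
    simp
    field_simp
  unfold coordLaplacian
  simp_rw [d2, ← Finset.mul_sum, Finset.sum_add_distrib]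
  have s1 : ∀ i : Fin N, inner ℝ x (EuclideanSpace.single i (1 : ℝ)) = x i := by
    intro i; simp [EuclideanSpace.inner_single_right]
  have s2 : ∀ i : Fin N, inner ℝ (EuclideanSpace.single i (1 : ℝ) : Space N)
      (EuclideanSpace.single i (1 : ℝ)) = 1 := by
    intro i; simp
  simp_rw [s1, s2]
  have s3 : ∑ i : Fin N, x i * (l ^ 2 / ((N : ℝ) + 2) * (radialSeries (N + 4) (l ^ 2 * ‖x‖ ^ 2) * x i))
      = l ^ 2 / ((N : ℝ) + 2) * radialSeries (N + 4) (l ^ 2 * ‖x‖ ^ 2) * ‖x‖ ^ 2 := by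
    generalize radialSeries (N + 4) (l ^ 2 * ‖x‖ ^ 2) = A
    rw [EuclideanSpace.real_norm_sq_eq, Finset.mul_sum]
    refine Finset.sum_congr rfl fun i _ => ?_
    ring
  rw [s3, Finset.sum_const, Finset.card_univ, Fintype.card_fin, radialSol,
    ← radialSeries_ode hN1 (l ^ 2 * ‖x‖ ^ 2)]
  have : (N : ℝ) + 2 ≠ 0 := by positivity
  simp
  field_simp
  ring

lemma radialSol_le (hN : 1 ≤ N) : ∃ C : ℝ, 0 < C ∧ ∀ l : ℝ, 0 ≤ l → ∀ x : Space N,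
    radialSol N l x ≤ C * (1 + l * ‖x‖) ^ (-(((N : ℝ) - 1) / 2)) * Real.exp (l * ‖x‖) := by
  obtain ⟨C, hC, h⟩ := radialSeries_sq_le (ν := N) (by exact_mod_cast hN)
  refine ⟨C, hC, fun l hl x => ?_⟩
  have := h (l * ‖x‖) (by positivity)
  rwa [mul_pow] at this

lemma continuous_radialSol_uncurry (hN : 1 ≤ N) :
    Continuous fun z : ℝ × Space N => radialSol N z.1 z.2 :=
  (contDiff_radialSeries (by exact_mod_cast hN)).continuous.comp (by fun_prop)

/-- For small `l` the data of a solution, paired with `e^{-lt} φ_l`, have the sign of `∫ g`. -/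
lemma exists_data_lower_bound (hN : 1 ≤ N) {f g : Space N → ℝ} (hf : IsTestFun f) (hg : IsTestFun g)
    (hI : 0 < ∫ x, g x) : ∃ l₀ : ℝ, 0 < l₀ ∧ ∀ l, 0 ≤ l → l ≤ l₀ →
      (∫ x, g x) / 2 ≤ (∫ x, g x * radialSol N l x) + l * ∫ x, f x * radialSol N l x := by
  have hc : ∀ f : Space N → ℝ, IsTestFun f → Continuous fun l : ℝ => ∫ x, f x * radialSol N l x := by
    intro f hf
    have h1 : ∀ l : ℝ, ∫ x, f x * radialSol N l x = ∫ x in tsupport f, f x * radialSol N l x := by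
      intro l
      refine (setIntegral_eq_integral_of_forall_compl_eq_zero fun x hx => ?_).symm
      rw [image_eq_zero_of_notMem_tsupport hx, zero_mul]
    simp_rw [h1]
    refine continuous_parametric_integral_of_continuous ?_ hf.2
    exact (hf.1.continuous.comp continuous_snd).mul (continuous_radialSol_uncurry hN)
  have hcont : Continuous fun l : ℝ => (∫ x, g x * radialSol N l x) + l * ∫ x, f x * radialSol N l x :=
    (hc g hg).add (continuous_id.mul (hc f hf))
  have h0 := hcont.continuousAt (x := 0)
  have hlt : (∫ x, g x) / 2 < (∫ x, g x * radialSol N 0 x) + 0 * ∫ x, f x * radialSol N 0 x := by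
    simp [radialSol_zero_left]
    linarith
  have hev := h0.eventually (lt_mem_nhds hlt)
  obtain ⟨δ, hδ, h⟩ := Metric.eventually_nhds_iff.1 hev
  refine ⟨δ / 2, by positivity, fun l hl hl2 => (h ?_).le⟩
  rw [Real.dist_eq, sub_zero, abs_of_nonneg hl]
  linarith

/-- Every smooth function agrees on a given ball with a test function. -/
lemma exists_testFun_eq {φ : Space N → ℝ} (hφ : ContDiff ℝ (⊤ : ℕ∞) φ) {ρ : ℝ} (hρ : 0 < ρ) :
    ∃ ϕ : Space N → ℝ, IsTestFun ϕ ∧ ∀ x, ‖x‖ < ρ → ϕ =ᶠ[nhds x] φ := by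
  let χ : ContDiffBump (0 : Space N) := ⟨ρ, ρ + 1, hρ, by linarith⟩
  refine ⟨fun x => χ x * φ x, ⟨χ.contDiff.mul hφ, χ.hasCompactSupport.mul_right⟩, fun x hx => ?_⟩
  have : Metric.ball (0 : Space N) ρ ∈ nhds x :=
    Metric.isOpen_ball.mem_nhds (by simpa using hx)
  filter_upwards [this] with y hy
  rw [χ.one_of_mem_closedBall (Metric.ball_subset_closedBall hy), one_mul]

lemma IsTestFun.fderiv_apply {φ : Space N → ℝ} (hφ : IsTestFun φ) (e : Space N) :
    IsTestFun fun x => fderiv ℝ φ x e :=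
  ⟨(hφ.1.fderiv_right (m := (⊤ : ℕ∞)) (by simp)).clm_apply contDiff_const,
    hφ.2.fderiv_apply (𝕜 := ℝ) e⟩

lemma IsTestFun.memLp {φ : Space N → ℝ} (hφ : IsTestFun φ) : MemLp φ 2 volume :=
  hφ.1.continuous.memLp_of_hasCompactSupport hφ.2

lemma IsTestFun.integrable_mul {φ : Space N → ℝ} (hφ : IsTestFun φ) (w : L2 N) :
    Integrable fun x => w x * φ x :=
  (Lp.memLp w).integrable_mul hφ.memLp

lemma integrable_inner_mul_testFun {φ : Space N → ℝ} (hφ : IsTestFun φ) (W : L2Vec N) (e : Space N) :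
    Integrable fun x => inner ℝ (W x) e * φ x :=
  MemLp.integrable_mul (p := 2) (q := 2) ((Lp.memLp W).inner_const e) hφ.memLp

lemma inner_gradient_eq_sum (φ : Space N → ℝ) (w x : Space N) :
    inner ℝ w (gradient φ x) = ∑ i, inner ℝ w (EuclideanSpace.single i 1) *
      fderiv ℝ φ x (EuclideanSpace.single i 1) := by
  rw [real_inner_comm, gradient, InnerProductSpace.toDual_symm_apply]
  have : w = ∑ i, (w i) • (EuclideanSpace.single i (1 : ℝ) : Space N) := by
    ext j
    simp [Finset.sum_apply, Pi.single_apply]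
  conv_lhs => rw [this]
  rw [map_sum]
  refine Finset.sum_congr rfl fun i _ => ?_
  simp [EuclideanSpace.inner_single_right]

lemma integrable_inner_gradient {φ : Space N → ℝ} (hφ : IsTestFun φ) (W : L2Vec N) :
    Integrable fun x => inner ℝ (W x) (gradient φ x) := by
  simp_rw [fun x => inner_gradient_eq_sum φ (W x) x]
  exact integrable_finsetSum _ fun i _ => integrable_inner_mul_testFun (hφ.fderiv_apply _) W _

lemma IsWeakGradient.integral_inner_gradient {w : L2 N} {W : L2Vec N} (h : IsWeakGradient w W)
    {φ : Space N → ℝ} (hφ : IsTestFun φ) :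
    ∫ x, inner ℝ (W x) (gradient φ x) = - ∫ x, w x * coordLaplacian φ x := by
  simp_rw [fun x => inner_gradient_eq_sum φ (W x) x]
  rw [integral_finsetSum _ fun i _ => integrable_inner_mul_testFun (hφ.fderiv_apply _) W _]
  unfold coordLaplacian
  simp_rw [Finset.mul_sum]
  rw [integral_finsetSum _ fun i _ => ((hφ.fderiv_apply _).fderiv_apply _).integrable_mul w,
    ← Finset.sum_neg_distrib]
  refine Finset.sum_congr rfl fun i _ => ?_
  rw [h _ (hφ.fderiv_apply _), neg_neg]

end

noncomputable section

/-- A smooth even cutoff in time, equal to `1` on `[-1/2, 1/2]` and to `0` outside `(-1, 1)`, whose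
first two derivatives are controlled by the power `κ` of the function itself. -/
structure IsCutoff (s : ℝ → ℝ) (κ C : ℝ) : Prop where
  pos : 0 < κ
  contDiff : ContDiff ℝ (⊤ : ℕ∞) s
  nonneg : ∀ t, 0 ≤ s t
  le_one : ∀ t, s t ≤ 1
  eq_one : ∀ t, |t| ≤ 1 / 2 → s t = 1
  eq_zero : ∀ t, 1 ≤ |t| → s t = 0
  anti : ∀ t t', |t| ≤ |t'| → s t' ≤ s t
  deriv_le : ∀ t, |deriv s t| ≤ C * s t ^ κ
  deriv2_le : ∀ t, |deriv (deriv s) t| ≤ C * s t ^ κ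

lemma exists_isCutoff {κ : ℝ} (hκ0 : 0 < κ) (hκ : κ < 1) : ∃ s C, 0 < C ∧ IsCutoff s κ C := by
  let η : ℝ → ℝ := fun t => Real.smoothTransition (2 - 2 * t ^ 2)
  have hη : ContDiff ℝ (⊤ : ℕ∞) η := Real.smoothTransition.contDiff.comp (by fun_prop)
  have η0 : ∀ t, 0 ≤ η t := fun t => Real.smoothTransition.nonneg _
  have η1 : ∀ t, η t ≤ 1 := fun t => Real.smoothTransition.le_one _
  have ηz : ∀ t, 1 ≤ |t| → η t = 0 := fun t ht =>
    Real.smoothTransition.zero_of_nonpos (by have := one_le_sq_iff_one_le_abs t |>.2 ht; linarith)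
  have hcs : HasCompactSupport η := HasCompactSupport.intro (K := Set.Icc (-1) 1) isCompact_Icc
    fun t ht => ηz t (by by_contra h; exact ht (abs_le.1 (not_le.1 h).le))
  have hη' : ContDiff ℝ (⊤ : ℕ∞) (deriv η) := by
    have : ContDiff ℝ ((⊤ : ℕ∞) + 1) η := by simpa using hη
    exact (contDiff_succ_iff_deriv.1 this).2.2
  have hη'' : Continuous (deriv (deriv η)) := hη'.continuous_deriv (by simp)
  obtain ⟨B1, hB1⟩ := hη'.continuous.bounded_above_of_compact_support hcs.deriv
  obtain ⟨B2, hB2⟩ := hη''.bounded_above_of_compact_support hcs.deriv.deriv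
  have hB10 : 0 ≤ B1 := (norm_nonneg _).trans (hB1 0)
  have hB20 : 0 ≤ B2 := (norm_nonneg _).trans (hB2 0)
  obtain ⟨j, hj⟩ := exists_nat_ge (2 * κ / (1 - κ))
  have hjκ : ((j : ℝ) + 2) * κ ≤ j := by
    rw [div_le_iff₀ (by linarith)] at hj
    linarith
  have d : ∀ t, HasDerivAt η (deriv η t) t := fun t => (hη.differentiable (by simp) t).hasDerivAt
  have d' : ∀ t, HasDerivAt (deriv η) (deriv (deriv η) t) t := fun t =>
    (hη'.differentiable (by simp) t).hasDerivAt
  have e1 : deriv (fun t => η t ^ (j + 2)) = fun t => ((j : ℝ) + 2) * η t ^ (j + 1) * deriv η t := by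
    ext t
    rw [((d t).fun_pow (j + 2)).deriv]
    push_cast
    simp
  have e2 : deriv (deriv fun t => η t ^ (j + 2)) = fun t => ((j : ℝ) + 2) * ((j : ℝ) + 1) * η t ^ j *
      deriv η t ^ 2 + ((j : ℝ) + 2) * η t ^ (j + 1) * deriv (deriv η) t := by
    ext t
    rw [e1, ((((d t).fun_pow (j + 1)).const_mul ((j : ℝ) + 2)).fun_mul (d' t)).deriv]
    push_cast
    simp
    ring
  have hpow : ∀ t, η t ^ j ≤ (η t ^ (j + 2)) ^ κ := by
    intro t
    rw [← Real.rpow_natCast, ← Real.rpow_natCast, ← Real.rpow_mul (η0 t)]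
    rcases (η0 t).eq_or_lt with h | h
    · have hj0 : (0 : ℝ) < j := by nlinarith [(Nat.cast_nonneg j : (0 : ℝ) ≤ j)]
      rw [← h, Real.zero_rpow hj0.ne']
      positivity
    · exact Real.rpow_le_rpow_of_exponent_ge h (η1 t) (by push_cast; linarith)
  have hpow1 : ∀ t, η t ^ (j + 1) ≤ (η t ^ (j + 2)) ^ κ := fun t =>
    (pow_le_pow_of_le_one (η0 t) (η1 t) (Nat.le_succ j)).trans (hpow t)
  have hη'b : ∀ t, |deriv η t| ≤ B1 := hB1
  have hη''b : ∀ t, |deriv (deriv η) t| ≤ B2 := hB2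
  set C : ℝ := ((j : ℝ) + 2) * ((j : ℝ) + 1) * B1 ^ 2 + ((j : ℝ) + 2) * (B1 + B2) + 1 with hC
  refine ⟨fun t => η t ^ (j + 2), C, by positivity, hκ0, hη.pow _, fun t => pow_nonneg (η0 t) _,
    fun t => pow_le_one₀ (η0 t) (η1 t), fun t ht => ?_, fun t ht => by rw [ηz t ht]; simp,
    fun t t' h => ?_, fun t => ?_, fun t => ?_⟩
  · have h1 : t ^ 2 ≤ (1 / 2) ^ 2 := by rw [← sq_abs]; gcongr
    have : η t = 1 := Real.smoothTransition.one_of_one_le (by linarith)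
    rw [this, one_pow]
  · have h1 : t ^ 2 ≤ t' ^ 2 := sq_le_sq.2 h
    have : η t' ≤ η t := Real.smoothTransition.monotone (by linarith)
    exact pow_le_pow_left₀ (η0 t') this _
  · have hP : 0 ≤ (η t ^ (j + 2)) ^ κ := by have := η0 t; positivity
    have h0 := η0 t
    rw [e1, abs_mul, abs_mul, abs_of_nonneg (by positivity : (0 : ℝ) ≤ (j : ℝ) + 2),
      abs_of_nonneg (by positivity : (0 : ℝ) ≤ η t ^ (j + 1))]
    calc _ ≤ ((j : ℝ) + 2) * (η t ^ (j + 2)) ^ κ * B1 := by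
          gcongr
          · exact hpow1 t
          · exact hη'b t
      _ = (((j : ℝ) + 2) * B1) * (η t ^ (j + 2)) ^ κ := by ring
      _ ≤ _ := by
          gcongr
          rw [hC]
          have : 0 ≤ ((j : ℝ) + 2) * ((j : ℝ) + 1) * B1 ^ 2 := by positivity
          have : 0 ≤ ((j : ℝ) + 2) * B2 := by positivity
          linarith
  · have hP : 0 ≤ (η t ^ (j + 2)) ^ κ := by have := η0 t; positivity
    have h0 := η0 t
    rw [e2]
    have a1 : |((j : ℝ) + 2) * ((j : ℝ) + 1) * η t ^ j * deriv η t ^ 2| ≤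
        (((j : ℝ) + 2) * ((j : ℝ) + 1) * B1 ^ 2) * (η t ^ (j + 2)) ^ κ := by
      rw [abs_of_nonneg (by positivity), ← sq_abs]
      calc _ ≤ ((j : ℝ) + 2) * ((j : ℝ) + 1) * (η t ^ (j + 2)) ^ κ * B1 ^ 2 := by
            gcongr
            · exact hpow t
            · exact hη'b t
        _ = _ := by ring
    have a2 : |((j : ℝ) + 2) * η t ^ (j + 1) * deriv (deriv η) t| ≤
        (((j : ℝ) + 2) * B2) * (η t ^ (j + 2)) ^ κ := by
      rw [abs_mul, abs_of_nonneg (by positivity : 0 ≤ ((j : ℝ) + 2) * η t ^ (j + 1))]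
      calc _ ≤ ((j : ℝ) + 2) * (η t ^ (j + 2)) ^ κ * B2 := by
            gcongr
            · exact hpow1 t
            · exact hη''b t
        _ = _ := by ring
    refine (abs_add_le _ _).trans ((add_le_add a1 a2).trans ?_)
    rw [← add_mul]
    gcongr
    rw [hC]
    have : 0 ≤ ((j : ℝ) + 2) * B1 := by positivity
    linarith

lemma IsCutoff.deriv_eq_zero {s : ℝ → ℝ} {κ C : ℝ} (hs : IsCutoff s κ C) {t : ℝ} (ht : |t| < 1 / 2) :
    deriv s t = 0 ∧ deriv (deriv s) t = 0 := by
  have hev : ∀ᶠ y in nhds t, |y| < 1 / 2 := continuous_abs.continuousAt.eventually (gt_mem_nhds ht)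
  have h1 : s =ᶠ[nhds t] fun _ => 1 := by
    filter_upwards [hev] with y hy using hs.eq_one y hy.le
  have h2 : deriv s =ᶠ[nhds t] fun _ => 0 := by
    filter_upwards [h1.eventuallyEq_nhds] with y hy
    rw [hy.deriv_eq, deriv_const]
  exact ⟨h2.self_of_nhds, by rw [h2.deriv_eq, deriv_const]⟩

lemma IsCutoff.deriv_eq_zero_of_le {s : ℝ → ℝ} {κ C : ℝ} (hs : IsCutoff s κ C) {t : ℝ}
    (ht : 1 ≤ |t|) : deriv s t = 0 ∧ deriv (deriv s) t = 0 := by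
  have h1 := hs.deriv_le t
  have h2 := hs.deriv2_le t
  rw [hs.eq_zero t ht, Real.zero_rpow hs.pos.ne', mul_zero] at h1 h2
  exact ⟨abs_nonpos_iff.1 h1, abs_nonpos_iff.1 h2⟩

lemma IsCutoff.contDiff_deriv {s : ℝ → ℝ} {κ C : ℝ} (hs : IsCutoff s κ C) :
    ContDiff ℝ (⊤ : ℕ∞) (deriv s) := by
  have : ContDiff ℝ ((⊤ : ℕ∞) + 1) s := by simpa using hs.contDiff
  exact (contDiff_succ_iff_deriv.1 this).2.2

end

noncomputable section

variable {N : ℕ}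

lemma integrableOn_Ioo_of_eq_zero {T R : ℝ} (hRT : R < T) {f : ℝ → ℝ}
    (hf : ContinuousOn f (Set.Ico 0 T)) (hz : ∀ t, R ≤ t → f t = 0) :
    IntegrableOn f (Set.Ioo 0 T) := by
  have h : IntegrableOn f (Set.Icc 0 R) :=
    (hf.mono fun t ht => ⟨ht.1, ht.2.trans_lt hRT⟩).integrableOn_Icc
  refine h.of_forall_sdiff_eq_zero measurableSet_Ioo fun t ht => hz t ?_
  by_contra hlt
  exact ht.2 ⟨ht.1.1.le, (not_le.1 hlt).le⟩

/-- Integration by parts on `(0, T)` against a function that vanishes from the time `R < T` on. -/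
lemma setIntegral_Ioo_deriv_mul_add {T R : ℝ} (hR : 0 < R) (hRT : R < T) {θ a b : ℝ → ℝ}
    (hθ : ContDiff ℝ 1 θ) (hz : ∀ t, R ≤ t → θ t = 0)
    (ha : ContinuousOn a (Set.Ico 0 T))
    (hb : ∀ t ∈ Set.Ico 0 T, HasDerivWithinAt b (a t) (Set.Ico 0 T) t) :
    ∫ t in Set.Ioo 0 T, (deriv θ t * b t + θ t * a t) = -(θ 0 * b 0) := by
  have hbc : ContinuousOn b (Set.Ico 0 T) := fun t ht => (hb t ht).continuousWithinAt
  obtain ⟨R', hR', hR'T⟩ := exists_between hRT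
  have hθ'c : Continuous (deriv θ) := hθ.continuous_deriv le_rfl
  have hsub : Set.Icc 0 R' ⊆ Set.Ico 0 T := fun t ht => ⟨ht.1, ht.2.trans_lt hR'T⟩
  have hz' : ∀ t, R < t → deriv θ t = 0 := by
    intro t ht
    have : θ =ᶠ[nhds t] fun _ => 0 := by
      filter_upwards [lt_mem_nhds ht] with y hy using hz y hy.le
    rw [this.deriv_eq, deriv_const]
  have hc : ContinuousOn (fun t => deriv θ t * b t + θ t * a t) (Set.Ico 0 T) :=
    (hθ'c.continuousOn.mul hbc).add (hθ.continuous.continuousOn.mul ha)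
  have h1 : ∫ t in Set.Ioo 0 T, (deriv θ t * b t + θ t * a t) =
      ∫ t in Set.Ioc 0 R', (deriv θ t * b t + θ t * a t) := by
    refine setIntegral_eq_of_subset_of_forall_sdiff_eq_zero measurableSet_Ioo
      (fun t ht => ⟨ht.1, ht.2.trans_lt hR'T⟩) fun t ht => ?_
    have : R' < t := by
      by_contra h
      exact ht.2 ⟨ht.1.1, not_lt.1 h⟩
    rw [hz' t (hR'.trans this), hz t (hR'.trans this).le]
    ring
  rw [h1, ← intervalIntegral.integral_of_le (hR.trans hR').le]
  have := intervalIntegral.integral_eq_sub_of_hasDeriv_right_of_le (hR.trans hR').le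
    (f := fun t => θ t * b t) (f' := fun t => deriv θ t * b t + θ t * a t)
    ((hθ.continuous.continuousOn.mul hbc).mono hsub) (fun t ht => ?_)
    ((hc.mono hsub).intervalIntegrable_of_Icc (hR.trans hR').le)
  · rw [this, hz R' hR'.le]; ring
  · have hd : HasDerivAt b (a t) t := (hb t ⟨ht.1.le, ht.2.trans hR'T⟩).hasDerivAt
      (Ico_mem_nhds ht.1 (ht.2.trans hR'T))
    exact (((hθ.differentiable one_ne_zero t).hasDerivAt).mul hd).hasDerivWithinAt

lemma exists_pairing {φ : Space N → ℝ} (hφ : IsTestFun φ) :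
    ∃ L : L2 N →L[ℝ] ℝ, ∀ w : L2 N, L w = ∫ x, w x * φ x := by
  refine ⟨innerSL ℝ (hφ.memLp.toLp φ), fun w => ?_⟩
  rw [innerSL_apply_apply, L2.inner_def]
  refine integral_congr_ae ?_
  filter_upwards [hφ.memLp.coeFn_toLp] with x hx
  rw [hx]
  simp

/-- The weak wave equation tested with a product `φ(x) θ(t)`. -/
lemma SatisfiesWeakWaveEq.test_mul {T ε : ℝ} {g : Space N → ℝ} {h : ℝ → Space N → ℝ}
    {u ut : ℝ → L2 N} {Du : ℝ → L2Vec N} (H : SatisfiesWeakWaveEq T ε g h ut Du)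
    (hu : ∀ t ∈ Set.Ico 0 T, IsWeakGradient (u t) (Du t))
    {φ : Space N → ℝ} (hφ : IsTestFun φ) {R : ℝ} (hRT : R < T) {θ : ℝ → ℝ}
    (hθ : ContDiff ℝ (⊤ : ℕ∞) θ) (hθc : HasCompactSupport θ) (hz : ∀ t, R ≤ t → θ t = 0) :
    ε * (∫ x, g x * φ x) * θ 0 + ∫ t in Set.Ioo 0 T, θ t * ∫ x, h t x * φ x =
      ∫ t in Set.Ioo 0 T, (-(deriv θ t * ∫ x, ut t x * φ x) -
        θ t * ∫ x, u t x * coordLaplacian φ x) := by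
  have hsupp : Function.support (fun z : Space N × ℝ => φ z.1 * θ z.2) ⊆
      (tsupport φ ×ˢ tsupport θ) ∩ {z | z.2 ≤ R} := by
    intro z hz'
    have h1 : φ z.1 ≠ 0 := fun h0 => hz' (by simp [h0])
    have h2 : θ z.2 ≠ 0 := fun h0 => hz' (by simp [h0])
    refine ⟨⟨subset_tsupport _ h1, subset_tsupport _ h2⟩, ?_⟩
    by_contra hlt
    exact h2 (hz _ (not_le.1 hlt).le)
  have hclosed : IsClosed {z : Space N × ℝ | z.2 ≤ R} := isClosed_le continuous_snd continuous_const
  have hcpt : IsCompact ((tsupport φ ×ˢ tsupport θ) ∩ {z : Space N × ℝ | z.2 ≤ R}) :=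
    (hφ.2.prod hθc).inter_right hclosed
  have hts : tsupport (fun z : Space N × ℝ => φ z.1 * θ z.2) ⊆
      (tsupport φ ×ˢ tsupport θ) ∩ {z | z.2 ≤ R} := closure_minimal hsupp hcpt.isClosed
  have key := H (fun z => φ z.1 * θ z.2) ⟨(hφ.1.comp contDiff_fst).mul (hθ.comp contDiff_snd),
    hcpt.of_isClosed_subset (isClosed_tsupport _) hts, fun z hz' => (hts hz').2.trans_lt hRT⟩
  have hθd : ∀ t, HasDerivAt θ (deriv θ t) t := fun t => (hθ.differentiable (by simp) t).hasDerivAt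
  have hφd : ∀ x, DifferentiableAt ℝ φ x := fun x => hφ.1.differentiable (by simp) x
  have e1 : ∫ x, g x * (φ x * θ 0) = (∫ x, g x * φ x) * θ 0 := by
    rw [← integral_mul_const]
    simp_rw [mul_assoc]
  have e2 : ∀ t, ∫ x, h t x * (φ x * θ t) = θ t * ∫ x, h t x * φ x := by
    intro t
    rw [← integral_const_mul]
    congr 1; ext x; ring
  simp only [e1, e2] at key
  rw [mul_assoc, key]
  refine setIntegral_congr_fun measurableSet_Ioo fun t ht => ?_
  have ht' : t ∈ Set.Ico 0 T := ⟨ht.1.le, ht.2⟩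
  have e3 : ∀ x, deriv (fun s : ℝ => φ x * θ s) t = φ x * deriv θ t := fun x =>
    ((hθd t).const_mul (φ x)).deriv
  have e4 : ∀ x, gradient (fun y : Space N => φ y * θ t) x = θ t • gradient φ x := by
    intro x
    simp only [gradient]
    rw [fderiv_mul_const (hφd x), map_smulₛₗ]
    simp
  simp only [e3, e4, inner_smul_right]
  have i1 : Integrable fun x => -(ut t x * (φ x * deriv θ t)) := by
    have := ((hφ.integrable_mul (ut t)).mul_const (deriv θ t)).neg
    refine this.congr (Filter.Eventually.of_forall fun x => ?_)
    simp [mul_assoc]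
  have i2 : Integrable fun x => θ t * inner ℝ (Du t x) (gradient φ x) :=
    (integrable_inner_gradient hφ (Du t)).const_mul _
  rw [integral_add i1 i2, integral_neg, integral_const_mul, (hu t ht').integral_inner_gradient hφ]
  have e5 : ∫ x, ut t x * (φ x * deriv θ t) = deriv θ t * ∫ x, ut t x * φ x := by
    rw [← integral_const_mul]
    congr 1; ext x; ring
  rw [e5]
  ring

section OneDim

variable {T R l e0 g0 : ℝ} {a b H s : ℝ → ℝ} {κ C : ℝ}

/-- The weak form, in time alone, of `b'' = l² b + H`, `b' = a`, `a 0 = g0`. -/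
def IsWeakODE (T l g0 : ℝ) (a b H : ℝ → ℝ) : Prop :=
  ∀ θ : ℝ → ℝ, ∀ R < T, ContDiff ℝ (⊤ : ℕ∞) θ → HasCompactSupport θ → (∀ t, R ≤ t → θ t = 0) →
    g0 * θ 0 + ∫ t in Set.Ioo 0 T, θ t * H t =
      ∫ t in Set.Ioo 0 T, (-(deriv θ t * a t) - θ t * (l ^ 2 * b t))

/-- The second order operator applied to `e^{-lt} s(t/R)`. -/
def cutoffKernel (s : ℝ → ℝ) (R l t : ℝ) : ℝ :=
  Real.exp (-(l * t)) * (deriv (deriv s) (t / R) / R ^ 2 - 2 * l * (deriv s (t / R) / R))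

lemma hasCompactSupport_of_eq_zero {f : ℝ → ℝ} (hf : ∀ t, R ≤ |t| → f t = 0) :
    HasCompactSupport f :=
  HasCompactSupport.intro (K := Set.Icc (-R) R) isCompact_Icc fun t ht => hf t (by
    by_contra h; exact ht (abs_le.1 (not_le.1 h).le))

lemma one_le_abs_div (hR : 0 < R) {t : ℝ} (ht : R ≤ |t|) : 1 ≤ |t / R| := by
  rw [abs_div, abs_of_pos hR, one_le_div hR]; exact ht

lemma IsCutoff.hasDerivAt_scaled (hs : IsCutoff s κ C) (R t : ℝ) :
    HasDerivAt (fun t => s (t / R)) (deriv s (t / R) / R) t := by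
  have h := ((hs.contDiff.differentiable (by simp) (t / R)).hasDerivAt).comp t
    ((hasDerivAt_id t).div_const R)
  exact h.congr_deriv (by ring)

lemma IsCutoff.hasDerivAt_scaled_deriv (hs : IsCutoff s κ C) (R t : ℝ) :
    HasDerivAt (fun t => deriv s (t / R) / R) (deriv (deriv s) (t / R) / R ^ 2) t := by
  have h := (((hs.contDiff_deriv.differentiable (by simp) (t / R)).hasDerivAt).comp t
    ((hasDerivAt_id t).div_const R)).div_const R
  exact h.congr_deriv (by ring)

lemma hasDerivAt_exp_neg_mul (l t : ℝ) :
    HasDerivAt (fun t => Real.exp (-(l * t))) (-(l * Real.exp (-(l * t)))) t := by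
  have h := (((hasDerivAt_id t).const_mul l).neg).exp
  exact h.congr_deriv (by simp; ring)

lemma IsCutoff.contDiff_scaled (hs : IsCutoff s κ C) (R : ℝ) :
    ContDiff ℝ (⊤ : ℕ∞) fun t => s (t / R) :=
  hs.contDiff.comp (contDiff_id.div_const R)

lemma IsCutoff.contDiff_scaled_deriv (hs : IsCutoff s κ C) (R : ℝ) :
    ContDiff ℝ (⊤ : ℕ∞) fun t => deriv s (t / R) / R :=
  (hs.contDiff_deriv.comp (contDiff_id.div_const R)).div_const R

lemma contDiff_exp_neg_mul (l : ℝ) : ContDiff ℝ (⊤ : ℕ∞) fun t : ℝ => Real.exp (-(l * t)) :=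
  Real.contDiff_exp.comp ((contDiff_const.mul contDiff_id).neg)

lemma IsCutoff.continuous_cutoffKernel (hs : IsCutoff s κ C) (R l : ℝ) :
    Continuous (cutoffKernel s R l) := by
  have h1 : Continuous (deriv (deriv s)) := hs.contDiff_deriv.continuous_deriv (by simp)
  have h2 : Continuous (deriv s) := hs.contDiff_deriv.continuous
  unfold cutoffKernel
  fun_prop

lemma IsCutoff.cutoffKernel_eq_zero (hs : IsCutoff s κ C) (hR : 0 < R) {t : ℝ} (ht : R ≤ |t|) :
    cutoffKernel s R l t = 0 := by
  have h := hs.deriv_eq_zero_of_le (one_le_abs_div hR ht)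
  simp [cutoffKernel, h.1, h.2]

/-- `e^{-lt} s(t/R)` and its first two derivatives. -/
lemma IsCutoff.hasDerivAt_exp_mul (hs : IsCutoff s κ C) (R l t : ℝ) :
    HasDerivAt (fun t => Real.exp (-(l * t)) * s (t / R))
      (-(Real.exp (-(l * t)) * (l * s (t / R) - deriv s (t / R) / R))) t :=
  ((hasDerivAt_exp_neg_mul l t).fun_mul (hs.hasDerivAt_scaled R t)).congr_deriv (by ring)

lemma IsCutoff.hasDerivAt_exp_mul_sub (hs : IsCutoff s κ C) (R l t : ℝ) :
    HasDerivAt (fun t => Real.exp (-(l * t)) * (l * s (t / R) - deriv s (t / R) / R))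
      (-(cutoffKernel s R l t + l ^ 2 * (Real.exp (-(l * t)) * s (t / R)))) t :=
  ((hasDerivAt_exp_neg_mul l t).fun_mul (((hs.hasDerivAt_scaled R t).const_mul l).fun_sub
    (hs.hasDerivAt_scaled_deriv R t))).congr_deriv (by unfold cutoffKernel; ring)

lemma IsWeakODE.integral_eq_position (hs : IsCutoff s κ C) (hR : 0 < R) (hRT : R < T)
    (h : IsWeakODE T l g0 a b H) (ha : ContinuousOn a (Set.Ico 0 T))
    (hb : ∀ t ∈ Set.Ico 0 T, HasDerivWithinAt b (a t) (Set.Ico 0 T) t) :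
    g0 + l * b 0 + ∫ t in Set.Ioo 0 T, Real.exp (-(l * t)) * s (t / R) * H t =
      ∫ t in Set.Ioo 0 T, cutoffKernel s R l t * b t := by
  have hbc : ContinuousOn b (Set.Ico 0 T) := fun t ht => (hb t ht).continuousWithinAt
  set E : ℝ → ℝ := fun t => Real.exp (-(l * t)) * s (t / R) with hE
  set D : ℝ → ℝ := fun t => Real.exp (-(l * t)) * (l * s (t / R) - deriv s (t / R) / R) with hD
  have hEz : ∀ t, R ≤ |t| → E t = 0 := fun t ht => by
    simp [hE, hs.eq_zero _ (one_le_abs_div hR ht)]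
  have hDz : ∀ t, R ≤ |t| → D t = 0 := fun t ht => by
    simp [hD, hs.eq_zero _ (one_le_abs_div hR ht),
      (hs.deriv_eq_zero_of_le (one_le_abs_div hR ht)).1]
  have hEc : ContDiff ℝ (⊤ : ℕ∞) E := (contDiff_exp_neg_mul l).mul (hs.contDiff_scaled R)
  have hDc : ContDiff ℝ (⊤ : ℕ∞) D := (contDiff_exp_neg_mul l).mul
    ((contDiff_const.mul (hs.contDiff_scaled R)).sub (hs.contDiff_scaled_deriv R))
  have key := h E R hRT hEc (hasCompactSupport_of_eq_zero hEz)
    fun t ht => hEz t (ht.trans (le_abs_self t))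
  have hdE : deriv E = fun t => -D t := funext fun t => (hs.hasDerivAt_exp_mul R l t).deriv
  have hdD : deriv D = fun t => -(cutoffKernel s R l t + l ^ 2 * E t) :=
    funext fun t => (hs.hasDerivAt_exp_mul_sub R l t).deriv
  have ibp := setIntegral_Ioo_deriv_mul_add hR hRT (hDc.of_le (by simp))
    (fun t ht => hDz t (ht.trans (le_abs_self t))) ha hb
  have i1 : IntegrableOn (fun t => deriv D t * b t + D t * a t) (Set.Ioo 0 T) := by
    refine integrableOn_Ioo_of_eq_zero hRT
      (((hDc.continuous_deriv (by simp)).continuousOn.mul hbc).add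
        (hDc.continuous.continuousOn.mul ha)) fun t ht => ?_
    have ht' := ht.trans (le_abs_self t)
    simp [hdD, hs.cutoffKernel_eq_zero hR ht', hEz t ht', hDz t ht']
  have i2 : IntegrableOn (fun t => cutoffKernel s R l t * b t) (Set.Ioo 0 T) := by
    refine integrableOn_Ioo_of_eq_zero hRT ((hs.continuous_cutoffKernel R l).continuousOn.mul hbc)
      fun t ht => ?_
    rw [hs.cutoffKernel_eq_zero hR (ht.trans (le_abs_self t)), zero_mul]
  have e1 : ∫ t in Set.Ioo 0 T, (-(deriv E t * a t) - E t * (l ^ 2 * b t)) =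
      (∫ t in Set.Ioo 0 T, (deriv D t * b t + D t * a t)) +
        ∫ t in Set.Ioo 0 T, cutoffKernel s R l t * b t := by
    rw [← integral_add i1 i2]
    congr 1; ext t
    rw [hdE, hdD]
    ring
  have hE0 : E 0 = 1 := by simp [hE, hs.eq_one 0 (by norm_num)]
  have hD0 : D 0 = l := by
    simp [hD, hs.eq_one 0 (by norm_num), (hs.deriv_eq_zero (t := 0) (by norm_num)).1]
  rw [e1, ibp, hE0, hD0] at key
  linarith

lemma IsWeakODE.integral_eq_velocity (hs : IsCutoff s κ C) (hR : 0 < R) (hRT : R < T)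
    (h : IsWeakODE T l g0 a b H) (ha : ContinuousOn a (Set.Ico 0 T))
    (hb : ∀ t ∈ Set.Ico 0 T, HasDerivWithinAt b (a t) (Set.Ico 0 T) t) :
    l * (g0 + l * b 0) + ∫ t in Set.Ioo 0 T,
        Real.exp (-(l * t)) * (l * s (t / R) - deriv s (t / R) / R) * H t =
      ∫ t in Set.Ioo 0 T, cutoffKernel s R l t * a t := by
  have hbc : ContinuousOn b (Set.Ico 0 T) := fun t ht => (hb t ht).continuousWithinAt
  set E : ℝ → ℝ := fun t => Real.exp (-(l * t)) * s (t / R) with hE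
  set D : ℝ → ℝ := fun t => Real.exp (-(l * t)) * (l * s (t / R) - deriv s (t / R) / R) with hD
  have hEz : ∀ t, R ≤ |t| → E t = 0 := fun t ht => by
    simp [hE, hs.eq_zero _ (one_le_abs_div hR ht)]
  have hDz : ∀ t, R ≤ |t| → D t = 0 := fun t ht => by
    simp [hD, hs.eq_zero _ (one_le_abs_div hR ht),
      (hs.deriv_eq_zero_of_le (one_le_abs_div hR ht)).1]
  have hEc : ContDiff ℝ (⊤ : ℕ∞) E := (contDiff_exp_neg_mul l).mul (hs.contDiff_scaled R)
  have hDc : ContDiff ℝ (⊤ : ℕ∞) D := (contDiff_exp_neg_mul l).mul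
    ((contDiff_const.mul (hs.contDiff_scaled R)).sub (hs.contDiff_scaled_deriv R))
  have key := h D R hRT hDc (hasCompactSupport_of_eq_zero hDz)
    fun t ht => hDz t (ht.trans (le_abs_self t))
  have hdE : deriv E = fun t => -D t := funext fun t => (hs.hasDerivAt_exp_mul R l t).deriv
  have hdD : deriv D = fun t => -(cutoffKernel s R l t + l ^ 2 * E t) :=
    funext fun t => (hs.hasDerivAt_exp_mul_sub R l t).deriv
  have ibp := setIntegral_Ioo_deriv_mul_add hR hRT (hEc.of_le (by simp))
    (fun t ht => hEz t (ht.trans (le_abs_self t))) ha hb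
  have i1 : IntegrableOn (fun t => deriv E t * b t + E t * a t) (Set.Ioo 0 T) := by
    refine integrableOn_Ioo_of_eq_zero hRT
      (((hEc.continuous_deriv (by simp)).continuousOn.mul hbc).add
        (hEc.continuous.continuousOn.mul ha)) fun t ht => ?_
    have ht' := ht.trans (le_abs_self t)
    simp [hdE, hDz t ht', hEz t ht']
  have i2 : IntegrableOn (fun t => cutoffKernel s R l t * a t) (Set.Ioo 0 T) := by
    refine integrableOn_Ioo_of_eq_zero hRT ((hs.continuous_cutoffKernel R l).continuousOn.mul ha)
      fun t ht => ?_
    rw [hs.cutoffKernel_eq_zero hR (ht.trans (le_abs_self t)), zero_mul]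
  have e1 : ∫ t in Set.Ioo 0 T, (-(deriv D t * a t) - D t * (l ^ 2 * b t)) =
      l ^ 2 * (∫ t in Set.Ioo 0 T, (deriv E t * b t + E t * a t)) +
        ∫ t in Set.Ioo 0 T, cutoffKernel s R l t * a t := by
    rw [← integral_const_mul, ← integral_add (i1.const_mul _) i2]
    congr 1; ext t
    rw [hdE, hdD]
    ring
  have hE0 : E 0 = 1 := by simp [hE, hs.eq_one 0 (by norm_num)]
  have hD0 : D 0 = l := by
    simp [hD, hs.eq_one 0 (by norm_num), (hs.deriv_eq_zero (t := 0) (by norm_num)).1]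
  rw [e1, ibp, hE0, hD0] at key
  linarith

lemma IsWeakODE.integral_eq_mass (hs : IsCutoff s κ C) (hR : 0 < R) (hRT : R < T)
    (h : IsWeakODE T 0 g0 a b H) :
    g0 + ∫ t in Set.Ioo 0 T, s (t / R) * H t =
      ∫ t in Set.Ioo 0 T, -(deriv s (t / R) / R) * a t := by
  have key := h (fun t => s (t / R)) R hRT (hs.contDiff_scaled R)
    (hasCompactSupport_of_eq_zero fun t ht => hs.eq_zero _ (one_le_abs_div hR ht))
    fun t ht => hs.eq_zero _ (one_le_abs_div hR (ht.trans (le_abs_self t)))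
  have hd : deriv (fun t => s (t / R)) = fun t => deriv s (t / R) / R :=
    funext fun t => (hs.hasDerivAt_scaled R t).deriv
  rw [hd] at key
  simpa [hs.eq_one 0 (by norm_num)] using key

end OneDim

end

noncomputable section

variable {N : ℕ}

/-- One equation of the system: `w` solves `∂ₜ²w - Δw = h` weakly in a cone, with data `ε (f, g)`. -/
structure IsConeSolution (T ε r : ℝ) (f g : Space N → ℝ) (h : ℝ → Space N → ℝ) (w wt : ℝ → L2 N)
    (Dw : ℝ → L2Vec N) : Prop where
  pos : 0 < T
  radius : 0 ≤ r
  h1 : IsContinuousH1Curve T w Dw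
  c1 : IsC1L2Curve T w wt
  init : (w 0 : Space N → ℝ) =ᵐ[volume] fun x => ε * f x
  init_deriv : (wt 0 : Space N → ℝ) =ᵐ[volume] fun x => ε * g x
  eqn : SatisfiesWeakWaveEq T ε g h wt Dw
  cone : SupportedInCone T r w
  supp_f : ∀ x, r < ‖x‖ → f x = 0
  supp_g : ∀ x, r < ‖x‖ → g x = 0

lemma IsConeSolution.cone_deriv {T ε r : ℝ} {f g : Space N → ℝ} {h : ℝ → Space N → ℝ}
    {w wt : ℝ → L2 N} {Dw : ℝ → L2Vec N} (H : IsConeSolution T ε r f g h w wt Dw) :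
    SupportedInCone T r wt := by
  intro t ht
  rcases ht.1.eq_or_lt with h0 | h0
  · subst h0
    filter_upwards [H.init_deriv] with x hx hr
    rw [hx, H.supp_g x (by simpa using hr), mul_zero]
  · have hms : MeasurableSet {x : Space N | r + t < ‖x‖} := measurableSet_lt measurable_const measurable_norm
    let L := LpToLpRestrictCLM (Space N) ℝ ℝ volume 2 {x : Space N | r + t < ‖x‖}
    have hz : ∀ s ∈ Set.Icc 0 t, L (w s) = 0 := by
      intro s hs
      have h1 := H.cone s ⟨hs.1, hs.2.trans_lt ht.2⟩
      apply Lp.ext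
      filter_upwards [LpToLpRestrictCLM_coeFn ℝ {x : Space N | r + t < ‖x‖} (w s),
        Lp.coeFn_zero ℝ 2 (volume.restrict {x : Space N | r + t < ‖x‖}),
        ae_restrict_of_ae h1, ae_restrict_mem hms] with x h2 h3 h4 h5
      rw [h2, h3]
      exact h4 (lt_of_le_of_lt (by linarith [hs.2]) h5)
    have hd : HasDerivWithinAt w (wt t) (Set.Icc 0 t) t :=
      (H.c1.1 t ht).mono fun s hs => ⟨hs.1, hs.2.trans_lt ht.2⟩
    have hd1 : HasDerivWithinAt (fun s => L (w s)) (L (wt t)) (Set.Icc 0 t) t :=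
      L.hasFDerivAt.comp_hasDerivWithinAt t hd
    have hd2 : HasDerivWithinAt (fun s => L (w s)) 0 (Set.Icc 0 t) t :=
      (hasDerivWithinAt_const t _ 0).congr (fun s hs => hz s hs) (hz t ⟨h0.le, le_rfl⟩)
    have he : L (wt t) = 0 :=
      ((uniqueDiffOn_Icc h0) t ⟨h0.le, le_rfl⟩).eq_deriv _ hd1 hd2
    have h6 := LpToLpRestrictCLM_coeFn ℝ {x : Space N | r + t < ‖x‖} (wt t)
    have h7 : (L (wt t) : Space N → ℝ) =ᵐ[volume.restrict {x : Space N | r + t < ‖x‖}] 0 := by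
      rw [he]; exact Lp.coeFn_zero _ _ _
    have h8 : ∀ᵐ x ∂(volume.restrict {x : Space N | r + t < ‖x‖}), wt t x = 0 := by
      filter_upwards [h6, h7] with x h6 h7
      rw [← h6, h7]; rfl
    exact (ae_restrict_iff' hms).1 h8

/-- Pairing `L¹` with a bounded function. -/
lemma exists_L1_pairing {φ : Space N → ℝ} (hφ : AEStronglyMeasurable φ volume) {B : ℝ}
    (hB : ∀ x, |φ x| ≤ B) : ∃ L : L1 N →L[ℝ] ℝ, ∀ w : L1 N, L w = ∫ x, w x * φ x := by
  have hi : ∀ w : L1 N, Integrable fun x => w x * φ x := fun w =>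
    (L1.integrable_coeFn w).mul_bdd hφ (Filter.Eventually.of_forall hB)
  refine ⟨LinearMap.mkContinuous ⟨⟨fun w => ∫ x, w x * φ x, fun v w => ?_⟩, fun c w => ?_⟩ B
    fun w => ?_, fun w => rfl⟩
  · rw [← integral_add (hi v) (hi w)]
    refine integral_congr_ae ?_
    filter_upwards [Lp.coeFn_add v w] with x hx
    rw [hx, Pi.add_apply, add_mul]
  · simp only [RingHom.id_apply, smul_eq_mul]
    rw [← integral_const_mul]
    refine integral_congr_ae ?_
    filter_upwards [Lp.coeFn_smul c w] with x hx
    rw [hx, Pi.smul_apply, smul_eq_mul, mul_assoc]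
  · change ‖∫ x, w x * φ x‖ ≤ B * ‖w‖
    rw [L1.norm_eq_integral_norm, ← integral_const_mul]
    refine norm_integral_le_of_norm_le ((L1.integrable_coeFn w).norm.const_mul B)
      (Filter.Eventually.of_forall fun x => ?_)
    rw [norm_mul, mul_comm]
    exact mul_le_mul_of_nonneg_right (hB x) (norm_nonneg _)

lemma MemL1L1.integrableOn_pairing {T : ℝ} {h : ℝ → Space N → ℝ} (hh : MemL1L1 T h)
    {φ : Space N → ℝ} (hφ : AEStronglyMeasurable φ volume) {B : ℝ} (hB : ∀ x, |φ x| ≤ B) :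
    IntegrableOn (fun t => ∫ x, h t x * φ x) (Set.Ioo 0 T) := by
  obtain ⟨H, hH, he⟩ := hh
  obtain ⟨L, hL⟩ := exists_L1_pairing hφ hB
  refine (L.integrable_comp hH).congr ?_
  filter_upwards [he] with t ht
  rw [hL]
  refine integral_congr_ae ?_
  filter_upwards [ht] with x hx
  rw [hx]

lemma MemL1L1.integrableOn_integral {T : ℝ} {h : ℝ → Space N → ℝ} (hh : MemL1L1 T h) :
    IntegrableOn (fun t => ∫ x, h t x) (Set.Ioo 0 T) := by
  have := hh.integrableOn_pairing (φ := fun _ => 1) aestronglyMeasurable_const (B := 1)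
    (fun x => by simp)
  simpa using this

lemma MemL1L1.ae_integrable {T : ℝ} {h : ℝ → Space N → ℝ} (hh : MemL1L1 T h) :
    ∀ᵐ t ∂(volume.restrict (Set.Ioo 0 T)), Integrable (h t) := by
  obtain ⟨H, hH, he⟩ := hh
  filter_upwards [he] with t ht
  exact (L1.integrable_coeFn (H t)).congr ht

lemma abs_integral_mul_le_of_cone {w : L2 N} {ρ : ℝ} (hw : ∀ᵐ x, ρ < ‖x‖ → w x = 0)
    {φ ψ : Space N → ℝ} (heq : ∀ x, ‖x‖ ≤ ρ → φ x = ψ x) (hψ : ∀ x, 0 ≤ ψ x) :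
    |∫ x, w x * φ x| ≤ ∫ x in Metric.closedBall 0 ρ, |w x| * ψ x := by
  have h1 : ∫ x, w x * φ x = ∫ x in Metric.closedBall 0 ρ, w x * ψ x := by
    rw [← integral_indicator measurableSet_closedBall]
    refine integral_congr_ae ?_
    filter_upwards [hw] with x hx
    by_cases hxρ : ‖x‖ ≤ ρ
    · rw [Set.indicator_of_mem (by simpa using hxρ), heq x hxρ]
    · rw [Set.indicator_of_notMem (by simpa using hxρ), hx (not_le.1 hxρ), zero_mul]
  rw [h1]
  refine (abs_integral_le_integral_abs).trans (le_of_eq ?_)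
  congr 1; ext x
  rw [abs_mul, abs_of_nonneg (hψ x)]

/-- The time-dependent moments of a solution against `radialSol N l`. -/
lemma IsConeSolution.exists_moments {T ε r : ℝ} {f g : Space N → ℝ} {h : ℝ → Space N → ℝ}
    {w wt : ℝ → L2 N} {Dw : ℝ → L2Vec N} (S : IsConeSolution T ε r f g h w wt Dw) (hN : 1 ≤ N)
    (hh : MemL1L1 T h) (h0 : ∀ t x, 0 ≤ h t x)
    (hcone : ∀ t ∈ Set.Ico 0 T, ∀ᵐ x, r + t < ‖x‖ → h t x = 0) (l : ℝ) :
    ∃ a b H : ℝ → ℝ,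
      IsWeakODE T l (ε * ∫ x, g x * radialSol N l x) a b H ∧
      ContinuousOn a (Set.Ico 0 T) ∧
      (∀ t ∈ Set.Ico 0 T, HasDerivWithinAt b (a t) (Set.Ico 0 T) t) ∧
      b 0 = ε * ∫ x, f x * radialSol N l x ∧
      (∀ t ∈ Set.Ico 0 T, |a t| ≤ ∫ x in Metric.closedBall 0 (r + t), |wt t x| * radialSol N l x) ∧
      (∀ t ∈ Set.Ico 0 T, |b t| ≤ ∫ x in Metric.closedBall 0 (r + t), |w t x| * radialSol N l x) ∧
      IntegrableOn H (Set.Ioo 0 T) ∧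
      ∀ᵐ t ∂(volume.restrict (Set.Ioo 0 T)), ∫ x, h t x ≤ H t := by
  have hr := S.radius
  have hT := S.pos
  obtain ⟨φ, hφ, heq⟩ := exists_testFun_eq (contDiff_radialSol hN l) (ρ := r + T) (by positivity)
  have heq' : ∀ x, ‖x‖ < r + T → φ x = radialSol N l x := fun x hx => (heq x hx).self_of_nhds
  have hpos : ∀ x, 0 ≤ radialSol N l x := fun x => zero_le_one.trans (one_le_radialSol hN l x)
  obtain ⟨L, hL⟩ := exists_pairing hφ
  obtain ⟨B, hB⟩ := hφ.1.continuous.bounded_above_of_compact_support hφ.2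
  have hdata : ∀ f : Space N → ℝ, (∀ x, r < ‖x‖ → f x = 0) →
      ∫ x, f x * φ x = ∫ x, f x * radialSol N l x := by
    intro f hf
    congr 1; ext x
    by_cases hx : r < ‖x‖
    · rw [hf x hx, zero_mul, zero_mul]
    · rw [heq' x (by linarith)]
  refine ⟨fun t => ∫ x, wt t x * φ x, fun t => ∫ x, w t x * φ x, fun t => ∫ x, h t x * φ x,
    ?_, ?_, ?_, ?_, ?_, ?_, ?_, ?_⟩
  · intro θ R hRT hθ hθc hz
    have key := S.eqn.test_mul S.h1.1 hφ hRT hθ hθc hz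
    rw [hdata g S.supp_g] at key
    rw [key]
    refine setIntegral_congr_fun measurableSet_Ioo fun t ht => ?_
    have e : ∫ x, w t x * coordLaplacian φ x = l ^ 2 * ∫ x, w t x * φ x := by
      rw [← integral_const_mul]
      refine integral_congr_ae ?_
      filter_upwards [S.cone t ⟨ht.1.le, ht.2⟩] with x hx
      by_cases hxr : r + t < ‖x‖
      · rw [hx hxr]; ring
      · have hxT : ‖x‖ < r + T := by linarith [ht.2]
        rw [coordLaplacian_congr (heq x hxT), coordLaplacian_radialSol hN, heq' x hxT]
        ring
    simp only [e]
  · simp_rw [← hL]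
    exact L.continuous.comp_continuousOn S.c1.2
  · intro t ht
    simp_rw [← hL]
    exact L.hasFDerivAt.comp_hasDerivWithinAt t (S.c1.1 t ht)
  · have : ∫ x, w 0 x * φ x = ∫ x, ε * (f x * φ x) := by
      refine integral_congr_ae ?_
      filter_upwards [S.init] with x hx
      rw [hx, mul_assoc]
    simp only [this]
    rw [integral_const_mul, hdata f S.supp_f]
  · exact fun t ht => abs_integral_mul_le_of_cone (S.cone_deriv t ht)
      (fun x hx => heq' x (by linarith [ht.2])) hpos
  · exact fun t ht => abs_integral_mul_le_of_cone (S.cone t ht)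
      (fun x hx => heq' x (by linarith [ht.2])) hpos
  · exact hh.integrableOn_pairing hφ.1.continuous.aestronglyMeasurable hB
  · filter_upwards [hh.ae_integrable, ae_restrict_mem measurableSet_Ioo] with t hi ht
    refine integral_mono_ae hi
      (hi.mul_bdd hφ.1.continuous.aestronglyMeasurable (Filter.Eventually.of_forall hB)) ?_
    filter_upwards [hcone t ⟨ht.1.le, ht.2⟩] with x hx
    by_cases hxr : r + t < ‖x‖
    · simp [hx hxr]
    · rw [heq' x (by linarith [ht.2])]
      exact le_mul_of_one_le_right (h0 t x) (one_le_radialSol hN l x)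

lemma IsCutoff.deriv_nonpos {s : ℝ → ℝ} {κ C : ℝ} (hs : IsCutoff s κ C) {t : ℝ} (ht : 0 < t) :
    deriv s t ≤ 0 := by
  have hanti : AntitoneOn s (Set.Ici 0) := fun x hx y hy hxy => hs.anti x y (by
    rwa [abs_of_nonneg hx, abs_of_nonneg hy])
  rw [← derivWithin_of_mem_nhds (Ici_mem_nhds ht)]
  exact hanti.derivWithin_nonpos

lemma IsCutoff.integral_mul_le {s : ℝ → ℝ} {κ C : ℝ} (hs : IsCutoff s κ C) {T R l M : ℝ} (hR : 0 < R)
    (hRT : R < T) {K b : ℝ → ℝ} (hK : Continuous K) (hb : ContinuousOn b (Set.Ico 0 T))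
    (hKz : ∀ t, 0 < t → t < R / 2 ∨ R < t → K t = 0)
    (hKM : ∀ t, |K t| ≤ M * (Real.exp (-(l * t)) * s (t / R) ^ κ)) :
    ∫ t in Set.Ioo 0 T, K t * b t ≤
      M * ∫ t in Set.Icc (R / 2) R, Real.exp (-(l * t)) * s (t / R) ^ κ * |b t| := by
  have hsub : Set.Icc (R / 2) R ⊆ Set.Ico 0 T := fun t ht =>
    ⟨by linarith [ht.1], ht.2.trans_lt hRT⟩
  have e : ∫ t in Set.Ioo 0 T, K t * b t = ∫ t in Set.Icc (R / 2) R, K t * b t := by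
    refine setIntegral_eq_of_subset_of_forall_sdiff_eq_zero measurableSet_Ioo
      (fun t ht => ⟨by linarith [ht.1], ht.2.trans_lt hRT⟩) fun t ht => ?_
    rw [hKz t ht.1.1, zero_mul]
    by_contra hcon
    rw [not_or, not_lt, not_lt] at hcon
    exact ht.2 hcon
  rw [e, ← integral_const_mul]
  have hsc : Continuous fun t => s (t / R) ^ κ :=
    (hs.contDiff_scaled R).continuous.rpow_const fun t => Or.inr hs.pos.le
  refine setIntegral_mono_on ((hK.continuousOn.mul (hb.mono hsub)).integrableOn_Icc) ?_
    measurableSet_Icc fun t ht => ?_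
  · exact (continuousOn_const.mul ((Continuous.continuousOn (by fun_prop)).mul
      (hb.mono hsub).abs)).integrableOn_Icc
  · calc K t * b t ≤ |K t| * |b t| := by rw [← abs_mul]; exact le_abs_self _
      _ ≤ M * (Real.exp (-(l * t)) * s (t / R) ^ κ) * |b t| := by gcongr; exact hKM t
      _ = _ := by ring

lemma IsCutoff.abs_cutoffKernel_le {s : ℝ → ℝ} {κ C : ℝ} (hs : IsCutoff s κ C) {R l : ℝ} (hR : 0 < R)
    (hl : 0 ≤ l) (t : ℝ) : |cutoffKernel s R l t| ≤
      C / R * (1 / R + 2 * l) * (Real.exp (-(l * t)) * s (t / R) ^ κ) := by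
  rw [cutoffKernel, abs_mul, abs_of_pos (Real.exp_pos _)]
  have h1 := hs.deriv_le (t / R)
  have h2 := hs.deriv2_le (t / R)
  have h3 : |deriv (deriv s) (t / R) / R ^ 2 - 2 * l * (deriv s (t / R) / R)| ≤
      C * s (t / R) ^ κ / R ^ 2 + 2 * l * (C * s (t / R) ^ κ / R) := by
    refine (abs_sub _ _).trans ?_
    rw [abs_div, abs_mul, abs_div, abs_of_pos hR, abs_of_nonneg (by positivity : 0 ≤ 2 * l),
      abs_of_pos (by positivity : 0 < R ^ 2)]
    gcongr
  calc _ ≤ Real.exp (-(l * t)) * (C * s (t / R) ^ κ / R ^ 2 + 2 * l * (C * s (t / R) ^ κ / R)) := by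
        gcongr
    _ = _ := by field_simp

lemma abs_div_lt_half {R t : ℝ} (hR : 0 < R) (h0 : 0 < t) (h : t < R / 2) : |t / R| < 1 / 2 := by
  rw [abs_of_pos (by positivity), div_lt_iff₀ hR]; linarith

lemma IsCutoff.cutoffKernel_eq_zero_outside {s : ℝ → ℝ} {κ C : ℝ} (hs : IsCutoff s κ C) {R l : ℝ}
    (hR : 0 < R) (t : ℝ) (h0 : 0 < t) (ht : t < R / 2 ∨ R < t) : cutoffKernel s R l t = 0 := by
  rcases ht with ht | ht
  · have := hs.deriv_eq_zero (abs_div_lt_half hR h0 ht)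
    simp [cutoffKernel, this.1, this.2]
  · exact hs.cutoffKernel_eq_zero hR (ht.le.trans (le_abs_self t))

section Inequalities

variable {T ε r : ℝ} {f g : Space N → ℝ} {h : ℝ → Space N → ℝ} {w wt : ℝ → L2 N}
  {Dw : ℝ → L2Vec N} {s : ℝ → ℝ} {κ C : ℝ}

lemma IsCutoff.integrableOn_exp_mul (hs : IsCutoff s κ C) (R l : ℝ) {U : ℝ → ℝ}
    (hl : 0 ≤ l) (hU : IntegrableOn U (Set.Ioo 0 T)) :
    IntegrableOn (fun t => Real.exp (-(l * t)) * s (t / R) * U t) (Set.Ioo 0 T) := by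
  refine Integrable.bdd_mul (c := 1) hU
    (((contDiff_exp_neg_mul l).mul (hs.contDiff_scaled R)).continuous.aestronglyMeasurable) ?_
  filter_upwards [ae_restrict_mem measurableSet_Ioo] with t ht
  rw [Real.norm_eq_abs, abs_of_nonneg (mul_nonneg (Real.exp_pos _).le (hs.nonneg _))]
  exact mul_le_one₀ (Real.exp_le_one_iff.2 (by have := ht.1; nlinarith)) (hs.nonneg _) (hs.le_one _)

lemma IsCutoff.integral_exp_mul_mono (hs : IsCutoff s κ C) (R l : ℝ) {U H : ℝ → ℝ}
    (hl : 0 ≤ l) (hU : IntegrableOn U (Set.Ioo 0 T)) (hH : IntegrableOn H (Set.Ioo 0 T))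
    (hUH : ∀ᵐ t ∂(volume.restrict (Set.Ioo 0 T)), U t ≤ H t) :
    ∫ t in Set.Ioo 0 T, Real.exp (-(l * t)) * s (t / R) * U t ≤
      ∫ t in Set.Ioo 0 T, Real.exp (-(l * t)) * s (t / R) * H t := by
  refine integral_mono_ae (hs.integrableOn_exp_mul R l hl hU) (hs.integrableOn_exp_mul R l hl hH) ?_
  filter_upwards [hUH] with t ht
  exact mul_le_mul_of_nonneg_left ht (mul_nonneg (Real.exp_pos _).le (hs.nonneg _))

lemma IsConeSolution.position_inequality (S : IsConeSolution T ε r f g h w wt Dw) (hN : 1 ≤ N)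
    (hh : MemL1L1 T h) (h0 : ∀ t x, 0 ≤ h t x)
    (hcone : ∀ t ∈ Set.Ico 0 T, ∀ᵐ x, r + t < ‖x‖ → h t x = 0) (hs : IsCutoff s κ C)
    {R l : ℝ} (hR : 0 < R) (hRT : R < T) (hl : 0 ≤ l) :
    ∃ b : ℝ → ℝ, ContinuousOn b (Set.Ico 0 T) ∧
      (∀ t ∈ Set.Ico 0 T, |b t| ≤ ∫ x in Metric.closedBall 0 (r + t), |w t x| * radialSol N l x) ∧
      ε * ((∫ x, g x * radialSol N l x) + l * ∫ x, f x * radialSol N l x) +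
          ∫ t in Set.Ioo 0 T, Real.exp (-(l * t)) * s (t / R) * ∫ x, h t x ≤
        C / R * (1 / R + 2 * l) *
          ∫ t in Set.Icc (R / 2) R, Real.exp (-(l * t)) * s (t / R) ^ κ * |b t| := by
  obtain ⟨a, b, H, hode, ha, hb, hb0, -, hbb, hHi, hUH⟩ := S.exists_moments hN hh h0 hcone l
  have hbc : ContinuousOn b (Set.Ico 0 T) := fun t ht => (hb t ht).continuousWithinAt
  refine ⟨b, hbc, hbb, ?_⟩
  have key := hode.integral_eq_position hs hR hRT ha hb
  have h1 := hs.integral_exp_mul_mono R l hl hh.integrableOn_integral hHi hUH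
  have h2 := hs.integral_mul_le hR hRT (hs.continuous_cutoffKernel R l) hbc
    (hs.cutoffKernel_eq_zero_outside hR) (hs.abs_cutoffKernel_le hR hl)
  rw [hb0] at key
  linarith

lemma IsConeSolution.velocity_inequality (S : IsConeSolution T ε r f g h w wt Dw) (hN : 1 ≤ N)
    (hh : MemL1L1 T h) (h0 : ∀ t x, 0 ≤ h t x)
    (hcone : ∀ t ∈ Set.Ico 0 T, ∀ᵐ x, r + t < ‖x‖ → h t x = 0) (hs : IsCutoff s κ C) (hC : 0 < C)
    {R l : ℝ} (hR : 0 < R) (hRT : R < T) (hl : l = 0 ∨ 1 ≤ l * R) :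
    ∃ a : ℝ → ℝ, ContinuousOn a (Set.Ico 0 T) ∧
      (∀ t ∈ Set.Ico 0 T, |a t| ≤ ∫ x in Metric.closedBall 0 (r + t), |wt t x| * radialSol N l x) ∧
      ε * ((∫ x, g x * radialSol N l x) + l * ∫ x, f x * radialSol N l x) +
          ∫ t in Set.Ioo 0 T, Real.exp (-(l * t)) * s (t / R) * ∫ x, h t x ≤
        3 * C / R * ∫ t in Set.Icc (R / 2) R, Real.exp (-(l * t)) * s (t / R) ^ κ * |a t| := by
  obtain ⟨a, b, H, hode, ha, hb, hb0, hab, -, hHi, hUH⟩ := S.exists_moments hN hh h0 hcone l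
  refine ⟨a, ha, hab, ?_⟩
  have hl0 : 0 ≤ l := by
    rcases hl with hl | hl
    · exact hl.ge
    · by_contra hneg
      nlinarith
  have h1 := hs.integral_exp_mul_mono R l hl0 hh.integrableOn_integral hHi hUH
  have hsκ : ∀ t, 0 ≤ s (t / R) ^ κ := fun t => Real.rpow_nonneg (hs.nonneg _) _
  rcases hl with hl | hl
  · subst hl
    have key := hode.integral_eq_mass hs hR hRT
    have h2 := hs.integral_mul_le (l := 0) (M := 3 * C / R) hR hRT
      (K := fun t => -(deriv s (t / R) / R)) (hs.contDiff_scaled_deriv R).continuous.neg ha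
      (fun t ht0 ht => ?_) fun t => ?_
    · simp only [zero_mul, neg_zero, Real.exp_zero, one_mul, add_zero] at h1 h2 ⊢
      linarith
    · rcases ht with ht | ht
      · simp [(hs.deriv_eq_zero (abs_div_lt_half hR ht0 ht)).1]
      · simp [(hs.deriv_eq_zero_of_le (one_le_abs_div hR (ht.le.trans (le_abs_self t)))).1]
    · rw [abs_neg, abs_div, abs_of_pos hR]
      have h3 := hs.deriv_le (t / R)
      have h4 := hsκ t
      simp only [zero_mul, neg_zero, Real.exp_zero, one_mul]
      calc _ ≤ C * s (t / R) ^ κ / R := by gcongr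
        _ ≤ 3 * (C * s (t / R) ^ κ / R) := by
          have : 0 ≤ C * s (t / R) ^ κ / R := by positivity
          linarith
        _ = _ := by ring
  · have hlpos : 0 < l := by
      rcases hl0.eq_or_lt with h | h
      · rw [← h] at hl; linarith
      · exact h
    have key := hode.integral_eq_velocity hs hR hRT ha hb
    have h2 := hs.integral_mul_le hR hRT (hs.continuous_cutoffKernel R l) ha
      (hs.cutoffKernel_eq_zero_outside hR) (hs.abs_cutoffKernel_le hR hl0)
    have h3 : l * ∫ t in Set.Ioo 0 T, Real.exp (-(l * t)) * s (t / R) * H t ≤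
        ∫ t in Set.Ioo 0 T, Real.exp (-(l * t)) * (l * s (t / R) - deriv s (t / R) / R) * H t := by
      rw [← integral_const_mul]
      have i1 := hs.integrableOn_exp_mul R l hl0 hHi
      have i2 : IntegrableOn (fun t => Real.exp (-(l * t)) * (deriv s (t / R) / R) * H t)
          (Set.Ioo 0 T) := by
        refine Integrable.bdd_mul (c := C / R) hHi
          (((contDiff_exp_neg_mul l).mul (hs.contDiff_scaled_deriv R)).continuous.aestronglyMeasurable) ?_
        filter_upwards [ae_restrict_mem measurableSet_Ioo] with t ht
        rw [norm_mul, norm_div, Real.norm_eq_abs, Real.norm_eq_abs, Real.norm_eq_abs,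
          abs_of_pos (Real.exp_pos _), abs_of_pos hR]
        have e1 : Real.exp (-(l * t)) ≤ 1 :=
          Real.exp_le_one_iff.2 (by have := ht.1; nlinarith)
        have e2 : |deriv s (t / R)| ≤ C := (hs.deriv_le _).trans
          (mul_le_of_le_one_right hC.le (Real.rpow_le_one (hs.nonneg _) (hs.le_one _) hs.pos.le))
        calc _ ≤ 1 * (C / R) := by gcongr
          _ = _ := one_mul _
      have i3 : IntegrableOn (fun t => Real.exp (-(l * t)) *
          (l * s (t / R) - deriv s (t / R) / R) * H t) (Set.Ioo 0 T) := by
        refine ((i1.const_mul l).sub i2).congr (Filter.Eventually.of_forall fun t => ?_)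
        simp only [Pi.sub_apply]
        ring
      refine integral_mono_ae (i1.const_mul l) i3 ?_
      filter_upwards [hUH, ae_restrict_mem measurableSet_Ioo] with t ht ht0
      have hH0 : 0 ≤ H t := (integral_nonneg (h0 t)).trans ht
      have hd : deriv s (t / R) / R ≤ 0 :=
        div_nonpos_of_nonpos_of_nonneg (hs.deriv_nonpos (div_pos ht0.1 hR)) hR.le
      have : 0 ≤ Real.exp (-(l * t)) * (-(deriv s (t / R) / R)) * H t := by
        have := Real.exp_pos (-(l * t))
        have h5 : 0 ≤ -(deriv s (t / R) / R) := by linarith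
        positivity
      nlinarith
    rw [hb0] at key
    set X := ∫ t in Set.Icc (R / 2) R, Real.exp (-(l * t)) * s (t / R) ^ κ * |a t| with hX
    have hX0 : 0 ≤ X := setIntegral_nonneg measurableSet_Icc fun t _ => by
      have := hsκ t
      positivity
    have h4 : C / R * (1 / R + 2 * l) * X ≤ l * (3 * C / R * X) := by
      have : 1 / R ≤ l := by rwa [div_le_iff₀ hR]
      calc _ ≤ C / R * (l + 2 * l) * X := by gcongr
        _ = _ := by ring
    set P := (∫ x, g x * radialSol N l x)
    set Q := (∫ x, f x * radialSol N l x)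
    set A := ∫ t in Set.Ioo 0 T, Real.exp (-(l * t)) * s (t / R) * H t
    refine (add_le_add le_rfl h1).trans ?_
    refine le_of_mul_le_mul_left ?_ hlpos
    have e6 : l * (ε * (P + l * Q) + A) = l * (ε * P + l * (ε * Q)) + l * A := by ring
    rw [e6]
    linarith

end Inequalities

end

noncomputable section

variable {N : ℕ}

lemma memLp_ofReal_of_integrable_rpow {α : Type*} [MeasurableSpace α] {μ : Measure α} {f : α → ℝ}
    {p : ℝ} (hp : 0 < p) (hf : AEStronglyMeasurable f μ) (h : Integrable (fun x => |f x| ^ p) μ) :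
    MemLp f (ENNReal.ofReal p) μ := by
  rw [← integrable_norm_rpow_iff hf (by simpa using hp) ENNReal.ofReal_ne_top]
  simpa [ENNReal.toReal_ofReal hp.le] using h

/-- Hölder's inequality on a ball, with the `Lᵖ` norm controlled through `G ≥ b |·|ᵖ`. -/
lemma setIntegral_abs_mul_le {p p' b : ℝ} (hpp : p.HolderConjugate p') (hb : 0 < b) {G : ℝ → ℝ}
    (hG : ∀ σ, b * |σ| ^ p ≤ G σ) {w : Space N → ℝ} (hw : AEStronglyMeasurable w volume)
    (hGw : Integrable fun x => G (w x)) {W : Space N → ℝ} (hW : Continuous W) (hW0 : ∀ x, 0 ≤ W x)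
    (ρ : ℝ) :
    ∫ x in Metric.closedBall 0 ρ, |w x| * W x ≤
      ((∫ x, G (w x)) / b) ^ (1 / p) * (∫ x in Metric.closedBall 0 ρ, W x ^ p') ^ (1 / p') := by
  have hp := hpp.pos
  have hp' := hpp.symm.pos
  have hi : Integrable fun x => |w x| ^ p := by
    refine (hGw.div_const b).mono' ?_ (Filter.Eventually.of_forall fun x => ?_)
    · exact (hw.aemeasurable.abs.pow_const p).aestronglyMeasurable
    · rw [Real.norm_eq_abs, abs_of_nonneg (by positivity), le_div_iff₀ hb, mul_comm]
      exact hG _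
  have hi' : Integrable (fun x => W x ^ p') (volume.restrict (Metric.closedBall 0 ρ)) :=
    ((hW.rpow_const fun x => Or.inr hp'.le).continuousOn).integrableOn_compact
      (isCompact_closedBall 0 ρ)
  have h1 : MemLp (fun x => |w x|) (ENNReal.ofReal p) (volume.restrict (Metric.closedBall 0 ρ)) := by
    refine memLp_ofReal_of_integrable_rpow hp (hw.restrict.norm) ?_
    simpa using hi.restrict
  have h2 : MemLp W (ENNReal.ofReal p') (volume.restrict (Metric.closedBall 0 ρ)) := by
    refine memLp_ofReal_of_integrable_rpow hp' hW.aestronglyMeasurable ?_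
    refine hi'.congr (Filter.Eventually.of_forall fun x => ?_)
    simp only [abs_of_nonneg (hW0 x)]
  refine (integral_mul_le_Lp_mul_Lq_of_nonneg hpp (Filter.Eventually.of_forall fun x => abs_nonneg _)
    (Filter.Eventually.of_forall hW0) h1 h2).trans ?_
  have h3 : ∫ x in Metric.closedBall 0 ρ, |w x| ^ p ≤ (∫ x, G (w x)) / b := by
    calc _ ≤ ∫ x, |w x| ^ p :=
          setIntegral_le_integral hi (Filter.Eventually.of_forall fun x => by positivity)
      _ ≤ ∫ x, G (w x) / b := integral_mono hi (hGw.div_const b) fun x => by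
          rw [le_div_iff₀ hb, mul_comm]; exact hG _
      _ = _ := integral_div _ _
  have h4 : 0 ≤ ∫ x in Metric.closedBall 0 ρ, W x ^ p' :=
    integral_nonneg fun x => Real.rpow_nonneg (hW0 x) _
  have h5 : 0 ≤ ∫ x in Metric.closedBall 0 ρ, |w x| ^ p :=
    integral_nonneg fun x => by positivity
  have h6 : 0 ≤ 1 / p := by positivity
  gcongr

/-- A superposition of the moments `∫ |w| e^{-lt} φ_l` is controlled by the nonlinear term. -/
lemma IsCutoff.sum_moments_le {T r R b p p' D κ C : ℝ} {s : ℝ → ℝ} (hs : IsCutoff s κ C)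
    (hpp : p.HolderConjugate p') (hκ : 1 / p ≤ κ) (hb : 0 < b) {G : ℝ → ℝ}
    (hG : ∀ σ, b * |σ| ^ p ≤ G σ) (hN : 1 ≤ N) (hR : 0 < R) (hRT : R < T) {w : ℝ → L2 N}
    (hMem : MemL1L1 T fun t x => G (w t x)) {J : Finset ℕ} {l k : ℕ → ℝ} (hk : ∀ j, 0 ≤ k j)
    {β : ℕ → ℝ → ℝ} (hβ : ∀ j ∈ J, ContinuousOn (β j) (Set.Ico 0 T))
    (hβw : ∀ j ∈ J, ∀ t ∈ Set.Ico 0 T,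
      |β j t| ≤ ∫ x in Metric.closedBall 0 (r + t), |w t x| * radialSol N (l j) x)
    (hD : ∀ t ∈ Set.Icc (R / 2) R, ∫ x in Metric.closedBall (0 : Space N) (r + t),
      (∑ j ∈ J, k j * (Real.exp (-(l j * t)) * radialSol N (l j) x)) ^ p' ≤ D) :
    ∑ j ∈ J, k j * ∫ t in Set.Icc (R / 2) R, Real.exp (-(l j * t)) * s (t / R) ^ κ * |β j t| ≤
      ((∫ t in Set.Ioo 0 T, s (t / R) * ∫ x, G (w t x)) / b) ^ (1 / p) * (R * D) ^ (1 / p') := by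
  have hp := hpp.pos
  have hp' := hpp.symm.pos
  have hG0 : ∀ σ, 0 ≤ G σ := fun σ => le_trans (by positivity) (hG σ)
  have hφ0 : ∀ l x, 0 ≤ radialSol N l x := fun l x => zero_le_one.trans (one_le_radialSol hN l x)
  have hφc : ∀ l, Continuous (radialSol N l) := fun l => (contDiff_radialSol hN l).continuous
  have hsub : Set.Icc (R / 2) R ⊆ Set.Ioo 0 T := fun t ht => ⟨by linarith [ht.1], ht.2.trans_lt hRT⟩
  set U : ℝ → ℝ := fun t => ∫ x, G (w t x) with hU
  have hU0 : ∀ t, 0 ≤ U t := fun t => integral_nonneg fun x => hG0 _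
  have hUi : IntegrableOn U (Set.Ioo 0 T) := hMem.integrableOn_integral
  have hsc : Continuous fun t => s (t / R) ^ κ :=
    (hs.contDiff_scaled R).continuous.rpow_const fun t => Or.inr hs.pos.le
  have hsUi : IntegrableOn (fun t => s (t / R) * U t) (Set.Ioo 0 T) := by
    simpa using hs.integrableOn_exp_mul (T := T) R 0 le_rfl hUi
  have hD0 : 0 ≤ D := le_trans (integral_nonneg fun x => Real.rpow_nonneg
    (Finset.sum_nonneg fun j _ => by have := hφ0 (l j) x; have := hk j; positivity) _)
    (hD R ⟨by linarith, le_rfl⟩)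
  set F : ℝ → ℝ := fun t => (s (t / R) * U t / b) ^ (1 / p) with hF
  have hF0 : ∀ t, 0 ≤ F t := fun t =>
    Real.rpow_nonneg (div_nonneg (mul_nonneg (hs.nonneg _) (hU0 t)) hb.le) _
  have hFp : ∀ t, F t ^ p = s (t / R) * U t / b := fun t => by
    rw [hF, ← Real.rpow_mul (div_nonneg (mul_nonneg (hs.nonneg _) (hU0 t)) hb.le),
      one_div_mul_cancel hp.ne', Real.rpow_one]
  have hsUb : IntegrableOn (fun t => s (t / R) * U t / b) (Set.Icc (R / 2) R) :=
    (hsUi.mono_set hsub).div_const b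
  have hFm : AEStronglyMeasurable F (volume.restrict (Set.Icc (R / 2) R)) :=
    (hsUb.aestronglyMeasurable.aemeasurable.pow_const _).aestronglyMeasurable
  have hFL : MemLp F (ENNReal.ofReal p) (volume.restrict (Set.Icc (R / 2) R)) := by
    refine memLp_ofReal_of_integrable_rpow hp hFm (hsUb.congr (Filter.Eventually.of_forall fun t => ?_))
    simp only [abs_of_nonneg (hF0 t), hFp]
  have hFi : IntegrableOn F (Set.Icc (R / 2) R) :=
    hFL.integrable (by simpa using hpp.lt.le)
  have hterm : ∀ j ∈ J, IntegrableOn (fun t => Real.exp (-(l j * t)) * s (t / R) ^ κ * |β j t|)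
      (Set.Icc (R / 2) R) := fun j hj =>
    ((Continuous.continuousOn (by fun_prop)).mul
      ((hβ j hj).mono (hsub.trans Set.Ioo_subset_Ico_self)).abs).integrableOn_Icc
  have hsum : ∑ j ∈ J, k j * ∫ t in Set.Icc (R / 2) R,
      Real.exp (-(l j * t)) * s (t / R) ^ κ * |β j t| =
      ∫ t in Set.Icc (R / 2) R, ∑ j ∈ J, k j * (Real.exp (-(l j * t)) * s (t / R) ^ κ * |β j t|) := by
    rw [integral_finsetSum _ fun j hj => (hterm j hj).const_mul _]
    simp_rw [integral_const_mul]
  rw [hsum]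
  have hpt : ∫ t in Set.Icc (R / 2) R,
      ∑ j ∈ J, k j * (Real.exp (-(l j * t)) * s (t / R) ^ κ * |β j t|) ≤
      ∫ t in Set.Icc (R / 2) R, F t * D ^ (1 / p') := by
    refine integral_mono_ae (integrable_finsetSum _ fun j hj => (hterm j hj).const_mul _)
      (hFi.mul_const _) ?_
    filter_upwards [ae_restrict_of_ae_restrict_of_subset hsub hMem.ae_integrable,
      ae_restrict_mem measurableSet_Icc] with t hGi ht
    have ht' : t ∈ Set.Ico 0 T := Set.Ioo_subset_Ico_self (hsub ht)
    have hsk : 0 ≤ s (t / R) ^ κ := Real.rpow_nonneg (hs.nonneg _) _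
    set W : Space N → ℝ := fun x => ∑ j ∈ J, k j * (Real.exp (-(l j * t)) * radialSol N (l j) x)
      with hW
    have hWc : Continuous W := continuous_finsetSum _ fun j _ =>
      continuous_const.mul (continuous_const.mul (hφc _))
    have hW0 : ∀ x, 0 ≤ W x := fun x => Finset.sum_nonneg fun j _ => by
      have := hφ0 (l j) x; have := hk j; positivity
    have hwi : ∀ j, IntegrableOn (fun x => |w t x| * radialSol N (l j) x)
        (Metric.closedBall 0 (r + t)) := by
      intro j
      have h2 : MemLp (radialSol N (l j)) 2 (volume.restrict (Metric.closedBall 0 (r + t))) := by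
        refine (memLp_two_iff_integrable_sq (hφc _).aestronglyMeasurable).2 ?_
        exact ((hφc _).pow 2).continuousOn.integrableOn_compact (isCompact_closedBall 0 _)
      exact MemLp.integrable_mul ((Lp.memLp (w t)).norm.restrict _) h2
    have e1 : ∑ j ∈ J, k j * (Real.exp (-(l j * t)) * s (t / R) ^ κ * |β j t|) ≤
        s (t / R) ^ κ * ∫ x in Metric.closedBall 0 (r + t), |w t x| * W x := by
      have e2 : ∫ x in Metric.closedBall 0 (r + t), |w t x| * W x = ∑ j ∈ J, k j *
          (Real.exp (-(l j * t)) * ∫ x in Metric.closedBall 0 (r + t), |w t x| * radialSol N (l j) x) := by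
        simp_rw [← integral_const_mul]
        rw [← integral_finsetSum _ fun j _ => ((hwi j).const_mul _).const_mul _]
        refine integral_congr_ae (Filter.Eventually.of_forall fun x => ?_)
        simp only [hW, Finset.mul_sum]
        refine Finset.sum_congr rfl fun j _ => by ring
      rw [e2, Finset.mul_sum]
      refine Finset.sum_le_sum fun j hj => ?_
      have h3 := hβw j hj t ht'
      have h4 := hk j
      calc k j * (Real.exp (-(l j * t)) * s (t / R) ^ κ * |β j t|) ≤ k j * (Real.exp (-(l j * t)) *
            s (t / R) ^ κ * ∫ x in Metric.closedBall 0 (r + t), |w t x| * radialSol N (l j) x) := by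
            gcongr
        _ = _ := by ring
    have e3 := setIntegral_abs_mul_le hpp hb hG (Lp.aestronglyMeasurable (w t)) hGi hWc hW0 (r + t)
    have e4 : s (t / R) ^ κ ≤ s (t / R) ^ (1 / p) :=
      Real.rpow_le_rpow_of_exponent_ge' (hs.nonneg _) (hs.le_one _) (by positivity) hκ
    have e5 : (∫ x in Metric.closedBall 0 (r + t), W x ^ p') ^ (1 / p') ≤ D ^ (1 / p') :=
      Real.rpow_le_rpow (integral_nonneg fun x => Real.rpow_nonneg (hW0 x) _) (hD t ht) (by positivity)
    have hUb : 0 ≤ U t / b := div_nonneg (hU0 t) hb.le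
    have hs0 : 0 ≤ s (t / R) ^ (1 / p) := Real.rpow_nonneg (hs.nonneg _) _
    calc _ ≤ _ := e1
      _ ≤ s (t / R) ^ (1 / p) * ((U t / b) ^ (1 / p) * D ^ (1 / p')) := by
          apply mul_le_mul e4 _ _ hs0
          · exact e3.trans (mul_le_mul_of_nonneg_left e5 (Real.rpow_nonneg hUb _))
          · exact integral_nonneg fun x => mul_nonneg (abs_nonneg _) (hW0 x)
      _ = F t * D ^ (1 / p') := by
          rw [← mul_assoc, ← Real.mul_rpow (hs.nonneg _) hUb]
          simp only [hF, mul_div_assoc]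
  refine hpt.trans ?_
  have hconst : MemLp (fun _ : ℝ => D ^ (1 / p')) (ENNReal.ofReal p')
      (volume.restrict (Set.Icc (R / 2) R)) := memLp_const _
  have hold := integral_mul_le_Lp_mul_Lq_of_nonneg hpp (Filter.Eventually.of_forall hF0)
    (Filter.Eventually.of_forall fun _ => Real.rpow_nonneg hD0 _) hFL hconst
  refine hold.trans ?_
  have f1 : ∫ t in Set.Icc (R / 2) R, F t ^ p ≤ (∫ t in Set.Ioo 0 T, s (t / R) * U t) / b := by
    simp_rw [hFp]
    rw [← integral_div]
    exact setIntegral_mono_set (hsUi.div_const b) (Filter.Eventually.of_forall fun t =>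
      div_nonneg (mul_nonneg (hs.nonneg _) (hU0 t)) hb.le) hsub.eventuallyLE
  have f2 : ∫ t in Set.Icc (R / 2) R, (D ^ (1 / p')) ^ p' ≤ R * D := by
    rw [← Real.rpow_mul hD0, one_div_mul_cancel hp'.ne', Real.rpow_one, setIntegral_const,
      Real.volume_real_Icc_of_le (by linarith), smul_eq_mul]
    nlinarith
  have f3 : 0 ≤ ∫ t in Set.Icc (R / 2) R, F t ^ p :=
    integral_nonneg fun t => Real.rpow_nonneg (hF0 t) _
  have f4 : 0 ≤ ∫ t in Set.Icc (R / 2) R, (D ^ (1 / p')) ^ p' :=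
    integral_nonneg fun t => Real.rpow_nonneg (Real.rpow_nonneg hD0 _) _
  have f7 : 0 ≤ (∫ t in Set.Ioo 0 T, s (t / R) * U t) / b := f3.trans f1
  have f8 : 0 ≤ ((∫ t in Set.Ioo 0 T, s (t / R) * U t) / b) ^ (1 / p) := Real.rpow_nonneg f7 _
  have f5 : 0 ≤ 1 / p := by positivity
  have f6 : 0 ≤ 1 / p' := by positivity
  exact mul_le_mul (Real.rpow_le_rpow f3 f1 f5) (Real.rpow_le_rpow f4 f2 f6)
    (Real.rpow_nonneg f4 _) f8

end

noncomputable section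

variable {N : ℕ}

lemma setIntegral_closedBall_norm_le (hN : 1 ≤ N) : ∃ C : ℝ, 0 < C ∧ ∀ (F : ℝ → ℝ) (ρ : ℝ), 0 ≤ ρ →
    (∀ y ∈ Set.Icc 0 ρ, 0 ≤ F y) → ContinuousOn F (Set.Icc 0 ρ) →
    ∫ x in Metric.closedBall (0 : Space N) ρ, F ‖x‖ ≤ C * ρ ^ (N - 1) * ∫ y in (0)..ρ, F y := by
  have : Nonempty (Fin N) := ⟨⟨0, hN⟩⟩
  have hv : 0 < volume.real (Metric.ball (0 : Space N) 1) :=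
    ENNReal.toReal_pos (Metric.measure_ball_pos _ _ one_pos).ne' Metric.isBounded_ball.measure_lt_top.ne
  refine ⟨N * volume.real (Metric.ball (0 : Space N) 1), by positivity, fun F ρ hρ hF hFc => ?_⟩
  have h1 : ∫ x in Metric.closedBall (0 : Space N) ρ, F ‖x‖ =
      ∫ x : Space N, (Set.Iic ρ).indicator F ‖x‖ := by
    rw [← integral_indicator measurableSet_closedBall]
    congr 1; ext x
    by_cases hx : ‖x‖ ≤ ρ
    · rw [Set.indicator_of_mem (by simpa using hx), Set.indicator_of_mem (by simpa using hx)]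
    · rw [Set.indicator_of_notMem (by simpa using hx), Set.indicator_of_notMem (by simpa using hx)]
  have h2 : ∫ y in Set.Ioi (0 : ℝ), y ^ (N - 1) • (Set.Iic ρ).indicator F y =
      ∫ y in Set.Ioc 0 ρ, y ^ (N - 1) * F y := by
    have : (fun y : ℝ => y ^ (N - 1) • (Set.Iic ρ).indicator F y) =
        (Set.Iic ρ).indicator fun y => y ^ (N - 1) * F y := by
      ext y
      by_cases hy : y ≤ ρ
      · rw [Set.indicator_of_mem (by simpa using hy), Set.indicator_of_mem (by simpa using hy),
          smul_eq_mul]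
      · rw [Set.indicator_of_notMem (by simpa using hy), Set.indicator_of_notMem (by simpa using hy),
          smul_zero]
    rw [this, setIntegral_indicator measurableSet_Iic]
    rfl
  rw [h1, integral_fun_norm_addHaar, finrank_euclideanSpace, Fintype.card_fin, h2,
    nsmul_eq_mul, smul_eq_mul, intervalIntegral.integral_of_le hρ]
  have h3 : ∫ y in Set.Ioc 0 ρ, y ^ (N - 1) * F y ≤ ρ ^ (N - 1) * ∫ y in Set.Ioc 0 ρ, F y := by
    rw [← integral_const_mul]
    have i0 : IntegrableOn F (Set.Icc 0 ρ) := hFc.integrableOn_Icc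
    have i1 : IntegrableOn (fun y => y ^ (N - 1) * F y) (Set.Icc 0 ρ) :=
      ((continuous_pow _).continuousOn.mul hFc).integrableOn_Icc
    refine setIntegral_mono_on (i1.mono_set Set.Ioc_subset_Icc_self)
      ((i0.mono_set Set.Ioc_subset_Icc_self).const_mul _) measurableSet_Ioc fun y hy => ?_
    have := hF y ⟨hy.1.le, hy.2⟩
    have := hy.1.le
    have := hy.2
    gcongr
  calc _ ≤ N * (volume.real (Metric.ball (0 : Space N) 1) * (ρ ^ (N - 1) * ∫ y in Set.Ioc 0 ρ, F y)) := by
        gcongr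
    _ = _ := by ring

lemma integral_one_add_rpow_le {l p ρ : ℝ} (hl : 0 < l) (hp : 1 < p) (hρ : 0 ≤ ρ) :
    ∫ y in (0)..ρ, (1 + l * (ρ - y)) ^ (-p) ≤ 1 / (l * (p - 1)) := by
  have hpos : ∀ y ∈ Set.uIcc 0 ρ, 0 < 1 + l * (ρ - y) := by
    intro y hy
    rw [Set.uIcc_of_le hρ] at hy
    have : 0 ≤ ρ - y := by linarith [hy.2]
    positivity
  have hp1 : p - 1 ≠ 0 := by linarith
  have hd : ∀ y ∈ Set.uIcc 0 ρ, HasDerivAt (fun y => (1 + l * (ρ - y)) ^ (1 - p) / (l * (p - 1)))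
      ((1 + l * (ρ - y)) ^ (-p)) y := by
    intro y hy
    have h1 : HasDerivAt (fun y => 1 + l * (ρ - y)) (-l) y := by
      have := (((hasDerivAt_id y).const_sub ρ).const_mul l).const_add 1
      exact this.congr_deriv (by ring)
    have := (h1.rpow_const (p := 1 - p) (Or.inl (hpos y hy).ne')).div_const (l * (p - 1))
    refine this.congr_deriv ?_
    rw [show 1 - p - 1 = -p by ring]
    field_simp
    ring
  have hc : ContinuousOn (fun y => (1 + l * (ρ - y)) ^ (-p)) (Set.uIcc 0 ρ) :=
    ContinuousOn.rpow_const (by fun_prop) fun y hy => Or.inl (hpos y hy).ne'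
  rw [intervalIntegral.integral_eq_sub_of_hasDerivAt hd hc.intervalIntegrable]
  have h2 : 0 ≤ (1 + l * (ρ - 0)) ^ (1 - p) / (l * (p - 1)) := by
    have : 0 < p - 1 := by linarith
    have := hpos 0 (by simp)
    positivity
  simp only [sub_self, mul_zero, add_zero, Real.one_rpow] at h2 ⊢
  linarith

lemma integral_one_add_inv_eq {ρ : ℝ} (hρ : 0 ≤ ρ) :
    ∫ y in (0)..ρ, (1 + (ρ - y))⁻¹ = Real.log (1 + ρ) := by
  have hpos : ∀ y ∈ Set.uIcc 0 ρ, 0 < 1 + (ρ - y) := by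
    intro y hy
    rw [Set.uIcc_of_le hρ] at hy
    linarith [hy.2]
  have hd : ∀ y ∈ Set.uIcc 0 ρ, HasDerivAt (fun y => -Real.log (1 + (ρ - y))) ((1 + (ρ - y))⁻¹) y := by
    intro y hy
    have h1 : HasDerivAt (fun y => 1 + (ρ - y)) (-1) y :=
      ((hasDerivAt_id y).const_sub ρ).const_add 1
    exact (h1.log (hpos y hy).ne').neg.congr_deriv (by ring)
  have hc : ContinuousOn (fun y => (1 + (ρ - y))⁻¹) (Set.uIcc 0 ρ) :=
    ContinuousOn.inv₀ (by fun_prop) fun y hy => (hpos y hy).ne'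
  rw [intervalIntegral.integral_eq_sub_of_hasDerivAt hd hc.intervalIntegrable]
  simp

/-- Concentration of `e^{-lt} φ_l` near the light cone. -/
lemma exp_mul_radialSol_le (hN : 1 ≤ N) {r : ℝ} (hr : 0 ≤ r) : ∃ C : ℝ, 0 < C ∧ ∀ l t : ℝ, 0 ≤ l →
    l ≤ 1 → 0 ≤ t → ∀ x : Space N, ‖x‖ ≤ r + t → Real.exp (-(l * t)) * radialSol N l x ≤
      C * (1 + l * t) ^ (-(((N : ℝ) - 1) / 2)) * (1 + l * (r + t - ‖x‖))⁻¹ := by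
  obtain ⟨C, hC, h⟩ := radialSol_le hN
  set m : ℝ := ((N : ℝ) - 1) / 2 with hm
  have hm0 : 0 ≤ m := by
    have : (1 : ℝ) ≤ N := by exact_mod_cast hN
    rw [hm]; linarith
  obtain ⟨k, hk⟩ := exists_nat_ge (m + 1)
  refine ⟨C * (Real.exp r * (k.factorial * Real.exp 1)), by positivity,
    fun l t hl hl1 ht x hx => ?_⟩
  set y := l * (r + t - ‖x‖) with hy
  have hσ : 0 ≤ r + t - ‖x‖ := by linarith
  have hy0 : 0 ≤ y := mul_nonneg hl hσ
  have hX : 0 < 1 + l * ‖x‖ := by positivity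
  have hTt : 0 < 1 + l * t := by positivity
  have hY : 0 < 1 + y := by linarith
  have h1 : (1 + l * ‖x‖) ^ (-m) ≤ (1 + l * t) ^ (-m) * (1 + y) ^ m := by
    rw [Real.rpow_neg hX.le, Real.rpow_neg hTt.le, ← div_eq_inv_mul, inv_eq_one_div,
      div_le_div_iff₀ (by positivity) (by positivity), one_mul, ← Real.mul_rpow hY.le hX.le]
    refine Real.rpow_le_rpow hTt.le ?_ hm0
    have : l * t ≤ l * ‖x‖ + y := by rw [hy]; nlinarith
    nlinarith [mul_nonneg hy0 (mul_nonneg hl (norm_nonneg x))]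
  have h2 : (1 + y) ^ m * (1 + y) ≤ k.factorial * Real.exp 1 * Real.exp y := by
    rw [← Real.rpow_add_one hY.ne']
    calc (1 + y) ^ (m + 1) ≤ (1 + y) ^ (k : ℝ) := Real.rpow_le_rpow_of_exponent_le (by linarith) hk
      _ = (1 + y) ^ k := Real.rpow_natCast _ _
      _ ≤ k.factorial * Real.exp (1 + y) := by
          have := Real.pow_div_factorial_le_exp (1 + y) hY.le k
          rwa [div_le_iff₀ (by positivity), mul_comm] at this
      _ = _ := by rw [Real.exp_add]; ring
  have h2' : (1 + y) ^ m ≤ k.factorial * Real.exp 1 * Real.exp y * (1 + y)⁻¹ := by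
    rwa [← div_eq_mul_inv, le_div_iff₀ hY]
  have h3 : Real.exp (-(l * t)) * Real.exp (l * ‖x‖) ≤ Real.exp r * Real.exp (-y) := by
    rw [← Real.exp_add, ← Real.exp_add]
    refine Real.exp_le_exp.2 ?_
    have : l * r ≤ r := by nlinarith
    rw [hy]; nlinarith
  calc Real.exp (-(l * t)) * radialSol N l x
      ≤ Real.exp (-(l * t)) * (C * (1 + l * ‖x‖) ^ (-m) * Real.exp (l * ‖x‖)) := by
        gcongr
        exact h l hl x
    _ = C * (1 + l * ‖x‖) ^ (-m) * (Real.exp (-(l * t)) * Real.exp (l * ‖x‖)) := by ring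
    _ ≤ C * ((1 + l * t) ^ (-m) * (k.factorial * Real.exp 1 * Real.exp y * (1 + y)⁻¹)) *
        (Real.exp r * Real.exp (-y)) := by
        gcongr
        exact h1.trans (mul_le_mul_of_nonneg_left h2' (by positivity))
    _ = _ := by
        have : Real.exp y * Real.exp (-y) = 1 := by rw [← Real.exp_add]; simp
        calc _ = C * (Real.exp r * (k.factorial * Real.exp 1)) * (1 + l * t) ^ (-m) * (1 + y)⁻¹ *
              (Real.exp y * Real.exp (-y)) := by ring
          _ = _ := by rw [this, mul_one]

/-- Dyadic geometric sums on both sides of a threshold. -/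
lemma sum_dyadic_le {α : ℝ} (h0 : 0 < α) (h1 : α < 1) : ∃ C : ℝ, 0 < C ∧ ∀ (R₀ σ : ℝ), 1 ≤ R₀ → 0 ≤ σ →
    ∀ n : ℕ, ∑ j ∈ Finset.range n, (R₀ * 2 ^ j) ^ (-α) * (1 + (R₀ * 2 ^ j)⁻¹ * σ)⁻¹ ≤
      C * (1 + σ) ^ (-α) := by
  set K1 : ℝ := (1 - 2 ^ (-(1 - α)))⁻¹ with hK1
  set K2 : ℝ := (1 - 2 ^ (-α))⁻¹ with hK2
  have hk1 : (0 : ℝ) < 1 - 2 ^ (-(1 - α)) := by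
    have : (2 : ℝ) ^ (-(1 - α)) < 1 := Real.rpow_lt_one_of_one_lt_of_neg (by norm_num) (by linarith)
    linarith
  have hk2 : (0 : ℝ) < 1 - 2 ^ (-α) := by
    have : (2 : ℝ) ^ (-α) < 1 := Real.rpow_lt_one_of_one_lt_of_neg (by norm_num) (by linarith)
    linarith
  have hK1p : 0 < K1 := inv_pos.2 hk1
  have hK2p : 0 < K2 := inv_pos.2 hk2
  refine ⟨2 * (K1 + K2), by positivity, fun R₀ σ hR₀ hσ n => ?_⟩
  set A := 1 + σ with hA
  have hA0 : 0 < A := by positivity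
  have hr : ∀ j : ℕ, 1 ≤ R₀ * 2 ^ j := fun j => by
    have : (1 : ℝ) ≤ 2 ^ j := one_le_pow₀ (by norm_num)
    nlinarith
  set f1 : ℕ → ℝ := fun j => min (R₀ * 2 ^ j / 2) A ^ (1 - α) with hf1
  set f2 : ℕ → ℝ := fun j => max (R₀ * 2 ^ j) A ^ (-α) with hf2
  have hterm : ∀ j, (R₀ * 2 ^ j) ^ (-α) * (1 + (R₀ * 2 ^ j)⁻¹ * σ)⁻¹ ≤
      2 * (K1 * A⁻¹ * (f1 (j + 1) - f1 j) + K2 * (f2 j - f2 (j + 1))) := by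
    intro j
    have hr1 := hr j
    set ρ := R₀ * 2 ^ j with hρ
    have hρ0 : 0 < ρ := by linarith
    have es : R₀ * 2 ^ (j + 1) = 2 * ρ := by rw [hρ, pow_succ]; ring
    have e1 : f1 (j + 1) = min ρ A ^ (1 - α) := by simp only [hf1, es]; congr 2; ring
    have e2 : f1 j = min (ρ / 2) A ^ (1 - α) := rfl
    have e3 : f2 j = max ρ A ^ (-α) := rfl
    have e4 : f2 (j + 1) = max (2 * ρ) A ^ (-α) := by simp only [hf2, es]
    have d1 : 0 ≤ f1 (j + 1) - f1 j := by
      rw [e1, e2, sub_nonneg]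
      exact Real.rpow_le_rpow (by positivity) (min_le_min_right _ (by linarith)) (by linarith)
    have d2 : 0 ≤ f2 j - f2 (j + 1) := by
      rw [e3, e4, sub_nonneg]
      exact Real.rpow_le_rpow_of_nonpos (lt_max_of_lt_left hρ0) (max_le_max_right _ (by linarith))
        (by linarith)
    have hb : ρ ^ (-α) * (1 + ρ⁻¹ * σ)⁻¹ ≤ 2 * (ρ ^ (1 - α) / (ρ + A)) := by
      have : ρ ^ (-α) * (1 + ρ⁻¹ * σ)⁻¹ = ρ ^ (1 - α) / (ρ + σ) := by
        rw [show 1 - α = -α + 1 by ring, Real.rpow_add_one hρ0.ne']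
        field_simp
      rw [this, ← mul_div_assoc, div_le_div_iff₀ (by positivity) (by positivity)]
      have : ρ + A ≤ 2 * (ρ + σ) := by rw [hA]; linarith
      calc _ ≤ ρ ^ (1 - α) * (2 * (ρ + σ)) := by gcongr
        _ = _ := by ring
    refine hb.trans (mul_le_mul_of_nonneg_left ?_ (by norm_num))
    rcases le_or_gt ρ A with hle | hgt
    · have g1 : f1 (j + 1) - f1 j = (1 - 2 ^ (-(1 - α))) * ρ ^ (1 - α) := by
        rw [e1, e2, min_eq_left hle, min_eq_left (by linarith), Real.div_rpow hρ0.le (by norm_num),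
          Real.rpow_neg (by norm_num)]
        ring
      have g2 : K1 * A⁻¹ * (f1 (j + 1) - f1 j) = ρ ^ (1 - α) / A := by
        rw [g1, hK1]; field_simp
      have g3 : ρ ^ (1 - α) / (ρ + A) ≤ ρ ^ (1 - α) / A := by
        gcongr; linarith
      have : 0 ≤ K2 * (f2 j - f2 (j + 1)) := mul_nonneg hK2p.le d2
      linarith
    · have g1 : f2 j - f2 (j + 1) = (1 - 2 ^ (-α)) * ρ ^ (-α) := by
        rw [e3, e4, max_eq_left hgt.le, max_eq_left (by linarith),
          Real.mul_rpow (by norm_num) hρ0.le]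
        ring
      have g2 : K2 * (f2 j - f2 (j + 1)) = ρ ^ (-α) := by
        rw [g1, hK2]; field_simp
      have g3 : ρ ^ (1 - α) / (ρ + A) ≤ ρ ^ (-α) := by
        rw [div_le_iff₀ (by positivity), show 1 - α = -α + 1 by ring, Real.rpow_add_one hρ0.ne']
        gcongr; linarith
      have : 0 ≤ K1 * A⁻¹ * (f1 (j + 1) - f1 j) := mul_nonneg (by positivity) d1
      linarith
  refine (Finset.sum_le_sum fun j _ => hterm j).trans ?_
  rw [← Finset.mul_sum, Finset.sum_add_distrib, ← Finset.mul_sum, ← Finset.mul_sum,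
    Finset.sum_range_sub, Finset.sum_range_sub']
  have b1 : f1 n - f1 0 ≤ A ^ (1 - α) := by
    have : 0 ≤ f1 0 := by simp only [hf1]; positivity
    have : f1 n ≤ A ^ (1 - α) :=
      Real.rpow_le_rpow (le_min (by have := hr n; positivity) hA0.le) (min_le_right _ _) (by linarith)
    linarith
  have b2 : f2 0 - f2 n ≤ A ^ (-α) := by
    have : 0 ≤ f2 n := by
      simp only [hf2]; exact Real.rpow_nonneg (hA0.le.trans (le_max_right _ _)) _
    have : f2 0 ≤ A ^ (-α) :=
      Real.rpow_le_rpow_of_nonpos hA0 (le_max_right _ _) (by linarith)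
    linarith
  have b3 : A⁻¹ * A ^ (1 - α) = A ^ (-α) := by
    rw [show 1 - α = -α + 1 by ring, Real.rpow_add_one hA0.ne']; field_simp
  calc _ ≤ 2 * (K1 * A⁻¹ * A ^ (1 - α) + K2 * A ^ (-α)) := by gcongr
    _ = 2 * (K1 * (A⁻¹ * A ^ (1 - α)) + K2 * A ^ (-α)) := by ring
    _ = _ := by rw [b3]; ring

/-- `∫ |e^{-lt} φ_l|^{p'}` over the cone, for `l = 0`. -/
lemma exists_bound_weight_zero (hN : 1 ≤ N) {r : ℝ} (hr : 0 ≤ r) (p' : ℝ) : ∃ C : ℝ, 0 < C ∧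
    ∀ R : ℝ, 1 ≤ R → ∀ t ∈ Set.Icc (R / 2) R,
      ∫ x in Metric.closedBall (0 : Space N) (r + t),
        (1 * (Real.exp (-(0 * t)) * radialSol N 0 x)) ^ p' ≤ C * R ^ (N : ℝ) := by
  obtain ⟨C, hC, h⟩ := setIntegral_closedBall_norm_le hN
  refine ⟨C * (r + 1) ^ N, by positivity, fun R hR t ht => ?_⟩
  have ht0 : 0 ≤ t := by linarith [ht.1]
  have := h (fun _ => 1) (r + t) (by positivity) (fun _ _ => zero_le_one) continuousOn_const
  simp only [radialSol_zero_left, zero_mul, neg_zero, Real.exp_zero, one_mul, Real.one_rpow]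
  refine this.trans ?_
  simp only [intervalIntegral.integral_const, sub_zero, smul_eq_mul, mul_one]
  have e : (r + t) ^ (N - 1) * (r + t) = (r + t) ^ N := by
    rw [← pow_succ, Nat.sub_add_cancel hN]
  have h1 : r + t ≤ (r + 1) * R := by nlinarith [ht.2]
  calc C * (r + t) ^ (N - 1) * (r + t) = C * (r + t) ^ N := by rw [mul_assoc, e]
    _ ≤ C * ((r + 1) * R) ^ N := by gcongr
    _ = _ := by rw [mul_pow, Real.rpow_natCast]; ring

/-- `∫ |e^{-lt} φ_l|^{p'}` over the cone, for a fixed `l > 0`. -/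
lemma exists_bound_weight_pos (hN : 1 ≤ N) {r l p' : ℝ} (hr : 0 ≤ r) (hl : 0 < l) (hl1 : l ≤ 1)
    (hp' : 1 < p') : ∃ C : ℝ, 0 < C ∧ ∀ R : ℝ, 1 ≤ R → ∀ t ∈ Set.Icc (R / 2) R,
      ∫ x in Metric.closedBall (0 : Space N) (r + t),
        (1 * (Real.exp (-(l * t)) * radialSol N l x)) ^ p' ≤
          C * R ^ (((N : ℝ) - 1) - ((N : ℝ) - 1) / 2 * p') := by
  obtain ⟨C, hC, h⟩ := setIntegral_closedBall_norm_le hN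
  obtain ⟨C1, hC1, h1⟩ := exp_mul_radialSol_le hN hr
  set m : ℝ := ((N : ℝ) - 1) / 2 with hm
  have hm0 : 0 ≤ m := by
    have : (1 : ℝ) ≤ N := by exact_mod_cast hN
    rw [hm]; linarith
  refine ⟨(C1 * (l / 2) ^ (-m)) ^ p' * (C * (r + 1) ^ (N - 1) * (1 / (l * (p' - 1)))),
    by have : 0 < p' - 1 := by linarith
       positivity, fun R hR t ht => ?_⟩
  have hR0 : 0 < R := by linarith
  have ht0 : 0 ≤ t := by linarith [ht.1]
  have hφ0 : ∀ x, 0 ≤ radialSol N l x := fun x => zero_le_one.trans (one_le_radialSol hN l x)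
  have hφc : Continuous (radialSol N l) := (contDiff_radialSol hN l).continuous
  set ρ := r + t with hρ
  have hρ0 : 0 ≤ ρ := by positivity
  have hb : ∀ y ∈ Set.Icc 0 ρ, 0 < 1 + l * (ρ - y) := fun y hy => by
    have : 0 ≤ ρ - y := by linarith [hy.2]
    positivity
  have hFc : ContinuousOn (fun y => (1 + l * (ρ - y)) ^ (-p')) (Set.Icc 0 ρ) :=
    ContinuousOn.rpow_const (by fun_prop) fun y hy => Or.inl (hb y hy).ne'
  have hpt : ∀ x ∈ Metric.closedBall (0 : Space N) ρ,
      (1 * (Real.exp (-(l * t)) * radialSol N l x)) ^ p' ≤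
        (C1 * (l / 2) ^ (-m)) ^ p' * R ^ (-(m * p')) * (1 + l * (ρ - ‖x‖)) ^ (-p') := by
    intro x hx
    have hx' : ‖x‖ ≤ ρ := by simpa using hx
    have hbx := hb ‖x‖ ⟨norm_nonneg x, hx'⟩
    have g1 := h1 l t hl.le hl1 ht0 x hx'
    have g2 : (1 + l * t) ^ (-m) ≤ (l / 2) ^ (-m) * R ^ (-m) := by
      rw [← Real.mul_rpow (by positivity) hR0.le]
      refine Real.rpow_le_rpow_of_nonpos (by positivity) ?_ (by linarith)
      nlinarith [ht.1]
    have g3 : 0 ≤ Real.exp (-(l * t)) * radialSol N l x :=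
      mul_nonneg (Real.exp_pos _).le (hφ0 x)
    rw [one_mul]
    calc _ ≤ (C1 * ((l / 2) ^ (-m) * R ^ (-m)) * (1 + l * (ρ - ‖x‖))⁻¹) ^ p' := by
          refine Real.rpow_le_rpow g3 (g1.trans ?_) (by linarith)
          have := inv_pos.2 hbx
          gcongr
      _ = _ := by
          rw [show C1 * ((l / 2) ^ (-m) * R ^ (-m)) = C1 * (l / 2) ^ (-m) * R ^ (-m) by ring,
            Real.mul_rpow (by positivity) (inv_pos.2 hbx).le, Real.mul_rpow (by positivity)
            (by positivity), ← Real.rpow_mul hR0.le, Real.inv_rpow hbx.le, Real.rpow_neg hbx.le p',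
            neg_mul]
  have hi : IntegrableOn (fun x : Space N => (1 + l * (ρ - ‖x‖)) ^ (-p')) (Metric.closedBall 0 ρ) := by
    refine ContinuousOn.integrableOn_compact (isCompact_closedBall 0 _) ?_
    exact hFc.comp continuous_norm.continuousOn fun x hx => ⟨norm_nonneg x, by simpa using hx⟩
  have hi2 : IntegrableOn (fun x : Space N => (1 * (Real.exp (-(l * t)) * radialSol N l x)) ^ p')
      (Metric.closedBall 0 ρ) := by
    refine ContinuousOn.integrableOn_compact (isCompact_closedBall 0 _) (Continuous.continuousOn ?_)
    exact (continuous_const.mul (continuous_const.mul hφc)).rpow_const fun x => Or.inr (by linarith)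
  refine (setIntegral_mono_on hi2 (hi.const_mul _) measurableSet_closedBall hpt).trans ?_
  rw [integral_const_mul]
  have g4 := h (fun y => (1 + l * (ρ - y)) ^ (-p')) ρ hρ0
    (fun y hy => Real.rpow_nonneg (hb y hy).le _) hFc
  have g5 := integral_one_add_rpow_le hl hp' hρ0
  have g6 : ρ ^ (N - 1) ≤ (r + 1) ^ (N - 1) * R ^ (N - 1) := by
    rw [← mul_pow]
    have : ρ ≤ (r + 1) * R := by rw [hρ]; nlinarith [ht.2]
    gcongr
  have g7 : R ^ (N - 1) = R ^ ((N : ℝ) - 1) := by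
    rw [← Real.rpow_natCast, Nat.cast_sub hN, Nat.cast_one]
  have hp1 : 0 < p' - 1 := by linarith
  have g8 : 0 ≤ ∫ y in (0)..ρ, (1 + l * (ρ - y)) ^ (-p') :=
    intervalIntegral.integral_nonneg hρ0 fun y hy => Real.rpow_nonneg (hb y hy).le _
  calc _ ≤ (C1 * (l / 2) ^ (-m)) ^ p' * R ^ (-(m * p')) *
        (C * ((r + 1) ^ (N - 1) * R ^ (N - 1)) * (1 / (l * (p' - 1)))) := by
        refine mul_le_mul_of_nonneg_left (g4.trans ?_) (by positivity)
        gcongr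
    _ = (C1 * (l / 2) ^ (-m)) ^ p' * (C * (r + 1) ^ (N - 1) * (1 / (l * (p' - 1)))) *
        (R ^ (N - 1) * R ^ (-(m * p'))) := by ring
    _ = _ := by rw [g7, ← Real.rpow_add hR0, ← sub_eq_add_neg]

/-- The dyadic superposition of `e^{-lt} φ_l` in the critical case; the logarithm of the radius
appears as the number `n + 1` of terms. -/
lemma exists_bound_weight_sum (hN : 1 ≤ N) {r p p' R₀ : ℝ} (hr : 0 ≤ r) (hR₀ : 1 ≤ R₀)
    (hpp : p.HolderConjugate p') : ∃ C : ℝ, 0 < C ∧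
    ∀ n : ℕ, ∀ t ∈ Set.Icc (R₀ * 2 ^ n / 2) (R₀ * 2 ^ n),
      ∫ x in Metric.closedBall (0 : Space N) (r + t),
        (∑ j ∈ Finset.range (n + 1), (R₀ * 2 ^ j) ^ (-(((N : ℝ) - 1) / 2 + 1 - 1 / p)) *
          (Real.exp (-((R₀ * 2 ^ j)⁻¹ * t)) * radialSol N (R₀ * 2 ^ j)⁻¹ x)) ^ p' ≤
        C * (R₀ * 2 ^ n) ^ (((N : ℝ) - 1) - ((N : ℝ) - 1) / 2 * p') * ((n : ℝ) + 1) := by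
  have hp' := hpp.symm.lt
  have hα : 1 - 1 / p = 1 / p' := by
    have := hpp.inv_add_inv_eq_one
    rw [one_div, one_div]; linarith
  obtain ⟨C, hC, h⟩ := setIntegral_closedBall_norm_le hN
  obtain ⟨C1, hC1, h1⟩ := exp_mul_radialSol_le hN hr
  obtain ⟨C2, hC2, h2⟩ := sum_dyadic_le (α := 1 / p') (by have := hpp.symm.pos; positivity)
    (by rw [div_lt_one hpp.symm.pos]; exact hp')
  set m : ℝ := ((N : ℝ) - 1) / 2 with hm
  have hm0 : 0 ≤ m := by
    have : (1 : ℝ) ≤ N := by exact_mod_cast hN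
    rw [hm]; linarith
  have hlog : 0 ≤ Real.log (2 * r + 2 * R₀) := Real.log_nonneg (by linarith)
  refine ⟨(C1 * (1 / 2 : ℝ) ^ (-m) * C2) ^ p' * (C * (r + 1) ^ (N - 1) *
    (Real.log (2 * r + 2 * R₀) + 1)), by positivity, fun n t ht => ?_⟩
  set R := R₀ * 2 ^ n with hR
  have hR1 : 1 ≤ R := by
    have : (1 : ℝ) ≤ 2 ^ n := one_le_pow₀ (by norm_num)
    rw [hR]; nlinarith
  have hR0 : 0 < R := by linarith
  have ht0 : 0 ≤ t := by linarith [ht.1]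
  have hφ0 : ∀ l x, 0 ≤ radialSol N l x := fun l x => zero_le_one.trans (one_le_radialSol hN l x)
  have hφc : ∀ l, Continuous (radialSol N l) := fun l => (contDiff_radialSol hN l).continuous
  set ρ := r + t with hρ
  have hρ0 : 0 ≤ ρ := by positivity
  have hb : ∀ y ∈ Set.Icc 0 ρ, 0 < 1 + (ρ - y) := fun y hy => by linarith [hy.2]
  have hrj : ∀ j : ℕ, 1 ≤ R₀ * 2 ^ j := fun j => by
    have : (1 : ℝ) ≤ 2 ^ j := one_le_pow₀ (by norm_num)
    nlinarith
  have hFc : ContinuousOn (fun y => (1 + (ρ - y))⁻¹) (Set.Icc 0 ρ) :=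
    ContinuousOn.inv₀ (by fun_prop) fun y hy => (hb y hy).ne'
  set W : Space N → ℝ := fun x => ∑ j ∈ Finset.range (n + 1), (R₀ * 2 ^ j) ^ (-(m + 1 - 1 / p)) *
    (Real.exp (-((R₀ * 2 ^ j)⁻¹ * t)) * radialSol N (R₀ * 2 ^ j)⁻¹ x) with hW
  have hW0 : ∀ x, 0 ≤ W x := fun x => Finset.sum_nonneg fun j _ => by
    have := hφ0 (R₀ * 2 ^ j)⁻¹ x; have := hrj j; positivity
  have hWc : Continuous W := continuous_finsetSum _ fun j _ =>
    continuous_const.mul (continuous_const.mul (hφc _))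
  have hpt : ∀ x ∈ Metric.closedBall (0 : Space N) ρ, W x ^ p' ≤
      (C1 * (1 / 2 : ℝ) ^ (-m) * C2) ^ p' * R ^ (-(m * p')) * (1 + (ρ - ‖x‖))⁻¹ := by
    intro x hx
    have hx' : ‖x‖ ≤ ρ := by simpa using hx
    have hbx := hb ‖x‖ ⟨norm_nonneg x, hx'⟩
    have hσ : 0 ≤ ρ - ‖x‖ := by linarith
    have g1 : W x ≤ C1 * (1 / 2 : ℝ) ^ (-m) * R ^ (-m) * ∑ j ∈ Finset.range (n + 1),
        (R₀ * 2 ^ j) ^ (-(1 / p')) * (1 + (R₀ * 2 ^ j)⁻¹ * (ρ - ‖x‖))⁻¹ := by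
      rw [Finset.mul_sum]
      refine Finset.sum_le_sum fun j _ => ?_
      have hj := hrj j
      set q := R₀ * 2 ^ j with hq
      have hq0 : 0 < q := by linarith
      have g2 := h1 q⁻¹ t (by positivity) (inv_le_one_of_one_le₀ hj) ht0 x hx'
      have g3 : (1 + q⁻¹ * t) ^ (-m) ≤ (1 / 2 : ℝ) ^ (-m) * R ^ (-m) * q ^ m := by
        rw [← Real.mul_rpow (by norm_num) hR0.le, ← neg_neg m, Real.rpow_neg hq0.le (-m), neg_neg,
          ← Real.inv_rpow hq0.le, ← Real.mul_rpow (by positivity) (by positivity)]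
        refine Real.rpow_le_rpow_of_nonpos (by positivity) ?_ (by linarith)
        have : q⁻¹ * (R / 2) ≤ q⁻¹ * t := by gcongr; exact ht.1
        linarith
      have g4 : q ^ (-(m + 1 - 1 / p)) * q ^ m = q ^ (-(1 / p')) := by
        rw [← Real.rpow_add hq0, ← hα]; congr 1; ring
      calc q ^ (-(m + 1 - 1 / p)) * (Real.exp (-(q⁻¹ * t)) * radialSol N q⁻¹ x)
          ≤ q ^ (-(m + 1 - 1 / p)) * (C1 * ((1 / 2 : ℝ) ^ (-m) * R ^ (-m) * q ^ m) *
            (1 + q⁻¹ * (ρ - ‖x‖))⁻¹) := by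
            refine mul_le_mul_of_nonneg_left (g2.trans ?_) (by positivity)
            gcongr
        _ = C1 * (1 / 2 : ℝ) ^ (-m) * R ^ (-m) * ((q ^ (-(m + 1 - 1 / p)) * q ^ m) *
            (1 + q⁻¹ * (ρ - ‖x‖))⁻¹) := by ring
        _ = _ := by rw [g4]
    have g5 : W x ≤ C1 * (1 / 2 : ℝ) ^ (-m) * C2 * R ^ (-m) * (1 + (ρ - ‖x‖)) ^ (-(1 / p')) := by
      refine g1.trans ?_
      calc _ ≤ C1 * (1 / 2 : ℝ) ^ (-m) * R ^ (-m) * (C2 * (1 + (ρ - ‖x‖)) ^ (-(1 / p'))) := by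
            gcongr
            exact h2 R₀ _ hR₀ hσ (n + 1)
        _ = _ := by ring
    calc _ ≤ (C1 * (1 / 2 : ℝ) ^ (-m) * C2 * R ^ (-m) * (1 + (ρ - ‖x‖)) ^ (-(1 / p'))) ^ p' :=
          Real.rpow_le_rpow (hW0 x) g5 (by linarith)
      _ = _ := by
          rw [Real.mul_rpow (by positivity) (by positivity), Real.mul_rpow (by positivity)
            (by positivity), ← Real.rpow_mul hR0.le, ← Real.rpow_mul hbx.le, neg_mul, neg_mul,
            one_div_mul_cancel (by linarith), Real.rpow_neg_one]
  have hi : IntegrableOn (fun x : Space N => (1 + (ρ - ‖x‖))⁻¹) (Metric.closedBall 0 ρ) := by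
    refine ContinuousOn.integrableOn_compact (isCompact_closedBall 0 _) ?_
    exact hFc.comp continuous_norm.continuousOn fun x hx => ⟨norm_nonneg x, by simpa using hx⟩
  have hi2 : IntegrableOn (fun x : Space N => W x ^ p') (Metric.closedBall 0 ρ) := by
    refine ContinuousOn.integrableOn_compact (isCompact_closedBall 0 _) (Continuous.continuousOn ?_)
    exact hWc.rpow_const fun x => Or.inr (by linarith)
  refine (setIntegral_mono_on hi2 (hi.const_mul _) measurableSet_closedBall hpt).trans ?_
  rw [integral_const_mul]
  have g4 := h (fun y => (1 + (ρ - y))⁻¹) ρ hρ0 (fun y hy => (inv_pos.2 (hb y hy)).le) hFc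
  have g5 : ∫ y in (0)..ρ, (1 + (ρ - y))⁻¹ ≤ (Real.log (2 * r + 2 * R₀) + 1) * ((n : ℝ) + 1) := by
    rw [integral_one_add_inv_eq hρ0]
    have k1 : 1 + ρ ≤ (2 * r + 2 * R₀) * 2 ^ n := by
      have h2n : (1 : ℝ) ≤ 2 ^ n := one_le_pow₀ (by norm_num)
      have : t ≤ R₀ * 2 ^ n := ht.2
      rw [hρ]
      nlinarith
    have k2 : Real.log (1 + ρ) ≤ Real.log (2 * r + 2 * R₀) + n * Real.log 2 := by
      have := Real.log_le_log (by linarith) k1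
      rwa [Real.log_mul (by positivity) (by positivity), Real.log_pow] at this
    have k3 : Real.log 2 ≤ 1 := by linarith [Real.log_two_lt_d9]
    have k4 : (0 : ℝ) ≤ n := Nat.cast_nonneg n
    nlinarith
  have g6 : ρ ^ (N - 1) ≤ (r + 1) ^ (N - 1) * R ^ (N - 1) := by
    rw [← mul_pow]
    have : ρ ≤ (r + 1) * R := by rw [hρ]; nlinarith [ht.2]
    gcongr
  have g7 : R ^ (N - 1) = R ^ ((N : ℝ) - 1) := by
    rw [← Real.rpow_natCast, Nat.cast_sub hN, Nat.cast_one]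
  have g8 : 0 ≤ ∫ y in (0)..ρ, (1 + (ρ - y))⁻¹ :=
    intervalIntegral.integral_nonneg hρ0 fun y hy => (inv_pos.2 (hb y hy)).le
  calc _ ≤ (C1 * (1 / 2 : ℝ) ^ (-m) * C2) ^ p' * R ^ (-(m * p')) *
        (C * ((r + 1) ^ (N - 1) * R ^ (N - 1)) *
          ((Real.log (2 * r + 2 * R₀) + 1) * ((n : ℝ) + 1))) := by
        refine mul_le_mul_of_nonneg_left (g4.trans ?_) (by positivity)
        gcongr
    _ = (C1 * (1 / 2 : ℝ) ^ (-m) * C2) ^ p' * (C * (r + 1) ^ (N - 1) *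
        (Real.log (2 * r + 2 * R₀) + 1)) * (R ^ (N - 1) * R ^ (-(m * p'))) * ((n : ℝ) + 1) := by ring
    _ = _ := by rw [g7, ← Real.rpow_add hR0, ← sub_eq_add_neg]

end

noncomputable section

variable {N : ℕ}

/-- The cutoff space-time integral of a nonlinearity with spatial integrals `U`. -/
def cutoffMass (s U : ℝ → ℝ) (T R : ℝ) : ℝ := ∫ t in Set.Ioo 0 T, s (t / R) * U t

/-- A bound of `P` and of a forcing term with spatial integrals `U` by the moments of `w` against
`e^{-lt} φ_l`. -/
def MomentInequality (T r κ : ℝ) (s : ℝ → ℝ) (R l M P : ℝ) (w : ℝ → L2 N) (U : ℝ → ℝ) : Prop :=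
  ∃ β : ℝ → ℝ, ContinuousOn β (Set.Ico 0 T) ∧
    (∀ t ∈ Set.Ico 0 T, |β t| ≤ ∫ x in Metric.closedBall 0 (r + t), |w t x| * radialSol N l x) ∧
    P + ∫ t in Set.Ioo 0 T, Real.exp (-(l * t)) * s (t / R) * U t ≤
      M * ∫ t in Set.Icc (R / 2) R, Real.exp (-(l * t)) * s (t / R) ^ κ * |β t|

lemma rpow_le_of_le_holder {p p' b X M S E : ℝ} (hpp : p.HolderConjugate p') (hb : 0 < b) (hX : 0 ≤ X)
    (hM : 0 ≤ M) (hS : 0 ≤ S) (hE : 0 ≤ E) (h : X ≤ M * ((S / b) ^ (1 / p) * E ^ (1 / p'))) :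
    X ^ p ≤ b⁻¹ * M ^ p * E ^ (p - 1) * S := by
  have hp := hpp.pos
  have hSb : 0 ≤ S / b := by positivity
  have e : 1 / p' * p = p - 1 := by
    have := hpp.inv_add_inv_eq_one
    have h1 : p'⁻¹ = 1 - p⁻¹ := by linarith
    rw [one_div, h1]
    field_simp
  calc X ^ p ≤ (M * ((S / b) ^ (1 / p) * E ^ (1 / p'))) ^ p := Real.rpow_le_rpow hX h hp.le
    _ = _ := by
        rw [Real.mul_rpow hM (by positivity), Real.mul_rpow (by positivity) (by positivity),
          ← Real.rpow_mul hSb, ← Real.rpow_mul hE, one_div_mul_cancel hp.ne', Real.rpow_one, e]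
        ring

section

variable {r p p' b κ C : ℝ} {G s : ℝ → ℝ}

lemma cutoffMass_nonneg (hs : IsCutoff s κ C) {U : ℝ → ℝ} (hU : ∀ t, 0 ≤ U t) (T R : ℝ) :
    0 ≤ cutoffMass s U T R :=
  integral_nonneg fun t => mul_nonneg (hs.nonneg _) (hU t)

lemma IsCutoff.exp_mass_nonneg (hs : IsCutoff s κ C) {U : ℝ → ℝ} (hU : ∀ t, 0 ≤ U t) (T R l : ℝ) :
    0 ≤ ∫ t in Set.Ioo 0 T, Real.exp (-(l * t)) * s (t / R) * U t :=
  integral_nonneg fun t => mul_nonneg (mul_nonneg (Real.exp_pos _).le (hs.nonneg _)) (hU t)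

/-- The forcing term is controlled through the test function that is constant in space. -/
lemma exists_mass_bound (hN : 1 ≤ N) (hr : 0 ≤ r) (hpp : p.HolderConjugate p') (hb : 0 < b)
    (hG : ∀ σ, b * |σ| ^ p ≤ G σ) (hs : IsCutoff s κ C) (hκ : 1 / p ≤ κ) :
    ∃ K : ℝ, 0 < K ∧ ∀ (T R M P : ℝ) (w : ℝ → L2 N) (U : ℝ → ℝ), 1 ≤ R → R < T → 0 ≤ M → 0 ≤ P →
      (∀ t, 0 ≤ U t) → MemL1L1 T (fun t x => G (w t x)) → MomentInequality T r κ s R 0 M P w U →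
      cutoffMass s U T R ^ p ≤ K * M ^ p * R ^ (((N : ℝ) + 1) * (p - 1)) *
        cutoffMass s (fun t => ∫ x, G (w t x)) T R := by
  obtain ⟨K, hK, hD⟩ := exists_bound_weight_zero hN hr p'
  refine ⟨b⁻¹ * K ^ (p - 1), by positivity, ?_⟩
  rintro T R M P w U hR hRT hM hP hU hmem ⟨β, hβ, hβw, hin⟩
  have hR0 : 0 < R := by linarith
  have hG0 : ∀ σ, 0 ≤ G σ := fun σ => le_trans (by positivity) (hG σ)
  have h1 := hs.sum_moments_le (J := {0}) (l := fun _ => 0) (k := fun _ => 1) (β := fun _ => β)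
    (r := r) (D := K * R ^ (N : ℝ)) hpp hκ hb hG hN hR0 hRT hmem (fun _ => zero_le_one)
    (fun _ _ => hβ) (fun _ _ => hβw) (fun t ht => by simpa using hD R hR t ht)
  rw [Finset.sum_singleton, one_mul] at h1
  have h2 : cutoffMass s U T R ≤ M * ((cutoffMass s (fun t => ∫ x, G (w t x)) T R / b) ^ (1 / p) *
      (R * (K * R ^ (N : ℝ))) ^ (1 / p')) := by
    have h3 := mul_le_mul_of_nonneg_left h1 hM
    have h4 : cutoffMass s U T R ≤ P + ∫ t in Set.Ioo 0 T, Real.exp (-(0 * t)) * s (t / R) * U t := by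
      simp [cutoffMass, hP]
    exact h4.trans (hin.trans h3)
  refine (rpow_le_of_le_holder hpp hb (cutoffMass_nonneg hs hU T R) hM
    (cutoffMass_nonneg hs (fun t => integral_nonneg fun x => hG0 _) T R) (by positivity) h2).trans
    (le_of_eq ?_)
  have e : R * (K * R ^ (N : ℝ)) = K * R ^ ((N : ℝ) + 1) := by
    rw [Real.rpow_add_one hR0.ne']; ring
  rw [e, Real.mul_rpow hK.le (by positivity), ← Real.rpow_mul hR0.le]
  ring

/-- Exponents in the concentrated bounds. -/
lemma concentrated_exponent (hpp : p.HolderConjugate p') {R K x : ℝ} (hR : 0 < R) (hK : 0 ≤ K)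
    (hx : 0 ≤ x) (M : ℝ) (hM : 0 ≤ M) :
    (M / R) ^ p * (R * (K * R ^ (((N : ℝ) - 1) - ((N : ℝ) - 1) / 2 * p') * x)) ^ (p - 1) =
      M ^ p * K ^ (p - 1) * x ^ (p - 1) * R ^ (((N : ℝ) - 1) / 2 * p - N) := by
  have e1 : R * (K * R ^ (((N : ℝ) - 1) - ((N : ℝ) - 1) / 2 * p') * x) =
      K * x * R ^ (((N : ℝ) - 1) - ((N : ℝ) - 1) / 2 * p' + 1) := by
    rw [Real.rpow_add_one hR.ne']; ring
  have e2 : p' * (p - 1) = p := by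
    have := hpp.symm.sub_one_mul_conj
    have := hpp.sub_one_mul_conj
    linarith
  rw [e1, Real.div_rpow hM hR.le, Real.mul_rpow (by positivity) (by positivity),
    Real.mul_rpow hK hx, ← Real.rpow_mul hR.le]
  have e3 : (((N : ℝ) - 1) - ((N : ℝ) - 1) / 2 * p' + 1) * (p - 1) =
      (((N : ℝ) - 1) / 2 * p - N) + p := by
    linear_combination (-(((N : ℝ) - 1) / 2)) * e2
  rw [e3, Real.rpow_add hR]
  have : R ^ p ≠ 0 := (Real.rpow_pos_of_pos hR p).ne'
  field_simp

/-- The size of the data is controlled through a test function concentrated near the light cone. -/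
lemma exists_data_bound (hN : 1 ≤ N) (hr : 0 ≤ r) (hpp : p.HolderConjugate p') (hb : 0 < b)
    (hG : ∀ σ, b * |σ| ^ p ≤ G σ) (hs : IsCutoff s κ C) (hκ : 1 / p ≤ κ) {l M : ℝ} (hl : 0 < l)
    (hl1 : l ≤ 1) (hM : 0 < M) :
    ∃ K : ℝ, 0 < K ∧ ∀ (T R P : ℝ) (w : ℝ → L2 N) (U : ℝ → ℝ), 1 ≤ R → R < T → 0 ≤ P →
      (∀ t, 0 ≤ U t) → MemL1L1 T (fun t x => G (w t x)) → MomentInequality T r κ s R l (M / R) P w U →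
      P ^ p ≤ K * R ^ (((N : ℝ) - 1) / 2 * p - N) * cutoffMass s (fun t => ∫ x, G (w t x)) T R := by
  obtain ⟨K, hK, hD⟩ := exists_bound_weight_pos hN hr hl hl1 hpp.symm.lt
  refine ⟨b⁻¹ * (M ^ p * K ^ (p - 1)), by positivity, ?_⟩
  rintro T R P w U hR hRT hP hU hmem ⟨β, hβ, hβw, hin⟩
  have hR0 : 0 < R := by linarith
  have hG0 : ∀ σ, 0 ≤ G σ := fun σ => le_trans (by positivity) (hG σ)
  have h1 := hs.sum_moments_le (J := {0}) (l := fun _ => l) (k := fun _ => 1) (β := fun _ => β)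
    (r := r) hpp hκ hb hG hN hR0 hRT hmem (fun _ => zero_le_one)
    (fun _ _ => hβ) (fun _ _ => hβw) (fun t ht => by simpa using hD R hR t ht)
  rw [Finset.sum_singleton, one_mul] at h1
  have h3 := mul_le_mul_of_nonneg_left h1 (by positivity : 0 ≤ M / R)
  have h4 := hs.exp_mass_nonneg hU T R l
  have h5 := rpow_le_of_le_holder (S := cutoffMass s (fun t => ∫ x, G (w t x)) T R) hpp hb hP
    (by positivity : 0 ≤ M / R) (cutoffMass_nonneg hs (fun t => integral_nonneg fun x => hG0 _) T R)
    (by positivity) ((le_add_of_nonneg_right h4).trans (hin.trans h3))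
  refine h5.trans (le_of_eq ?_)
  have h6 := concentrated_exponent (N := N) hpp hR0 hK.le zero_le_one M hM.le
  rw [mul_one, Real.one_rpow, mul_one] at h6
  rw [mul_assoc b⁻¹, h6]
  ring

/-- The logarithmic superposition of the concentrated test functions. -/
lemma exists_dyadic_bound (hN : 1 ≤ N) (hr : 0 ≤ r) (hpp : p.HolderConjugate p') (hb : 0 < b)
    (hG : ∀ σ, b * |σ| ^ p ≤ G σ) (hs : IsCutoff s κ C) (hκ : 1 / p ≤ κ) {M R₀ : ℝ} (hR₀ : 1 ≤ R₀)
    (hM : 0 < M) :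
    ∃ K : ℝ, 0 < K ∧ ∀ (T P : ℝ) (w : ℝ → L2 N) (U : ℝ → ℝ) (μ : ℕ → ℝ) (n : ℕ), R₀ * 2 ^ n < T →
      0 ≤ P → (∀ t, 0 ≤ U t) → IntegrableOn U (Set.Ioo 0 T) → (∀ j, 0 < μ j) →
      MemL1L1 T (fun t x => G (w t x)) →
      (∀ j ≤ n, MomentInequality T r κ s (R₀ * 2 ^ n) (R₀ * 2 ^ j)⁻¹ (M / (R₀ * 2 ^ n) * μ j) P w U) →
      (∑ j ∈ Finset.range (n + 1), (R₀ * 2 ^ j) ^ (-(((N : ℝ) - 1) / 2 + 1 - 1 / p)) * (μ j)⁻¹ *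
        cutoffMass s U T (R₀ * 2 ^ j)) ^ p ≤
      K * ((n : ℝ) + 1) ^ (p - 1) * (R₀ * 2 ^ n) ^ (((N : ℝ) - 1) / 2 * p - N) *
        cutoffMass s (fun t => ∫ x, G (w t x)) T (R₀ * 2 ^ n) := by
  obtain ⟨K, hK, hD⟩ := exists_bound_weight_sum hN hr hR₀ hpp
  refine ⟨b⁻¹ * ((Real.exp 1 * M) ^ p * K ^ (p - 1)), by positivity, ?_⟩
  intro T P w U μ n hRT hP hU hUi hμ hmem hin
  have hrj : ∀ j : ℕ, 0 < R₀ * 2 ^ j := fun j => by positivity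
  set R := R₀ * 2 ^ n with hR
  have hR0 : 0 < R := hrj n
  have hT : 0 < T := hR0.trans hRT
  have hG0 : ∀ σ, 0 ≤ G σ := fun σ => le_trans (by positivity) (hG σ)
  choose! β hβ hβw hβin using hin
  have hJ : ∀ j ∈ Finset.range (n + 1), j ≤ n := fun j hj => Nat.lt_succ_iff.1 (Finset.mem_range.1 hj)
  have h1 := hs.sum_moments_le (J := Finset.range (n + 1)) (l := fun j => (R₀ * 2 ^ j)⁻¹)
    (k := fun j => (R₀ * 2 ^ j) ^ (-(((N : ℝ) - 1) / 2 + 1 - 1 / p))) (β := β) (r := r)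
    (D := K * R ^ (((N : ℝ) - 1) - ((N : ℝ) - 1) / 2 * p') * ((n : ℝ) + 1))
    hpp hκ hb hG hN hR0 hRT hmem
    (fun j => Real.rpow_nonneg (hrj j).le _) (fun j hj => hβ j (hJ j hj)) (fun j hj => hβw j (hJ j hj))
    (fun t ht => hD n t ht)
  have hmass : ∀ j ≤ n, cutoffMass s U T (R₀ * 2 ^ j) ≤ Real.exp 1 *
      ∫ t in Set.Ioo 0 T, Real.exp (-((R₀ * 2 ^ j)⁻¹ * t)) * s (t / R) * U t := by
    intro j hj
    have hle : R₀ * 2 ^ j ≤ R := by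
      rw [hR]
      have : (2 : ℝ) ^ j ≤ 2 ^ n := pow_le_pow_right₀ (by norm_num) hj
      gcongr
    have hq := hrj j
    set q := R₀ * 2 ^ j with hqdef
    rw [cutoffMass, ← integral_const_mul]
    have i1 : IntegrableOn (fun t => s (t / q) * U t) (Set.Ioo 0 T) := by
      simpa using hs.integrableOn_exp_mul (T := T) q 0 le_rfl hUi
    have i2 := (hs.integrableOn_exp_mul (T := T) R q⁻¹ (by positivity) hUi).const_mul (Real.exp 1)
    refine setIntegral_mono_on i1 i2 measurableSet_Ioo fun t ht => ?_
    have ht0 := ht.1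
    have hUt := hU t
    rcases le_or_gt q t with h | h
    · rw [hs.eq_zero _ (one_le_abs_div hq (h.trans (le_abs_self t))), zero_mul]
      have := hs.nonneg (t / R)
      positivity
    · have e1 : s (t / q) ≤ s (t / R) := hs.anti _ _ (by
        rw [abs_of_pos (by positivity), abs_of_pos (by positivity)]; gcongr)
      have e2 : 1 ≤ Real.exp 1 * Real.exp (-(q⁻¹ * t)) := by
        rw [← Real.exp_add]
        refine Real.one_le_exp ?_
        have : q⁻¹ * t ≤ 1 := by rw [inv_mul_le_iff₀ hq]; linarith
        linarith
      have := hs.nonneg (t / R)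
      calc s (t / q) * U t ≤ 1 * (s (t / R) * U t) := by rw [one_mul]; gcongr
        _ ≤ (Real.exp 1 * Real.exp (-(q⁻¹ * t))) * (s (t / R) * U t) := by gcongr
        _ = _ := by ring
  have h2 : ∑ j ∈ Finset.range (n + 1), (R₀ * 2 ^ j) ^ (-(((N : ℝ) - 1) / 2 + 1 - 1 / p)) * (μ j)⁻¹ *
      cutoffMass s U T (R₀ * 2 ^ j) ≤ (Real.exp 1 * M) / R * ∑ j ∈ Finset.range (n + 1),
        (R₀ * 2 ^ j) ^ (-(((N : ℝ) - 1) / 2 + 1 - 1 / p)) * ∫ t in Set.Icc (R / 2) R,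
          Real.exp (-((R₀ * 2 ^ j)⁻¹ * t)) * s (t / R) ^ κ * |β j t| := by
    rw [Finset.mul_sum]
    refine Finset.sum_le_sum fun j hj => ?_
    have hjn := hJ j hj
    have hμj := hμ j
    have hqj := hrj j
    have k1 := hβin j hjn
    have k2 := hmass j hjn
    have k3 : cutoffMass s U T (R₀ * 2 ^ j) ≤ Real.exp 1 * (M / R * μ j *
        ∫ t in Set.Icc (R / 2) R, Real.exp (-((R₀ * 2 ^ j)⁻¹ * t)) * s (t / R) ^ κ * |β j t|) :=
      k2.trans (mul_le_mul_of_nonneg_left (by linarith) (Real.exp_pos 1).le)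
    calc _ ≤ (R₀ * 2 ^ j) ^ (-(((N : ℝ) - 1) / 2 + 1 - 1 / p)) * (μ j)⁻¹ * (Real.exp 1 * (M / R * μ j *
        ∫ t in Set.Icc (R / 2) R, Real.exp (-((R₀ * 2 ^ j)⁻¹ * t)) * s (t / R) ^ κ * |β j t|)) := by
          gcongr
      _ = _ := by field_simp
  have h3 := h2.trans (mul_le_mul_of_nonneg_left h1 (by positivity : 0 ≤ (Real.exp 1 * M) / R))
  have h4 := rpow_le_of_le_holder (S := cutoffMass s (fun t => ∫ x, G (w t x)) T R) hpp hb
    (Finset.sum_nonneg fun j _ => by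
      have := hμ j; have := cutoffMass_nonneg hs hU T (R₀ * 2 ^ j); positivity)
    (by positivity : 0 ≤ (Real.exp 1 * M) / R)
    (cutoffMass_nonneg hs (fun t => integral_nonneg fun x => hG0 _) T R) (by positivity) h3
  refine h4.trans (le_of_eq ?_)
  have h6 := concentrated_exponent (N := N) hpp hR0 hK.le (by positivity : (0 : ℝ) ≤ n + 1)
    (Real.exp 1 * M) (by positivity)
  rw [mul_assoc b⁻¹, h6]
  ring

end

end

noncomputable section

variable {N : ℕ}

/-- The inequalities between the cutoff masses `A` of `G₂(∂ₜu)` and `B` of `G₁(v)` from which the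
lifespan estimates follow. -/
structure LifespanBounds (N : ℕ) (p q K R₀ ε T : ℝ) (A B : ℝ → ℝ) : Prop where
  nonneg_A : ∀ R, 0 ≤ A R
  nonneg_B : ∀ R, 0 ≤ B R
  mass_B : ∀ R, R₀ ≤ R → R < T → B R ^ p ≤ K * R ^ (-p + ((N : ℝ) + 1) * (p - 1)) * A R
  mass_A : ∀ R, R₀ ≤ R → R < T → A R ^ q ≤ K * R ^ (-(2 * q) + ((N : ℝ) + 1) * (q - 1)) * B R
  data_A : ∀ R, R₀ ≤ R → R < T → ε ^ p ≤ K * R ^ (((N : ℝ) - 1) / 2 * p - N) * A R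
  data_B : ∀ R, R₀ ≤ R → R < T → ε ^ q ≤ K * R ^ (((N : ℝ) - 1) / 2 * q - N) * B R
  dyadic_A : ∀ n : ℕ, R₀ * 2 ^ n < T →
    (∑ j ∈ Finset.range (n + 1), (R₀ * 2 ^ j) ^ (1 / p - 1 - ((N : ℝ) - 1) / 2) * B (R₀ * 2 ^ j)) ^ p ≤
      K * ((n : ℝ) + 1) ^ (p - 1) * (R₀ * 2 ^ n) ^ (((N : ℝ) - 1) / 2 * p - N) * A (R₀ * 2 ^ n)
  dyadic_B : ∀ n : ℕ, R₀ * 2 ^ n < T →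
    (∑ j ∈ Finset.range (n + 1), (R₀ * 2 ^ j) ^ (1 / q - ((N : ℝ) - 1) / 2) * A (R₀ * 2 ^ j)) ^ q ≤
      K * ((n : ℝ) + 1) ^ (q - 1) * (R₀ * 2 ^ n) ^ (((N : ℝ) - 1) / 2 * q - N) * B (R₀ * 2 ^ n)

lemma MomentInequality.mono {T r κ : ℝ} {s : ℝ → ℝ} {R l M M' P P' : ℝ} {w : ℝ → L2 N} {U : ℝ → ℝ}
    {C : ℝ} (hs : IsCutoff s κ C) (h : MomentInequality T r κ s R l M P w U) (hM : M ≤ M')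
    (hP : P' ≤ P) : MomentInequality T r κ s R l M' P' w U := by
  obtain ⟨β, h1, h2, h3⟩ := h
  refine ⟨β, h1, h2, ?_⟩
  have h4 : 0 ≤ ∫ t in Set.Icc (R / 2) R, Real.exp (-(l * t)) * s (t / R) ^ κ * |β t| :=
    integral_nonneg fun t => mul_nonneg (mul_nonneg (Real.exp_pos _).le
      (Real.rpow_nonneg (hs.nonneg _) _)) (abs_nonneg _)
  have h5 := mul_le_mul_of_nonneg_right hM h4
  linarith

lemma dataRadius_nonneg (f₁ g₁ f₂ g₂ : Space N → ℝ) : 0 ≤ dataRadius f₁ g₁ f₂ g₂ :=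
  Real.sSup_nonneg fun y hy => by
    obtain ⟨x, -, rfl⟩ := hy
    exact norm_nonneg x

lemma norm_le_dataRadius {f₁ g₁ f₂ g₂ : Space N → ℝ} (hf₁ : IsTestFun f₁) (hg₁ : IsTestFun g₁)
    (hf₂ : IsTestFun f₂) (hg₂ : IsTestFun g₂) {x : Space N}
    (hx : x ∈ tsupport f₁ ∪ tsupport f₂ ∪ tsupport g₁ ∪ tsupport g₂) :
    ‖x‖ ≤ dataRadius f₁ g₁ f₂ g₂ := by
  have hc : IsCompact (tsupport f₁ ∪ tsupport f₂ ∪ tsupport g₁ ∪ tsupport g₂) :=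
    ((hf₁.2.isCompact.union hf₂.2.isCompact).union hg₁.2.isCompact).union hg₂.2.isCompact
  exact le_csSup (hc.image continuous_norm).bddAbove ⟨x, hx, rfl⟩

lemma exists_lifespanBounds (hN : 1 ≤ N) {p q a b : ℝ} (hp : 1 < p) (hq : 1 < q)
    (ha : 0 < a) (hb : 0 < b) {G₁ G₂ : ℝ → ℝ} (hG₁0 : G₁ 0 = 0) (hG₂0 : G₂ 0 = 0)
    (hG₁ : ∀ s : ℝ, a * |s| ^ q ≤ G₁ s) (hG₂ : ∀ σ : ℝ, b * |σ| ^ p ≤ G₂ σ)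
    {f₁ g₁ f₂ g₂ : Space N → ℝ} (hf₁ : IsTestFun f₁) (hg₁ : IsTestFun g₁) (hf₂ : IsTestFun f₂)
    (hg₂ : IsTestFun g₂) (hI₁ : 0 < ∫ x, g₁ x) (hI₂ : 0 < ∫ x, g₂ x) :
    ∃ K R₀ : ℝ, 0 < K ∧ 1 ≤ R₀ ∧ ∀ ε T : ℝ, 0 < ε → 0 < T → ∀ u v : ℝ → L2 N,
      IsWeakSolution G₁ G₂ f₁ g₁ f₂ g₂ ε T u v →
      SupportedInCone T (dataRadius f₁ g₁ f₂ g₂) u → SupportedInCone T (dataRadius f₁ g₁ f₂ g₂) v →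
      ∃ A B : ℝ → ℝ, LifespanBounds N p q K R₀ ε T A B := by
  have hp0 : 0 < p := by linarith
  have hq0 : 0 < q := by linarith
  have hpp : p.HolderConjugate (Real.conjExponent p) := Real.HolderConjugate.conjExponent hp
  have hqq : q.HolderConjugate (Real.conjExponent q) := Real.HolderConjugate.conjExponent hq
  set r := dataRadius f₁ g₁ f₂ g₂ with hrdef
  have hr : 0 ≤ r := dataRadius_nonneg _ _ _ _
  have hsup : ∀ f : Space N → ℝ,
      tsupport f ⊆ tsupport f₁ ∪ tsupport f₂ ∪ tsupport g₁ ∪ tsupport g₂ →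
      ∀ x, r < ‖x‖ → f x = 0 := by
    intro f hf x hx
    by_contra hne
    exact absurd (norm_le_dataRadius hf₁ hg₁ hf₂ hg₂ (hf (subset_tsupport _ hne))) (not_le.2 hx)
  have hsf₁ := hsup f₁ fun x hx => by simp [hx]
  have hsg₁ := hsup g₁ fun x hx => by simp [hx]
  have hsf₂ := hsup f₂ fun x hx => by simp [hx]
  have hsg₂ := hsup g₂ fun x hx => by simp [hx]
  set κ := max (1 / p) (1 / q) with hκdef
  obtain ⟨s, C, hC, hs⟩ := exists_isCutoff (κ := κ) (lt_max_of_lt_left (by positivity))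
    (max_lt (by rw [div_lt_one hp0]; exact hp) (by rw [div_lt_one hq0]; exact hq))
  have hκp : 1 / p ≤ κ := le_max_left _ _
  have hκq : 1 / q ≤ κ := le_max_right _ _
  obtain ⟨l₁, hl₁, hd₁⟩ := exists_data_lower_bound hN hf₁ hg₁ hI₁
  obtain ⟨l₂, hl₂, hd₂⟩ := exists_data_lower_bound hN hf₂ hg₂ hI₂
  set l := min 1 (min l₁ l₂) with hldef
  have hl : 0 < l := lt_min one_pos (lt_min hl₁ hl₂)
  have hl1 : l ≤ 1 := min_le_left _ _
  have hll₁ : l ≤ l₁ := (min_le_right _ _).trans (min_le_left _ _)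
  have hll₂ : l ≤ l₂ := (min_le_right _ _).trans (min_le_right _ _)
  set R₀ := l⁻¹ with hR₀def
  have hR₀ : 1 ≤ R₀ := (one_le_inv₀ hl).2 hl1
  have hM3 : 0 < 3 * C := by positivity
  obtain ⟨K1, hK1, B1⟩ := exists_mass_bound hN hr hpp hb hG₂ hs hκp
  obtain ⟨K2, hK2, B2⟩ := exists_mass_bound hN hr hqq ha hG₁ hs hκq
  obtain ⟨K3, hK3, B3⟩ := exists_data_bound hN hr hpp hb hG₂ hs hκp hl hl1 hM3
  obtain ⟨K4, hK4, B4⟩ := exists_data_bound hN hr hqq ha hG₁ hs hκq hl hl1 hM3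
  obtain ⟨K5, hK5, B5⟩ := exists_dyadic_bound hN hr hpp hb hG₂ hs hκp hR₀ hM3
  obtain ⟨K6, hK6, B6⟩ := exists_dyadic_bound hN hr hqq ha hG₁ hs hκq hR₀ hM3
  set c₁ := (∫ x, g₁ x) / 2 with hc₁def
  set c₂ := (∫ x, g₂ x) / 2 with hc₂def
  have hc₁ : 0 < c₁ := by positivity
  have hc₂ : 0 < c₂ := by positivity
  set L1' := K1 * (3 * C) ^ p
  set L2' := K2 * C ^ q
  set L3' := K3 * (c₁ ^ p)⁻¹
  set L4' := K4 * (c₂ ^ q)⁻¹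
  have hL1 : 0 < L1' := by positivity
  have hL2 : 0 < L2' := by positivity
  have hL3 : 0 < L3' := by positivity
  have hL4 : 0 < L4' := by positivity
  refine ⟨L1' + L2' + L3' + L4' + K5 + K6, R₀, by positivity, hR₀, ?_⟩
  intro ε T hε hT u v hsol hcu hcv
  obtain ⟨ut, vt, Du, Dv, hu1, hv1, hut, hvt, hm2, hm1, iu, iv, iut, ivt, eu, ev⟩ := hsol
  have Su : IsConeSolution T ε r f₁ g₁ (fun t x => G₁ (v t x)) u ut Du :=
    ⟨hT, hr, hu1, hut, iu, iut, eu, hcu, hsf₁, hsg₁⟩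
  have Sv : IsConeSolution T ε r f₂ g₂ (fun t x => G₂ (ut t x)) v vt Dv :=
    ⟨hT, hr, hv1, hvt, iv, ivt, ev, hcv, hsf₂, hsg₂⟩
  have hG₁p : ∀ s, 0 ≤ G₁ s := fun s => le_trans (by positivity) (hG₁ s)
  have hG₂p : ∀ s, 0 ≤ G₂ s := fun s => le_trans (by positivity) (hG₂ s)
  have hcone₁ : ∀ t ∈ Set.Ico 0 T, ∀ᵐ x, r + t < ‖x‖ → G₁ (v t x) = 0 := fun t ht => by
    filter_upwards [hcv t ht] with x hx hxr
    rw [hx hxr, hG₁0]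
  have hcone₂ : ∀ t ∈ Set.Ico 0 T, ∀ᵐ x, r + t < ‖x‖ → G₂ (ut t x) = 0 := fun t ht => by
    filter_upwards [Su.cone_deriv t ht] with x hx hxr
    rw [hx hxr, hG₂0]
  set U : ℝ → ℝ := fun t => ∫ x, G₂ (ut t x) with hU
  set V : ℝ → ℝ := fun t => ∫ x, G₁ (v t x) with hV
  have hU0 : ∀ t, 0 ≤ U t := fun t => integral_nonneg fun x => hG₂p _
  have hV0 : ∀ t, 0 ≤ V t := fun t => integral_nonneg fun x => hG₁p _
  have hUi : IntegrableOn U (Set.Ioo 0 T) := hm2.integrableOn_integral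
  have hVi : IntegrableOn V (Set.Ioo 0 T) := hm1.integrableOn_integral
  have vel : ∀ R l', 0 < R → R < T → 0 ≤ l' → l' ≤ l → (l' = 0 ∨ 1 ≤ l' * R) →
      MomentInequality T r κ s R l' (3 * C / R) (ε * c₁) ut V := by
    intro R l' hR hRT hl'0 hl' hor
    obtain ⟨β, h1, h2, h3⟩ := Su.velocity_inequality hN hm1 (fun t x => hG₁p _) hcone₁ hs hC hR hRT hor
    exact MomentInequality.mono hs ⟨β, h1, h2, h3⟩ le_rfl
      (mul_le_mul_of_nonneg_left (hd₁ l' hl'0 (hl'.trans hll₁)) hε.le)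
  have posi : ∀ R l', 0 < R → R < T → 0 ≤ l' → l' ≤ l →
      MomentInequality T r κ s R l' (C / R * (1 / R + 2 * l')) (ε * c₂) v U := by
    intro R l' hR hRT hl'0 hl'
    obtain ⟨β, h1, h2, h3⟩ := Sv.position_inequality hN hm2 (fun t x => hG₂p _) hcone₂ hs hR hRT hl'0
    exact MomentInequality.mono hs ⟨β, h1, h2, h3⟩ le_rfl
      (mul_le_mul_of_nonneg_left (hd₂ l' hl'0 (hl'.trans hll₂)) hε.le)
  have hA0 : ∀ R, 0 ≤ cutoffMass s U T R := fun R => cutoffMass_nonneg hs hU0 T R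
  have hB0 : ∀ R, 0 ≤ cutoffMass s V T R := fun R => cutoffMass_nonneg hs hV0 T R
  have hrj : ∀ j : ℕ, R₀ ≤ R₀ * 2 ^ j := fun j =>
    le_mul_of_one_le_right (by linarith) (one_le_pow₀ (by norm_num))
  have hrl : ∀ j : ℕ, (R₀ * 2 ^ j)⁻¹ ≤ l := fun j => by
    rw [← inv_inv l]; exact inv_anti₀ (by positivity) (hrj j)
  have hrjn : ∀ {j n : ℕ}, j ≤ n → R₀ * 2 ^ j ≤ R₀ * 2 ^ n := fun {j n} hjn =>
    mul_le_mul_of_nonneg_left (pow_le_pow_right₀ (by norm_num) hjn) (by linarith)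
  refine ⟨cutoffMass s U T, cutoffMass s V T, hA0, hB0, ?_, ?_, ?_, ?_, ?_, ?_⟩
  · intro R hR hRT
    have hR0 : 0 < R := by linarith
    have h := B1 T R (3 * C / R) (ε * c₁) ut V (hR₀.trans hR) hRT (by positivity) (by positivity) hV0
      hm2 (vel R 0 hR0 hRT le_rfl hl.le (Or.inl rfl))
    have e : K1 * (3 * C / R) ^ p * R ^ (((N : ℝ) + 1) * (p - 1)) =
        L1' * R ^ (-p + ((N : ℝ) + 1) * (p - 1)) := by
      rw [Real.div_rpow hM3.le hR0.le, Real.rpow_add hR0, Real.rpow_neg hR0.le]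
      ring
    rw [e] at h
    refine h.trans (mul_le_mul_of_nonneg_right ?_ (hA0 R))
    gcongr
    linarith
  · intro R hR hRT
    have hR0 : 0 < R := by linarith
    have h := B2 T R _ (ε * c₂) v U (hR₀.trans hR) hRT (by positivity) (by positivity) hU0
      hm1 (posi R 0 hR0 hRT le_rfl hl.le)
    have e : K2 * (C / R * (1 / R + 2 * 0)) ^ q * R ^ (((N : ℝ) + 1) * (q - 1)) =
        L2' * R ^ (-(2 * q) + ((N : ℝ) + 1) * (q - 1)) := by
      rw [show C / R * (1 / R + 2 * 0) = C / R ^ (2 : ℝ) by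
          rw [Real.rpow_two]; field_simp; ring, Real.div_rpow hC.le (by positivity),
        Real.rpow_add hR0, Real.rpow_neg hR0.le, ← Real.rpow_mul hR0.le]
      ring
    rw [e] at h
    refine h.trans (mul_le_mul_of_nonneg_right ?_ (hB0 R))
    gcongr
    linarith
  · intro R hR hRT
    have hR0 : 0 < R := by linarith
    have hlR : 1 ≤ l * R := by
      have := mul_le_mul_of_nonneg_left hR hl.le
      rwa [hR₀def, mul_inv_cancel₀ hl.ne'] at this
    have h := B3 T R (ε * c₁) ut V (hR₀.trans hR) hRT (by positivity) hV0 hm2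
      (vel R l hR0 hRT hl.le le_rfl (Or.inr hlR))
    rw [Real.mul_rpow hε.le hc₁.le, ← le_div_iff₀ (by positivity)] at h
    refine h.trans ?_
    have hA := hA0 R
    calc _ = L3' * R ^ (((N : ℝ) - 1) / 2 * p - N) * cutoffMass s U T R := by
          rw [div_eq_mul_inv]; ring
      _ ≤ _ := by
          gcongr
          linarith
  · intro R hR hRT
    have hR0 : 0 < R := by linarith
    have h := B4 T R (ε * c₂) v U (hR₀.trans hR) hRT (by positivity) hU0 hm1
      ((posi R l hR0 hRT hl.le le_rfl).mono hs (by
        have h1 : 1 / R ≤ 1 := by rw [div_le_one hR0]; linarith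
        calc C / R * (1 / R + 2 * l) ≤ C / R * (1 + 2 * 1) := by gcongr
          _ = _ := by ring) le_rfl)
    rw [Real.mul_rpow hε.le hc₂.le, ← le_div_iff₀ (by positivity)] at h
    refine h.trans ?_
    have hA := hB0 R
    calc _ = L4' * R ^ (((N : ℝ) - 1) / 2 * q - N) * cutoffMass s V T R := by
          rw [div_eq_mul_inv]; ring
      _ ≤ _ := by
          gcongr
          linarith
  · intro n hn
    have hR0 : 0 < R₀ * 2 ^ n := by positivity
    have h := B5 T (ε * c₁) ut V (fun _ => 1) n hn (by positivity) hV0 hVi (fun _ => one_pos) hm2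
      fun j hj => by
        have hj0 : 0 < R₀ * 2 ^ j := by positivity
        have := vel (R₀ * 2 ^ n) (R₀ * 2 ^ j)⁻¹ hR0 hn (by positivity) (hrl j) (Or.inr (by
          rw [inv_mul_eq_div, one_le_div hj0]; exact hrjn hj))
        simpa using this
    have e : ∀ j : ℕ, (R₀ * 2 ^ j) ^ (-(((N : ℝ) - 1) / 2 + 1 - 1 / p)) * (1 : ℝ)⁻¹ =
        (R₀ * 2 ^ j) ^ (1 / p - 1 - ((N : ℝ) - 1) / 2) := fun j => by
      rw [inv_one, mul_one]; congr 1; ring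
    simp only [e] at h
    have hA := hA0 (R₀ * 2 ^ n)
    refine h.trans ?_
    gcongr
    linarith
  · intro n hn
    have hR0 : 0 < R₀ * 2 ^ n := by positivity
    have h := B6 T (ε * c₂) v U (fun j => (R₀ * 2 ^ j)⁻¹) n hn (by positivity) hU0 hUi
      (fun j => by positivity) hm1 fun j hj => by
        have hj0 : 0 < R₀ * 2 ^ j := by positivity
        refine (posi (R₀ * 2 ^ n) (R₀ * 2 ^ j)⁻¹ hR0 hn (by positivity) (hrl j)).mono hs ?_ le_rfl
        have h1 : 1 / (R₀ * 2 ^ n) ≤ (R₀ * 2 ^ j)⁻¹ := by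
          rw [one_div]; exact inv_anti₀ hj0 (hrjn hj)
        calc C / (R₀ * 2 ^ n) * (1 / (R₀ * 2 ^ n) + 2 * (R₀ * 2 ^ j)⁻¹) ≤
              C / (R₀ * 2 ^ n) * ((R₀ * 2 ^ j)⁻¹ + 2 * (R₀ * 2 ^ j)⁻¹) := by gcongr
          _ = _ := by ring
    have e : ∀ j : ℕ, (R₀ * 2 ^ j) ^ (-(((N : ℝ) - 1) / 2 + 1 - 1 / q)) * ((R₀ * 2 ^ j)⁻¹)⁻¹ =
        (R₀ * 2 ^ j) ^ (1 / q - ((N : ℝ) - 1) / 2) := fun j => by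
      have hj0 : 0 < R₀ * 2 ^ j := by positivity
      rw [inv_inv, ← Real.rpow_add_one hj0.ne']; congr 1; ring
    simp only [e] at h
    have hB := hB0 (R₀ * 2 ^ n)
    refine h.trans ?_
    gcongr
    linarith

end

noncomputable section

lemma le_rpow_sub_rpow {k x z : ℝ} (hk : 1 < k) (hx : 0 < x) (hz : 0 < z) :
    (k - 1) * (z - x) * z ^ (-k) ≤ x ^ (1 - k) - z ^ (1 - k) := by
  have h1 : 1 + (1 - k) * (x / z - 1) ≤ (x / z) ^ (1 - k) := by
    have hxz : 0 < x / z := by positivity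
    rw [Real.rpow_def_of_pos hxz]
    have h2 := Real.log_le_sub_one_of_pos hxz
    have h3 := Real.add_one_le_exp (Real.log (x / z) * (1 - k))
    nlinarith
  have h2 : z ^ (1 - k) = z * z ^ (-k) := by
    rw [show 1 - k = -k + 1 by ring, Real.rpow_add_one hz.ne', mul_comm]
  have h3 : x ^ (1 - k) = (x / z) ^ (1 - k) * z ^ (1 - k) := by
    rw [← Real.mul_rpow (by positivity) hz.le, div_mul_cancel₀ _ hz.ne']
  have h4 : 0 < z ^ (-k) := Real.rpow_pos_of_pos hz _
  have h5 : (1 + (1 - k) * (x / z - 1)) * z = z + (1 - k) * (x - z) := by field_simp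
  rw [h3, h2]
  have h6 := mul_le_mul_of_nonneg_right h1 (by positivity : 0 ≤ z * z ^ (-k))
  have h7 : (1 + (1 - k) * (x / z - 1)) * (z * z ^ (-k)) = (z + (1 - k) * (x - z)) * z ^ (-k) := by
    rw [← h5]; ring
  rw [h7] at h6
  linarith

/-- Discrete blow-up: partial sums `Y` with `Y_n^k ≤ L (n+1)^θ (Y_n - Y_{n-1})` that grow at least like
`c M^i` cannot be continued from `M` to `2 M` steps unless `M` is small. -/
lemma discrete_blowup {k θ L : ℝ} (hk : 1 < k) (hθ : 0 ≤ θ) (hL : 0 < L) {y : ℕ → ℝ}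
    (hy : ∀ n, 0 ≤ y n) {n₀ : ℕ} {z : ℝ} (hz : 0 < z)
    (hlow : z ≤ ∑ j ∈ Finset.range (n₀ + 1), y j)
    (hstep : ∀ n ≤ 2 * n₀ + 1,
      (∑ j ∈ Finset.range (n + 1), y j) ^ k ≤ L * ((n : ℝ) + 1) ^ θ * y n) :
    (k - 1) * ((n₀ : ℝ) + 1) / (L * (2 * ((n₀ : ℝ) + 1)) ^ θ) ≤ z ^ (1 - k) := by
  set Y : ℕ → ℝ := fun n => ∑ j ∈ Finset.range (n + 1), y j with hY
  set M : ℝ := (n₀ : ℝ) + 1 with hM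
  have hM0 : 0 < M := by positivity
  have hYpos : ∀ i, 0 < Y (n₀ + i) := fun i => by
    refine hz.trans_le (hlow.trans ?_)
    exact Finset.sum_le_sum_of_subset_of_nonneg (Finset.range_mono (by omega)) fun j _ _ => hy j
  have hYs : ∀ n, Y (n + 1) = Y n + y (n + 1) := fun n => Finset.sum_range_succ _ _
  set δ : ℝ := (k - 1) / (L * (2 * M) ^ θ) with hδ
  have hk1 : 0 < k - 1 := by linarith
  have key : ∀ i ≤ n₀ + 1, Y (n₀ + i) ^ (1 - k) + i * δ ≤ Y n₀ ^ (1 - k) := by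
    intro i
    induction i with
    | zero => intro _; simp
    | succ i ih =>
      intro hi
      have h1 := ih (by omega)
      have h2 := le_rpow_sub_rpow hk (hYpos i) (hYpos (i + 1))
      have h3 := hstep (n₀ + i + 1) (by omega)
      have h4 : Y (n₀ + (i + 1)) - Y (n₀ + i) = y (n₀ + i + 1) := by
        rw [show n₀ + (i + 1) = n₀ + i + 1 by ring, hYs]; ring
      change Y (n₀ + (i + 1)) ^ k ≤ _ at h3
      have h5 : ((n₀ + i + 1 : ℕ) : ℝ) + 1 ≤ 2 * M := by
        have : (n₀ + i + 1 : ℕ) + 1 ≤ 2 * (n₀ + 1) := by omega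
        rw [hM]; exact_mod_cast this
      have h6 : Y (n₀ + (i + 1)) ^ k ≤ L * (2 * M) ^ θ * y (n₀ + i + 1) := by
        refine h3.trans ?_
        have := hy (n₀ + i + 1)
        gcongr
      have h7 : δ ≤ (k - 1) * (Y (n₀ + (i + 1)) - Y (n₀ + i)) * Y (n₀ + (i + 1)) ^ (-k) := by
        rw [h4, Real.rpow_neg (hYpos _).le, hδ, ← div_eq_mul_inv,
          div_le_div_iff₀ (by positivity) (Real.rpow_pos_of_pos (hYpos _) _)]
        calc _ ≤ (k - 1) * (L * (2 * M) ^ θ * y (n₀ + i + 1)) := by gcongr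
          _ = _ := by ring
      push_cast
      linarith
  have h1 := key (n₀ + 1) le_rfl
  have h2 : 0 < Y (n₀ + (n₀ + 1)) ^ (1 - k) := Real.rpow_pos_of_pos (hYpos _) _
  have h3 : Y n₀ ^ (1 - k) ≤ z ^ (1 - k) :=
    Real.rpow_le_rpow_of_nonpos hz hlow (by linarith)
  have h4 : ((n₀ + 1 : ℕ) : ℝ) * δ = (k - 1) * M / (L * (2 * M) ^ θ) := by
    rw [hδ, hM]; push_cast; ring
  linarith

/-- Consequence of `discrete_blowup` with explicit powers of `ε`. -/
lemma discrete_blowup_rpow {k θ L c i : ℝ} (hk : 1 < k) (hθ : 0 ≤ θ) (hL : 0 < L) (hc : 0 < c)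
    (hi : 0 < 1 - θ + i * (k - 1)) : ∃ C : ℝ, 0 < C ∧ ∀ (ε : ℝ) (y : ℕ → ℝ) (n₀ : ℕ), 0 < ε →
      (∀ n, 0 ≤ y n) →
      c * ε ^ k * ((n₀ : ℝ) + 1) ^ i ≤ ∑ j ∈ Finset.range (n₀ + 1), y j →
      (∀ n ≤ 2 * n₀ + 1, (∑ j ∈ Finset.range (n + 1), y j) ^ k ≤ L * ((n : ℝ) + 1) ^ θ * y n) →
      (n₀ : ℝ) + 1 ≤ C * ε ^ (-(k * (k - 1) / (1 - θ + i * (k - 1)))) := by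
  set ω := 1 - θ + i * (k - 1) with hω
  have hk1 : 0 < k - 1 := by linarith
  refine ⟨((L * 2 ^ θ / (k - 1)) * c ^ (1 - k)) ^ (1 / ω), by positivity, ?_⟩
  intro ε y n₀ hε hy hlow hstep
  set M : ℝ := (n₀ : ℝ) + 1 with hM
  have hM0 : 0 < M := by positivity
  have h := discrete_blowup hk hθ hL hy (by positivity : 0 < c * ε ^ k * M ^ i) hlow hstep
  rw [← hM, div_le_iff₀ (by positivity), Real.mul_rpow (by positivity) (by positivity),
    Real.mul_rpow (by positivity) (by positivity), Real.mul_rpow (by positivity) hM0.le,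
    ← Real.rpow_mul hε.le, ← Real.rpow_mul hM0.le] at h
  have e1 : M = M ^ ω * (M ^ (i * (1 - k)) * M ^ θ) := by
    rw [← Real.rpow_add hM0, ← Real.rpow_add hM0, hω]
    conv_lhs => rw [← Real.rpow_one M]
    congr 1; ring
  have h2 : M ^ ω ≤ (L * 2 ^ θ / (k - 1)) * c ^ (1 - k) * ε ^ (k * (1 - k)) := by
    have hP : 0 < M ^ (i * (1 - k)) * M ^ θ := by positivity
    refine le_of_mul_le_mul_right ?_ hP
    rw [← e1]
    refine le_of_mul_le_mul_left (h.trans (le_of_eq ?_)) hk1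
    field_simp
  have h3 := Real.rpow_le_rpow (by positivity) h2 (by positivity : 0 ≤ 1 / ω)
  rw [← Real.rpow_mul hM0.le, mul_one_div_cancel hi.ne', Real.rpow_one,
    Real.mul_rpow (by positivity) (by positivity), ← Real.rpow_mul hε.le] at h3
  have e2 : k * (1 - k) * (1 / ω) = -(k * (k - 1) / ω) := by ring
  rwa [e2] at h3

lemma le_exp_of_dyadic {R₀ T C X : ℝ} (hR₀ : 1 ≤ R₀) (hC : 0 ≤ C) (hX : 1 ≤ X)
    (h : ∀ n : ℕ, R₀ * 2 ^ (2 * n + 1) < T → (n : ℝ) + 1 ≤ C * X) :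
    T ≤ Real.exp ((Real.log R₀ + 2 * C + 1) * X) := by
  set n := ⌊C * X⌋₊ with hn
  have h1 : C * X < (n : ℝ) + 1 := Nat.lt_floor_add_one _
  have h2 : (n : ℝ) ≤ C * X := Nat.floor_le (by positivity)
  have h3 : T ≤ R₀ * 2 ^ (2 * n + 1) := by
    by_contra hlt
    exact absurd (h n (not_le.1 hlt)) (not_le.2 h1)
  refine h3.trans ?_
  have h4 : R₀ * 2 ^ (2 * n + 1) = Real.exp (Real.log R₀ + (2 * n + 1) * Real.log 2) := by
    rw [Real.exp_add, Real.exp_log (by linarith), mul_comm ((2 * n + 1 : ℝ)), Real.exp_mul,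
      Real.exp_log (by norm_num)]
    norm_cast
  rw [h4]
  refine Real.exp_le_exp.2 ?_
  have h5 : Real.log 2 ≤ 1 := by linarith [Real.log_two_lt_d9]
  have h6 : 0 ≤ Real.log R₀ := Real.log_nonneg hR₀
  have h7 : (2 * (n : ℝ) + 1) * Real.log 2 ≤ (2 * n + 1) * 1 := by gcongr
  nlinarith

/-- Two nonlinear bounds for a pair and a lower bound for one of them combine to a power of `R`. -/
lemma combine_bounds {p q K R e₁ e₂ d ε X Y : ℝ} (hp : 1 < p) (hq : 1 < q) (hK : 0 < K) (hR : 0 < R)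
    (hε : 0 < ε) (hX : 0 ≤ X) (hY : 0 ≤ Y) (h1 : Y ^ p ≤ K * R ^ e₁ * X)
    (h2 : X ^ q ≤ K * R ^ e₂ * Y) (h3 : ε ^ p ≤ K * R ^ d * X) :
    ε ^ (p * (p * q - 1)) ≤ K ^ (p * q + p) * R ^ (d * (p * q - 1) + p * e₂ + e₁) := by
  have hp0 : 0 < p := by linarith
  have hpq : 0 < p * q - 1 := by nlinarith
  have hXpos : 0 < X := by
    rcases hX.eq_or_lt with h | h
    · rw [← h, mul_zero] at h3
      exact absurd h3 (not_le.2 (by positivity))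
    · exact h
  have h4 : X ^ (p * q) ≤ K ^ (p + 1) * R ^ (p * e₂ + e₁) * X := by
    calc X ^ (p * q) = (X ^ q) ^ p := by rw [← Real.rpow_mul hX, mul_comm]
      _ ≤ (K * R ^ e₂ * Y) ^ p := Real.rpow_le_rpow (by positivity) h2 hp0.le
      _ = K ^ p * R ^ (p * e₂) * Y ^ p := by
          rw [Real.mul_rpow (by positivity) hY, Real.mul_rpow hK.le (by positivity),
            ← Real.rpow_mul hR.le, mul_comm e₂]
      _ ≤ K ^ p * R ^ (p * e₂) * (K * R ^ e₁ * X) := by gcongr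
      _ = _ := by rw [Real.rpow_add_one hK.ne', Real.rpow_add hR]; ring
  have h5 : X ^ (p * q - 1) ≤ K ^ (p + 1) * R ^ (p * e₂ + e₁) := by
    rw [Real.rpow_sub_one hXpos.ne', div_le_iff₀ hXpos]; exact h4
  calc ε ^ (p * (p * q - 1)) = (ε ^ p) ^ (p * q - 1) := Real.rpow_mul hε.le _ _
    _ ≤ (K * R ^ d * X) ^ (p * q - 1) := Real.rpow_le_rpow (by positivity) h3 hpq.le
    _ = K ^ (p * q - 1) * R ^ (d * (p * q - 1)) * X ^ (p * q - 1) := by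
        rw [Real.mul_rpow (by positivity) hX, Real.mul_rpow hK.le (by positivity),
          ← Real.rpow_mul hR.le]
    _ ≤ K ^ (p * q - 1) * R ^ (d * (p * q - 1)) * (K ^ (p + 1) * R ^ (p * e₂ + e₁)) := by gcongr
    _ = _ := by
        have hK' : K ^ (p * q + p) = K ^ (p * q - 1) * K ^ (p + 1) := by
          rw [← Real.rpow_add hK]; congr 1; ring
        have hR' : R ^ (d * (p * q - 1) + p * e₂ + e₁) =
            R ^ (d * (p * q - 1)) * R ^ (p * e₂ + e₁) := by
          rw [← Real.rpow_add hR]; congr 1; ring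
        rw [hK', hR']
        exact mul_mul_mul_comm _ _ _ _

lemma le_of_rpow_mul_le {ε R F x K c : ℝ} (hε : 0 < ε) (hR : 0 < R) (hK : 0 < K) (hx : 0 < x)
    (h : ε ^ x ≤ K ^ c * R ^ (-(x * F))) : ε * R ^ F ≤ K ^ (c / x) := by
  have h1 : (ε * R ^ F) ^ x ≤ K ^ c := by
    rw [Real.mul_rpow hε.le (by positivity), ← Real.rpow_mul hR.le, mul_comm F]
    calc _ ≤ K ^ c * R ^ (-(x * F)) * R ^ (x * F) := by gcongr
      _ = _ := by rw [mul_assoc, ← Real.rpow_add hR]; simp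
  have h2 := Real.rpow_le_rpow (by positivity) h1 (by positivity : 0 ≤ 1 / x)
  rw [← Real.rpow_mul (by positivity), mul_one_div_cancel hx.ne', Real.rpow_one,
    ← Real.rpow_mul hK.le] at h2
  rwa [mul_one_div] at h2

section

variable {N : ℕ} {p q K R₀ : ℝ}

lemma LifespanBounds.mul_rpow_FSG1_le {ε T : ℝ} {A B : ℝ → ℝ} (h : LifespanBounds N p q K R₀ ε T A B)
    (hp : 1 < p) (hq : 1 < q) (hK : 0 < K) (hR₀ : 1 ≤ R₀) (hε : 0 < ε) {R : ℝ} (hR : R₀ ≤ R)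
    (hRT : R < T) : ε * R ^ FSG1 N p q ≤ K ^ ((p * q + p) / (p * (p * q - 1))) := by
  have hR0 : 0 < R := by linarith
  have hpq : 0 < p * q - 1 := by nlinarith
  refine le_of_rpow_mul_le hε hR0 hK (by positivity) ?_
  have h1 := combine_bounds hp hq hK hR0 hε (h.nonneg_A R) (h.nonneg_B R) (h.mass_B R hR hRT)
    (h.mass_A R hR hRT) (h.data_A R hR hRT)
  refine h1.trans (le_of_eq ?_)
  congr 2
  unfold FSG1
  have : p ≠ 0 := by positivity
  field_simp
  ring

lemma LifespanBounds.mul_rpow_FSG2_le {ε T : ℝ} {A B : ℝ → ℝ} (h : LifespanBounds N p q K R₀ ε T A B)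
    (hp : 1 < p) (hq : 1 < q) (hK : 0 < K) (hR₀ : 1 ≤ R₀) (hε : 0 < ε) {R : ℝ} (hR : R₀ ≤ R)
    (hRT : R < T) : ε * R ^ FSG2 N p q ≤ K ^ ((q * p + q) / (q * (q * p - 1))) := by
  have hR0 : 0 < R := by linarith
  have hpq : 0 < q * p - 1 := by nlinarith
  refine le_of_rpow_mul_le hε hR0 hK (by positivity) ?_
  have h1 := combine_bounds hq hp hK hR0 hε (h.nonneg_B R) (h.nonneg_A R) (h.mass_A R hR hRT)
    (h.mass_B R hR hRT) (h.data_B R hR hRT)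
  refine h1.trans (le_of_eq ?_)
  congr 2
  unfold FSG2
  have : q ≠ 0 := by positivity
  rw [mul_comm p q]
  field_simp
  ring

lemma le_of_mul_rpow_le {ε T C Γ : ℝ} (hε : 0 < ε) (hε1 : ε ≤ 1) (hC : 0 < C)
    (hΓ : 0 < Γ) (hR₀ : 1 ≤ R₀) (h : ∀ R, R₀ ≤ R → R < T → ε * R ^ Γ ≤ C) :
    T ≤ (R₀ + C ^ Γ⁻¹) * ε ^ (-Γ⁻¹) := by
  by_contra hlt
  obtain ⟨R, hR1, hR2⟩ := exists_between (not_le.1 hlt)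
  have hεΓ : 1 ≤ ε ^ (-Γ⁻¹) := Real.one_le_rpow_of_pos_of_le_one_of_nonpos hε hε1
    (by have : 0 < Γ⁻¹ := inv_pos.2 hΓ; linarith)
  have hCΓ : 0 < C ^ Γ⁻¹ := by positivity
  have h1 : R₀ ≤ R := by nlinarith
  have h2 := h R h1 hR2
  have h3 : C ^ Γ⁻¹ * ε ^ (-Γ⁻¹) < R := by nlinarith
  have h4 : (C ^ Γ⁻¹ * ε ^ (-Γ⁻¹)) ^ Γ < R ^ Γ :=
    Real.rpow_lt_rpow (by positivity) h3 hΓ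
  rw [Real.mul_rpow (by positivity) (by positivity), ← Real.rpow_mul hC.le, ← Real.rpow_mul hε.le,
    neg_mul, inv_mul_cancel₀ hΓ.ne', Real.rpow_one, Real.rpow_neg_one] at h4
  have h5 : C < ε * R ^ Γ := by
    calc C = ε * (C * ε⁻¹) := by field_simp
      _ < _ := by gcongr
  linarith

/-- Composition of the dyadic and the mass bounds. -/
lemma rpow_mul_le_of_comp {p q K R e d g x X S n : ℝ} (hq : 0 < q) (hK : 0 < K) (hR : 0 < R)
    (hS : 0 ≤ S) (hX : 0 ≤ X) (hn : 0 ≤ n) (h1 : S ^ p ≤ K * n * R ^ d * X)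
    (hS' : 0 ≤ S ^ p) (h2 : X ^ q ≤ K * R ^ e * x) (hg : q * d + e = g) :
    S ^ (p * q) ≤ K ^ (q + 1) * n ^ q * (R ^ g * x) := by
  calc S ^ (p * q) = (S ^ p) ^ q := Real.rpow_mul hS _ _
    _ ≤ (K * n * R ^ d * X) ^ q := Real.rpow_le_rpow hS' h1 hq.le
    _ = K ^ q * n ^ q * R ^ (q * d) * X ^ q := by
        rw [Real.mul_rpow (by positivity) hX, Real.mul_rpow (by positivity) (by positivity),
          Real.mul_rpow hK.le hn, ← Real.rpow_mul hR.le, mul_comm d]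
    _ ≤ K ^ q * n ^ q * R ^ (q * d) * (K * R ^ e * x) := by gcongr
    _ = _ := by rw [Real.rpow_add_one hK.ne', ← hg, Real.rpow_add hR]; ring

/-- The critical estimates, for abstract sequences of exponents. -/
lemma critical_bound (hp : 1 < p) (hq : 1 < q) (hK : 0 < K) (hR₀ : 1 ≤ R₀) :
    ∃ C : ℝ, 0 < C ∧ ∀ (ε T d e g : ℝ) (A B : ℝ → ℝ), 0 < ε → ε ≤ 1 → (∀ R, 0 ≤ A R) → (∀ R, 0 ≤ B R) →
      q * d + e = g → (∀ R, R₀ ≤ R → R < T → A R ^ q ≤ K * R ^ e * B R) →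
      (∀ R, R₀ ≤ R → R < T → ε ^ p ≤ K * R ^ d * A R) →
      (∀ n : ℕ, R₀ * 2 ^ n < T →
        (∑ j ∈ Finset.range (n + 1), (R₀ * 2 ^ j) ^ g * B (R₀ * 2 ^ j)) ^ p ≤
          K * ((n : ℝ) + 1) ^ (p - 1) * (R₀ * 2 ^ n) ^ d * A (R₀ * 2 ^ n)) →
      T ≤ Real.exp (C * ε ^ (-(p * (p * q - 1)))) ∧
      ((∀ n : ℕ, R₀ * 2 ^ n < T →
          (∑ j ∈ Finset.range (n + 1), (R₀ * 2 ^ j) ^ d * A (R₀ * 2 ^ j)) ^ q ≤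
            K * ((n : ℝ) + 1) ^ (q - 1) * (R₀ * 2 ^ n) ^ g * B (R₀ * 2 ^ n)) →
        T ≤ Real.exp (C * ε ^ (-(p * q - 1)))) := by
  have hp0 : 0 < p := by linarith
  have hq0 : 0 < q := by linarith
  have hk : 1 < p * q := by nlinarith
  have hθ : 0 ≤ (p - 1) * q := mul_nonneg (by linarith) hq0.le
  set L := K ^ (q + 1) with hL
  have hL0 : 0 < L := by positivity
  obtain ⟨C1, hC1, D1⟩ := discrete_blowup_rpow (k := p * q) (θ := (p - 1) * q) (L := L) (c := L⁻¹)
    (i := 1) hk hθ hL0 (inv_pos.2 hL0) (by nlinarith)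
  obtain ⟨C2, hC2, D2⟩ := discrete_blowup_rpow (k := p * q) (θ := (p - 1) * q) (L := L)
    (c := L⁻¹ / 2) (i := 2) hk hθ hL0 (by positivity) (by nlinarith)
  have hlogR : 0 ≤ Real.log R₀ := Real.log_nonneg hR₀
  refine ⟨Real.log R₀ + 2 * (C1 + C2) + 1, by positivity, ?_⟩
  intro ε T d e g A B hε hε1 hA hB hg hAB hdat hdy
  set r : ℕ → ℝ := fun j => R₀ * 2 ^ j with hr
  have hr0 : ∀ j, 0 < r j := fun j => by simp only [hr]; positivity
  have hrR : ∀ j, R₀ ≤ r j := fun j =>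
    le_mul_of_one_le_right (by linarith) (one_le_pow₀ (by norm_num))
  have hrm : ∀ {j n : ℕ}, j ≤ n → r j ≤ r n := fun {j n} hjn =>
    mul_le_mul_of_nonneg_left (pow_le_pow_right₀ (by norm_num) hjn) (by linarith)
  set y : ℕ → ℝ := fun j => r j ^ g * B (r j) with hy
  have hy0 : ∀ j, 0 ≤ y j := fun j => mul_nonneg (Real.rpow_nonneg (hr0 j).le _) (hB _)
  have hS0 : ∀ n, 0 ≤ ∑ j ∈ Finset.range (n + 1), y j := fun n => Finset.sum_nonneg fun j _ => hy0 j
  have hstep : ∀ n₀ : ℕ, r (2 * n₀ + 1) < T → ∀ n ≤ 2 * n₀ + 1,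
      (∑ j ∈ Finset.range (n + 1), y j) ^ (p * q) ≤ L * ((n : ℝ) + 1) ^ ((p - 1) * q) * y n := by
    intro n₀ hn₀ n hn
    have hnT : r n < T := (hrm hn).trans_lt hn₀
    have := rpow_mul_le_of_comp hq0 hK (hr0 n) (hS0 n) (hA _) (by positivity)
      (hdy n hnT) (Real.rpow_nonneg (hS0 n) _) (hAB (r n) (hrR n) hnT) hg
    rwa [← Real.rpow_mul (by positivity)] at this
  have hylow : ∀ n, r n < T → L⁻¹ * ε ^ (p * q) ≤ y n := by
    intro n hnT
    have h1 : ε ^ p ≤ K * 1 * r n ^ d * A (r n) := by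
      rw [mul_one]; exact hdat (r n) (hrR n) hnT
    have := rpow_mul_le_of_comp hq0 hK (hr0 n) hε.le (hA _) zero_le_one h1 (by positivity)
      (hAB (r n) (hrR n) hnT) hg
    rw [Real.one_rpow, mul_one] at this
    rwa [inv_mul_le_iff₀ hL0]
  have hεe : ∀ x : ℝ, 0 ≤ x → 1 ≤ ε ^ (-x) := fun x hx =>
    Real.one_le_rpow_of_pos_of_le_one_of_nonpos hε hε1 (by linarith)
  have hpq1 : 0 ≤ p * q - 1 := by linarith
  constructor
  · have hX := hεe (p * (p * q - 1)) (by positivity)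
    have := le_exp_of_dyadic (T := T) (C := C1) hR₀ hC1.le hX fun n₀ hn₀ => by
      have h1 := D1 ε y n₀ hε hy0 ?_ (hstep n₀ hn₀)
      · have e1 : p * q * (p * q - 1) / (1 - (p - 1) * q + 1 * (p * q - 1)) = p * (p * q - 1) := by
          rw [show 1 - (p - 1) * q + 1 * (p * q - 1) = q by ring]
          field_simp
        rwa [e1] at h1
      · rw [Real.rpow_one]
        calc _ = ∑ _j ∈ Finset.range (n₀ + 1), L⁻¹ * ε ^ (p * q) := by
              rw [Finset.sum_const, Finset.card_range, nsmul_eq_mul]; push_cast; ring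
          _ ≤ _ := Finset.sum_le_sum fun j hj => hylow j
              ((hrm (by have := Finset.mem_range.1 hj; omega)).trans_lt hn₀)
    refine this.trans (Real.exp_le_exp.2 ?_)
    gcongr
    linarith
  · intro hdy'
    have hX := hεe (p * q - 1) hpq1
    have hylow2 : ∀ n, r n < T → L⁻¹ * ε ^ (p * q) * ((n : ℝ) + 1) ≤ y n := by
      intro n hnT
      have h1 : K⁻¹ * ε ^ p * ((n : ℝ) + 1) ≤
          ∑ j ∈ Finset.range (n + 1), r j ^ d * A (r j) := by
        calc _ = ∑ _j ∈ Finset.range (n + 1), K⁻¹ * ε ^ p := by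
              rw [Finset.sum_const, Finset.card_range, nsmul_eq_mul]; push_cast; ring
          _ ≤ _ := Finset.sum_le_sum fun j hj => by
              have hjT : r j < T := (hrm (Nat.lt_succ_iff.1 (Finset.mem_range.1 hj))).trans_lt hnT
              rw [inv_mul_le_iff₀ hK, ← mul_assoc]
              exact hdat (r j) (hrR j) hjT
      have h2 := (Real.rpow_le_rpow (by positivity) h1 hq0.le).trans (hdy' n hnT)
      have hM0 : (0 : ℝ) < (n : ℝ) + 1 := by positivity
      rw [Real.mul_rpow (by positivity) hM0.le, Real.mul_rpow (by positivity) (by positivity),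
        ← Real.rpow_mul hε.le, Real.inv_rpow hK.le, Real.rpow_sub_one hM0.ne'] at h2
      rw [hL, Real.rpow_add_one hK.ne']
      have hMq : 0 < ((n : ℝ) + 1) ^ q := by positivity
      have h3 : (K ^ q)⁻¹ * ε ^ (p * q) * ((n : ℝ) + 1) ^ q ≤
          (K * y n / ((n : ℝ) + 1)) * ((n : ℝ) + 1) ^ q := by
        refine h2.trans (le_of_eq ?_)
        simp only [hy]
        ring
      have h4 := le_of_mul_le_mul_right h3 hMq
      rw [le_div_iff₀ hM0] at h4
      rw [mul_inv, mul_comm (K ^ q)⁻¹, mul_assoc, mul_assoc, inv_mul_le_iff₀ hK, ← mul_assoc]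
      exact h4
    have := le_exp_of_dyadic (T := T) (C := C2) hR₀ hC2.le hX fun n₀ hn₀ => by
      have h1 := D2 ε y n₀ hε hy0 ?_ (hstep n₀ hn₀)
      · refine h1.trans (mul_le_mul_of_nonneg_left ?_ hC2.le)
        refine Real.rpow_le_rpow_of_exponent_ge hε hε1 (neg_le_neg ?_)
        rw [show 1 - (p - 1) * q + 2 * (p * q - 1) = p * q + q - 1 by ring,
          div_le_iff₀ (by nlinarith)]
        nlinarith
      · rw [Real.rpow_two]
        have hgauss : ∀ n : ℕ, ((n : ℝ) + 1) ^ 2 / 2 ≤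
            ∑ j ∈ Finset.range (n + 1), ((j : ℝ) + 1) := by
          intro n
          induction n with
          | zero => norm_num
          | succ n ih =>
            rw [Finset.sum_range_succ]
            push_cast
            nlinarith [(Nat.cast_nonneg n : (0 : ℝ) ≤ n)]
        calc _ = L⁻¹ * ε ^ (p * q) * (((n₀ : ℝ) + 1) ^ 2 / 2) := by ring
          _ ≤ L⁻¹ * ε ^ (p * q) * ∑ j ∈ Finset.range (n₀ + 1), ((j : ℝ) + 1) :=
              mul_le_mul_of_nonneg_left (hgauss n₀) (by positivity)
          _ ≤ _ := by
              rw [Finset.mul_sum]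
              exact Finset.sum_le_sum fun j hj => hylow2 j
                ((hrm (by have := Finset.mem_range.1 hj; omega)).trans_lt hn₀)
    refine this.trans (Real.exp_le_exp.2 ?_)
    gcongr
    linarith

end

end
end WaveSystem

theorem mainTheorem1 (N : ℕ) (hN : 1 ≤ N) (p q a b : ℝ) (hp : 1 < p) (hq : 1 < q)
    (ha : 0 < a) (hb : 0 < b) (G₁ G₂ : ℝ → ℝ)
    (hG₁ : ContDiff ℝ 1 G₁) (hG₂ : ContDiff ℝ 1 G₂)
    (hG₁0 : G₁ 0 = 0) (hG₂0 : G₂ 0 = 0)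
    (hG₁lower : ∀ s : ℝ, a * |s| ^ q ≤ G₁ s) (hG₂lower : ∀ σ : ℝ, b * |σ| ^ p ≤ G₂ σ)
    (f₁ g₁ f₂ g₂ : WaveSystem.Space N → ℝ)
    (hf₁ : WaveSystem.IsTestFun f₁) (hg₁ : WaveSystem.IsTestFun g₁)
    (hf₂ : WaveSystem.IsTestFun f₂) (hg₂ : WaveSystem.IsTestFun g₂)
    (hIg₁ : 0 < ∫ x, g₁ x) (hIg₂ : 0 < ∫ x, g₂ x)
    (hΓ : 0 ≤ WaveSystem.GammaSG N p q) :
    ∃ ε₀ : ℝ, 0 < ε₀ ∧ ∃ C : ℝ, 0 < C ∧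
      ∀ ε : ℝ, 0 < ε → ε ≤ ε₀ → ∀ T : ℝ, 0 < T →
      ∀ u v : ℝ → WaveSystem.L2 N,
        WaveSystem.IsWeakSolution G₁ G₂ f₁ g₁ f₂ g₂ ε T u v →
        WaveSystem.SupportedInCone T (WaveSystem.dataRadius f₁ g₁ f₂ g₂) u →
        WaveSystem.SupportedInCone T (WaveSystem.dataRadius f₁ g₁ f₂ g₂) v →
        (0 < WaveSystem.GammaSG N p q →
          T ≤ C * ε ^ (-(WaveSystem.GammaSG N p q)⁻¹)) ∧
        (WaveSystem.FSG1 N p q = 0 → WaveSystem.FSG2 N p q < 0 →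
          T ≤ Real.exp (C * ε ^ (-(p * (p * q - 1))))) ∧
        (WaveSystem.FSG1 N p q < 0 → WaveSystem.FSG2 N p q = 0 →
          T ≤ Real.exp (C * ε ^ (-(q * (p * q - 1))))) ∧
        (WaveSystem.FSG1 N p q = 0 → WaveSystem.FSG2 N p q = 0 →
          T ≤ Real.exp (C * ε ^ (-(p * q - 1)))) := by
  obtain ⟨K, R₀, hK, hR₀, H⟩ := WaveSystem.exists_lifespanBounds hN hp hq ha hb hG₁0 hG₂0 hG₁lower
    hG₂lower hf₁ hg₁ hf₂ hg₂ hIg₁ hIg₂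
  obtain ⟨C1, hC1, E1⟩ := WaveSystem.critical_bound hp hq hK hR₀
  obtain ⟨C2, hC2, E2⟩ := WaveSystem.critical_bound hq hp hK hR₀
  have hp0 : p ≠ 0 := by positivity
  have hq0 : q ≠ 0 := by positivity
  have hpq : p * q - 1 ≠ 0 := by nlinarith
  set Cs : ℝ := max (K ^ ((p * q + p) / (p * (p * q - 1)))) (K ^ ((q * p + q) / (q * (q * p - 1))))
    with hCs
  have hCs0 : 0 < Cs := lt_max_of_lt_left (by positivity)
  set Γ := WaveSystem.GammaSG N p q with hΓdef
  have hC3 : 0 < R₀ + Cs ^ Γ⁻¹ := by positivity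
  refine ⟨1, one_pos, C1 + C2 + (R₀ + Cs ^ Γ⁻¹), by positivity, ?_⟩
  intro ε hε hε1 T hT u v hsol hu hv
  obtain ⟨A, B, hAB⟩ := H ε T hε hT u v hsol hu hv
  have hexp : ∀ C x : ℝ, C ≤ C1 + C2 + (R₀ + Cs ^ Γ⁻¹) →
      Real.exp (C * ε ^ x) ≤ Real.exp ((C1 + C2 + (R₀ + Cs ^ Γ⁻¹)) * ε ^ x) := fun C x hC =>
    Real.exp_le_exp.2 (mul_le_mul_of_nonneg_right hC (Real.rpow_nonneg hε.le _))
  have eF1 : WaveSystem.FSG1 N p q = 0 → (1 / p + 1 + q) = ((N : ℝ) - 1) / 2 * (p * q - 1) := by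
    intro h
    unfold WaveSystem.FSG1 at h
    rw [sub_eq_zero, ← div_eq_mul_inv, div_eq_iff hpq] at h
    exact h
  have eF2 : WaveSystem.FSG2 N p q = 0 → (2 + 1 / q) = ((N : ℝ) - 1) / 2 * (p * q - 1) := by
    intro h
    unfold WaveSystem.FSG2 at h
    rw [sub_eq_zero, ← div_eq_mul_inv, div_eq_iff hpq] at h
    exact h
  have key1 : WaveSystem.FSG1 N p q = 0 → q * (((N : ℝ) - 1) / 2 * p - N) +
      (-(2 * q) + ((N : ℝ) + 1) * (q - 1)) = 1 / p - 1 - ((N : ℝ) - 1) / 2 := by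
    intro h
    linear_combination -(eF1 h)
  have key2 : WaveSystem.FSG2 N p q = 0 → p * (((N : ℝ) - 1) / 2 * q - N) +
      (-p + ((N : ℝ) + 1) * (p - 1)) = 1 / q - ((N : ℝ) - 1) / 2 := by
    intro h
    linear_combination -(eF2 h)
  refine ⟨fun hpos => ?_, fun h1 _ => ?_, fun _ h2 => ?_, fun h1 h2 => ?_⟩
  · have hb' : ∀ R, R₀ ≤ R → R < T → ε * R ^ Γ ≤ Cs := by
      intro R hR hRT
      rcases max_choice (WaveSystem.FSG1 N p q) (WaveSystem.FSG2 N p q) with h | h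
      · rw [hΓdef, WaveSystem.GammaSG, h]
        exact (hAB.mul_rpow_FSG1_le hp hq hK hR₀ hε hR hRT).trans (le_max_left _ _)
      · rw [hΓdef, WaveSystem.GammaSG, h]
        exact (hAB.mul_rpow_FSG2_le hp hq hK hR₀ hε hR hRT).trans (le_max_right _ _)
    refine (WaveSystem.le_of_mul_rpow_le hε hε1 hCs0 hpos hR₀ hb').trans ?_
    exact mul_le_mul_of_nonneg_right (by linarith) (Real.rpow_nonneg hε.le _)
  · refine ((E1 ε T _ _ _ A B hε hε1 hAB.nonneg_A hAB.nonneg_B (key1 h1) hAB.mass_A hAB.data_A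
      hAB.dyadic_A).1).trans (hexp _ _ (by linarith))
  · have := (E2 ε T _ _ _ B A hε hε1 hAB.nonneg_B hAB.nonneg_A (key2 h2) hAB.mass_B hAB.data_B
      hAB.dyadic_B).1
    rw [mul_comm q p] at this
    exact this.trans (hexp _ _ (by linarith))
  · have h3 := eF1 h1
    have h4 := eF2 h2
    have h5 : q * (1 / q) = 1 := mul_one_div_cancel hq0
    have h6 : p * (1 / p) = 1 := mul_one_div_cancel hp0
    have hm1 : ((N : ℝ) - 1) / 2 * (q - 1) = 1 / p := mul_left_cancel₀ hpq <| by
      linear_combination -(q - 1) * h4 + h5 - q * h6 + (h3 - h4)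
    have hm2 : ((N : ℝ) - 1) / 2 * (p - 1) = 1 + 1 / q := mul_left_cancel₀ hpq <| by
      linear_combination -(p - 1) * h4 - p * h5 - p * (h3 - h4) + h6
    have hd1 : ((N : ℝ) - 1) / 2 * p - N = 1 / q - ((N : ℝ) - 1) / 2 := by
      linear_combination hm2
    have hd2 : ((N : ℝ) - 1) / 2 * q - N = 1 / p - 1 - ((N : ℝ) - 1) / 2 := by
      linear_combination hm1
    refine ((E1 ε T _ _ _ A B hε hε1 hAB.nonneg_A hAB.nonneg_B (key1 h1) hAB.mass_A hAB.data_A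
      hAB.dyadic_A).2 ?_).trans (hexp _ _ (by linarith))
    intro n hn
    have := hAB.dyadic_B n hn
    rwa [hd2, ← hd1] at this
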